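/- There is an algorithm that enumerates all consistent extensions of a given MPDAG with linear-time delay. Here a graph $G=(V,E)$ has $V=\{0,\dots,n-1\}$ and $E\subseteq V\times V$ without self-loops; $u-v$ is an undirected edge if $(u,v),(v,u)\in E$, and $u\to v$ is a directed edge if $(u,v)\in E$ and $(v,u)\notin E$; $m$ is the number of edges, directed or undirected, an undirected edge being counted once. A PDAG is such a graph without directed cycle. A DAG is a PDAG all of whose edges are directed. An MPDAG is a PDAG to which none of the four Meek rules applies, i.e. for distinct vertices $a,b,c,d$ it contains none of the following configurations: (R1) $a\to b-c$ with $a,c$ non-adjacent; (R2) $a\to b\to c$ and $a-c$; (R3) $a-b$, $a-c$, $a-d$, $b\to c\leftarrow d$ with $b,d$ non-adjacent; (R4) $a-b$, $a-c$, $a-d$, $d\to c\to b$ with $b,d$ non-adjacent. A v-structure is an ordered triple $(u,c,v)$ with $u\to c\leftarrow v$, $u\ne v$ and $u,v$ non-adjacent. A consistent extension of $G$ is a DAG with the same skeleton and the same v-structures as $G$ that contains every directed edge of $G$. Precisely: there are one random-access machine program (each assignment, addition, truncated subtraction, indirect memory access, output of a word, mark of the end of a solution, or comparison is one step) and constants $C,k$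 such that the following holds for every MPDAG $G$. The input is $n$, the number of directed edges, the number of undirected edges, and a list of the directed and a list of the undirected edges, in any order, each edge once. On a machine whose words are the numbers below $(n+m+2)^k$ (that is, word length $O(\log(n+m+2))$), the program halts after having written every consistent extension of $G$ exactly once and nothing else, each as a list of its edges (in some order, each edge once). At most $C\,(n+m+1)$ steps pass from the start to the completion of the first extension, between the completions of any two consecutive extensions, and from the completion of the last one to the halt. If $G$ has no consistent extension, the program halts within $C\,(n+m+1)$ steps without output. -/

import Mathlib

/-! Partially directed graphs, consistent extensions, and a word RAM with a step count. -/

namespace CausalGraph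

variable {V : Type*}

/-- `u → v`: exactly the orientation `(u, v)` is an edge. -/
def DirEdge (G : Digraph V) (u v : V) : Prop := G.Adj u v ∧ ¬ G.Adj v u

/-- `u - v`: both orientations are edges. -/
def UndirEdge (G : Digraph V) (u v : V) : Prop := G.Adj u v ∧ G.Adj v u

/-- `u` and `v` are linked by an edge of any type. -/
def Adjacent (G : Digraph V) (u v : V) : Prop := G.Adj u v ∨ G.Adj v u

/-- The skeleton: every edge is replaced by an undirected one. -/
def skel (G : Digraph V) : SimpleGraph V := G.toSimpleGraphInclusive

/-- There is no directed cycle `v → ⋯ → v`. -/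
def NoDirectedCycle (G : Digraph V) : Prop := ∀ v, ¬ Relation.TransGen (DirEdge G) v v

/-- `(u, c, v)` induces the subgraph `u → c ← v`. -/
def VStructure (G : Digraph V) (u c v : V) : Prop :=
  u ≠ v ∧ DirEdge G u c ∧ DirEdge G v c ∧ ¬ Adjacent G u v

/-- A partially directed acyclic graph: no self-loop and no directed cycle. -/
structure IsPDAG (G : Digraph V) : Prop where
  loopless : ∀ v, ¬ G.Adj v v
  noDirectedCycle : NoDirectedCycle G

/-- A DAG: an acyclic graph all of whose edges are directed. -/
structure IsDAG (G : Digraph V) : Prop where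
  allDirected : ∀ u v, G.Adj u v → ¬ G.Adj v u
  noDirectedCycle : NoDirectedCycle G

/-- The premise of the first Meek rule: the induced subgraph `a → b - c`. -/
def MeekR1 (G : Digraph V) (a b c : V) : Prop :=
  a ≠ c ∧ DirEdge G a b ∧ UndirEdge G b c ∧ ¬ Adjacent G a c

/-- The premise of the second Meek rule: `a → b → c` and `a - c`. -/
def MeekR2 (G : Digraph V) (a b c : V) : Prop :=
  DirEdge G a b ∧ DirEdge G b c ∧ UndirEdge G a c

/-- The premise of the third Meek rule: `a - b`, `a - c`, `a - d`, `b → c ← d`,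
with `b` and `d` distinct and not adjacent. -/
def MeekR3 (G : Digraph V) (a b c d : V) : Prop :=
  b ≠ d ∧ UndirEdge G a b ∧ UndirEdge G a c ∧ UndirEdge G a d ∧
    DirEdge G b c ∧ DirEdge G d c ∧ ¬ Adjacent G b d

/-- The premise of the fourth Meek rule: `a - b`, `a - c`, `a - d`, `d → c → b`,
with `b` and `d` distinct and not adjacent. -/
def MeekR4 (G : Digraph V) (a b c d : V) : Prop :=
  b ≠ d ∧ UndirEdge G a b ∧ UndirEdge G a c ∧ UndirEdge G a d ∧
    DirEdge G d c ∧ DirEdge G c b ∧ ¬ Adjacent G b d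

/-- A maximally oriented PDAG: a PDAG to which none of the four Meek rules applies. -/
structure IsMPDAG (G : Digraph V) : Prop extends IsPDAG G where
  closedR1 : ∀ a b c, ¬ MeekR1 G a b c
  closedR2 : ∀ a b c, ¬ MeekR2 G a b c
  closedR3 : ∀ a b c d, ¬ MeekR3 G a b c d
  closedR4 : ∀ a b c d, ¬ MeekR4 G a b c d

/-- `D` is a DAG that orients the undirected edges of `G` (the directed ones are kept) and has
the same v-structures as `G`. -/
structure IsConsistentExtension (D G : Digraph V) : Prop where
  isDAG : IsDAG D
  sameSkeleton : skel D = skel G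
  keepsDirected : ∀ u v, DirEdge G u v → D.Adj u v
  sameVStructures : ∀ u c v, VStructure D u c v ↔ VStructure G u c v

/-- `dirE` and `undE` list the directed and the undirected edges of `G`, in any order, every edge
exactly once (an undirected edge `u - v` appears as just one of the pairs `(u, v)`, `(v, u)`). -/
structure IsEdgeListing {n : ℕ} (G : Digraph (Fin n)) (dirE undE : List (Fin n × Fin n)) :
    Prop where
  nodup_dir : dirE.Nodup
  mem_dir : ∀ u v, (u, v) ∈ dirE ↔ DirEdge G u v
  nodup_und : (undE.map fun e => s(e.1, e.2)).Nodup
  mem_und : ∀ u v, ((u, v) ∈ undE ∨ (v, u) ∈ undE) ↔ UndirEdge G u v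

/-- A list of pairs written as the word sequence `u₁, v₁, u₂, v₂, …`. -/
def edgeWords {n : ℕ} (es : List (Fin n × Fin n)) : List ℕ :=
  es.flatMap fun e => [(e.1 : ℕ), (e.2 : ℕ)]

/-- The input: the number of vertices, the numbers of directed and of undirected edges, the
directed edges, the undirected edges. -/
def inputWords {n : ℕ} (dirE undE : List (Fin n × Fin n)) : List ℕ :=
  [n, dirE.length, undE.length] ++ edgeWords dirE ++ edgeWords undE

/-- The word sequence `ws` is the list of the edges of `D`, in some order, each exactly once. -/
def Encodes {n : ℕ} (ws : List ℕ) (D : Digraph (Fin n)) : Prop :=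
  ∃ es : List (Fin n × Fin n),
    es.Nodup ∧ (∀ u v, (u, v) ∈ es ↔ D.Adj u v) ∧ ws = edgeWords es

end CausalGraph

namespace WordRAM

/-- Comparison of two registers. -/
inductive Test where
  | lt (x y : ℕ)
  | eq (x y : ℕ)

/-- Programs of a random-access machine with registers `0, 1, 2, …`, a memory array with indirect
addressing, and an output stream. The arguments `x y z` are register numbers. -/
inductive Prog where
  /-- do nothing -/
  | skip
  /-- register `x` gets the constant `c` -/
  | const (x c : ℕ)
  /-- register `x` gets the content of register `y` -/
  | move (x y : ℕ)
  /-- register `x` gets the sum of registers `y` and `z` -/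
  | add (x y z : ℕ)
  /-- register `x` gets the truncated difference of registers `y` and `z` -/
  | sub (x y z : ℕ)
  /-- register `x` gets the memory cell whose address is in register `y` -/
  | load (x y : ℕ)
  /-- the memory cell whose address is in register `x` gets the content of register `y` -/
  | store (x y : ℕ)
  /-- append the content of register `x` to the output stream -/
  | write (x : ℕ)
  /-- mark the end of the solution that is being written -/
  | finish
  | seq (p q : Prog)
  | ite (b : Test) (p q : Prog)
  | loop (b : Test) (p : Prog)

structure State where
  reg : ℕ → ℕ
  mem : ℕ → ℕ

/-- All registers are zero; the memory holds the input words from address `0` on, and zeros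
elsewhere. -/
def init (ws : List ℕ) : State where
  reg := fun _ => 0
  mem := fun i => ws.getD i 0

def State.setReg (s : State) (x a : ℕ) : State := { s with reg := Function.update s.reg x a }

def State.setMem (s : State) (i a : ℕ) : State := { s with mem := Function.update s.mem i a }

def Test.Holds (s : State) : Test → Prop
  | .lt x y => s.reg x < s.reg y
  | .eq x y => s.reg x = s.reg y

/-- What is visible of one machine step: nothing, one output word, or the mark that a solution is
complete. -/
inductive Event where
  | silent
  | word (a : ℕ)
  | done

/-- `Exec W p s t s'`: on a machine whose words are the numbers below `W`, program `p` started in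
state `s` halts in state `s'`, and `t` is the sequence of its steps. Each elementary instruction
and each test is one step, so `t.length` is the running time. An instruction whose result is
no machine word cannot be executed. -/
inductive Exec (W : ℕ) : Prog → State → List Event → State → Prop where
  | skip (s) : Exec W .skip s [.silent] s
  | const (s x c) : c < W → Exec W (.const x c) s [.silent] (s.setReg x c)
  | move (s x y) : Exec W (.move x y) s [.silent] (s.setReg x (s.reg y))
  | add (s x y z) : s.reg y + s.reg z < W →
      Exec W (.add x y z) s [.silent] (s.setReg x (s.reg y + s.reg z))
  | sub (s x y z) : Exec W (.sub x y z) s [.silent] (s.setReg x (s.reg y - s.reg z))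
  | load (s x y) : Exec W (.load x y) s [.silent] (s.setReg x (s.mem (s.reg y)))
  | store (s x y) : Exec W (.store x y) s [.silent] (s.setMem (s.reg x) (s.reg y))
  | write (s x) : Exec W (.write x) s [.word (s.reg x)] s
  | finish (s) : Exec W .finish s [.done] s
  | seq {p q s₁ s₂ s₃ t₁ t₂} : Exec W p s₁ t₁ s₂ → Exec W q s₂ t₂ s₃ →
      Exec W (.seq p q) s₁ (t₁ ++ t₂) s₃
  | ite_true {b p q s s' t} : b.Holds s → Exec W p s t s' →
      Exec W (.ite b p q) s (.silent :: t) s'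
  | ite_false {b p q s s' t} : ¬ b.Holds s → Exec W q s t s' →
      Exec W (.ite b p q) s (.silent :: t) s'
  | loop_true {b p s₁ s₂ s₃ t₁ t₂} : b.Holds s₁ → Exec W p s₁ t₁ s₂ →
      Exec W (.loop b p) s₂ t₂ s₃ → Exec W (.loop b p) s₁ (.silent :: (t₁ ++ t₂)) s₃
  | loop_false {b p s} : ¬ b.Holds s → Exec W (.loop b p) s [.silent] s

/-- A program has at most one halting run from a given state. -/
theorem Exec.unique {W : ℕ} {p : Prog} {s s₁ s₂ : State} {t₁ t₂ : List Event}
    (h₁ : Exec W p s t₁ s₁) (h₂ : Exec W p s t₂ s₂) : t₁ = t₂ ∧ s₁ = s₂ := by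
  induction h₁ generalizing t₂ s₂ with
  | seq _ _ ih₁ ih₂ =>
    cases h₂ with
    | seq a b => obtain ⟨rfl, rfl⟩ := ih₁ a; obtain ⟨rfl, rfl⟩ := ih₂ b; exact ⟨rfl, rfl⟩
  | ite_true hb _ ih =>
    cases h₂ with
    | ite_true _ a => obtain ⟨rfl, rfl⟩ := ih a; exact ⟨rfl, rfl⟩
    | ite_false hn _ => exact absurd hb hn
  | ite_false hb _ ih =>
    cases h₂ with
    | ite_true hn _ => exact absurd hn hb
    | ite_false _ a => obtain ⟨rfl, rfl⟩ := ih a; exact ⟨rfl, rfl⟩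
  | loop_true hb _ _ ih₁ ih₂ =>
    cases h₂ with
    | loop_true _ a b => obtain ⟨rfl, rfl⟩ := ih₁ a; obtain ⟨rfl, rfl⟩ := ih₂ b; exact ⟨rfl, rfl⟩
    | loop_false hn => exact absurd hb hn
  | loop_false hb =>
    cases h₂ with
    | loop_true hn _ _ => exact absurd hn hb
    | loop_false _ => exact ⟨rfl, rfl⟩
  | _ => cases h₂; exact ⟨rfl, rfl⟩

/-- The words written during a sequence of steps. -/
def written (t : List Event) : List ℕ :=
  t.filterMap fun
    | .word a => some a
    | _ => none

/-- `OutputsWithDelay d t sols`: during the run with step sequence `t`, exactly the solutions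
`sols` are written, in this order, and at most `d` steps pass from the start to the first completed
solution, between any two consecutive ones, and from the last one (or from the start, if there is
none) to the halt. -/
inductive OutputsWithDelay (d : ℕ) : List Event → List (List ℕ) → Prop where
  | halt {t} : Event.done ∉ t → written t = [] → t.length ≤ d → OutputsWithDelay d t []
  | next {t t' sols} : Event.done ∉ t → (t ++ [Event.done]).length ≤ d →
      OutputsWithDelay d t' sols →
      OutputsWithDelay d (t ++ [Event.done] ++ t') (written t :: sols)

end WordRAM

set_option linter.constructorNameAsVariable false
set_option linter.unusedSimpArgs false
set_option linter.unusedSectionVars false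

/-! Call the connected components of the undirected part of `G` buckets. By the Meek rules a
v-structure at one vertex of a bucket is a v-structure at every vertex of it, so its parents lie
outside. Hence a consistent extension `D` restricts on each bucket to an acyclic orientation in
which the parents of a vertex are pairwise adjacent. A graph with such an orientation is chordal in
the form of `IsMoralOrientation.no_hole`, and the classical argument for maximum cardinality search
then makes search orders perfect (`IsMoralOrientation.perfect`).

The search visits only ready vertices, those whose directed parents have all been visited, and among
them one of largest label, the label of `y` being the number of visited vertices with an edge to
`y`. If `G` has any extension, orienting the undirected edges along an arbitrary complete search
order gives an extension (`moral_of_isTop`, `orient_isConsistentExtension`). So the search tree has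
no dead ends, and a test at the first leaf decides whether there are extensions at all. By
`moral_of_last_parent` this test need only compare every undirected parent of a vertex with the last
one, which takes linear time.

Different orders may give the same extension. Therefore, below a node where `v` would be chosen, the
branches are the candidates: the vertices linked to `v` by undirected edges through ready vertices
with the label of `v`. In an extension compatible with the path so far, exactly one candidate `x`
has all its undirected edges to unvisited vertices directed away from `x` (`exists_cand_leavesTo`,
`leavesTo_unique`). Thus every extension belongs to exactly one leaf.

For the delay, the ready vertices are kept in buckets by label, with a pointer to the largest label.
A descent to a leaf is linear by a potential argument: visiting a vertex raises the label of a ready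
vertex by at most one, and the label of a vertex that becomes ready is paid for by the edges into it
(`lab_le_freeIn`, `descPot_insert`). The candidates of a level are collected only when the search
returns to it. If the current vertex is the only candidate, collecting costs no more than scanning
its edges (`ascendBody_wp_of_empty`). Otherwise there is a branch to take and the ascent ends, so
the price of a large candidate set is paid once per ascent (`ascendBody_wp_of_mem`). Ascent, descent
and output together take O(n+m) steps.

The algorithm is written in a small language with variables and arrays that is compiled to the
machine; `wp` bounds the steps of a command together with its effect. Memory outside the input is
zero at the start, so tables with n rows of length n are available without initialisation, and
multiplication by n is done through the table `row`. -/

namespace CausalGraph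

/-! ### Orderings of chordal graphs -/

section PerfectOrientation

theorem reflTransGen_mono {V : Type*} {r p : V → V → Prop} (h : ∀ x y, r x y → p x y) {a b : V}
    (hab : Relation.ReflTransGen r a b) : Relation.ReflTransGen p a b := by
  induction hab with
  | refl => exact .refl
  | tail _ h2 ih => exact ih.tail (h _ _ h2)

theorem reflTransGen_symm {V : Type*} {r : V → V → Prop} (h : ∀ x y, r x y → r y x) {a b : V}
    (hab : Relation.ReflTransGen r a b) : Relation.ReflTransGen r b a := by
  induction hab with
  | refl => exact .refl
  | tail _ h2 ih => exact .head (h _ _ h2) ih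

variable {V : Type*}

/-- `A` is an acyclic orientation of the graph `H` in which the parents of a vertex are pairwise
adjacent. -/
structure IsMoralOrientation (H A : V → V → Prop) : Prop where
  symm : ∀ x y, H x y → H y x
  total : ∀ x y, H x y → A x y ∨ A y x
  sub : ∀ x y, A x y → H x y
  acyclic : ∀ x, ¬ Relation.TransGen A x x
  moral : ∀ u v c, A u c → A v c → u ≠ v → H u v

variable {H A : V → V → Prop}

/-- The vertices reached from `u` along `A` outside the neighbourhood of `a` are closed under `H`
outside that neighbourhood: an edge oriented backwards has, by morality, a companion edge at the
predecessor, and at `u` itself the parent `a` rules it out. So the path is absorbed, and the same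
descent gives a reached `z` with an arc into `d`. An arc from `a` to `d` would make `a` and `z`
adjacent, an arc from `d` to `a` would close a cycle. -/
theorem IsMoralOrientation.no_hole_aux (h : IsMoralOrientation H A) {a u d p q : V}
    (hau : A a u) (had : H a d) (hud : u ≠ d) (hnud : ¬ H u d)
    (hp : ¬ H a p ∧ p ≠ a) (hup : H u p) (hqd : H q d)
    (hpq : Relation.ReflTransGen (fun x y => H x y ∧ ¬ H a y ∧ y ≠ a) p q) : False := by
  have hS : ∀ x, Relation.ReflTransGen (fun x y => A x y ∧ ¬ H a y ∧ y ≠ a) u x →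
      x = u ∨ (¬ H a x ∧ x ≠ a) := by
    intro x hx
    cases hx with
    | refl => exact Or.inl rfl
    | tail _ h2 => exact Or.inr h2.2
  have l1 : ∀ x, Relation.ReflTransGen (fun x y => A x y ∧ ¬ H a y ∧ y ≠ a) u x →
      ∀ y, ¬ H a y → y ≠ a → H x y →
      Relation.ReflTransGen (fun x y => A x y ∧ ¬ H a y ∧ y ≠ a) u y := by
    intro x hx
    induction hx with
    | refl =>
      intro y hy1 hy2 hxy
      rcases h.total _ _ hxy with e | e
      · exact Relation.ReflTransGen.single ⟨e, hy1, hy2⟩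
      · exact absurd (h.moral _ _ _ hau e hy2.symm) hy1
    | @tail b c hb hbc ih =>
      intro y hy1 hy2 hxy
      rcases h.total _ _ hxy with e | e
      · exact (hb.tail hbc).tail ⟨e, hy1, hy2⟩
      · by_cases hby : b = y
        · exact hby ▸ hb
        · exact ih y hy1 hy2 (h.moral _ _ _ hbc.1 e hby)
  have l2 : ∀ x, Relation.ReflTransGen (fun x y => A x y ∧ ¬ H a y ∧ y ≠ a) u x → H x d →
      ∃ z, Relation.ReflTransGen (fun x y => A x y ∧ ¬ H a y ∧ y ≠ a) u z ∧ ¬ H a z ∧ z ≠ a ∧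
        A z d := by
    intro x hx
    induction hx with
    | refl => intro hxd; exact absurd hxd hnud
    | @tail b c hb hbc ih =>
      intro hcd
      rcases h.total _ _ hcd with e | e
      · exact ⟨c, hb.tail hbc, hbc.2.1, hbc.2.2, e⟩
      · have hbd : b ≠ d := by
          rintro rfl
          rcases hS _ hb with e' | e'
          · exact hud e'.symm
          · exact e'.1 had
        exact ih (h.moral _ _ _ hbc.1 e hbd)
  have hq : Relation.ReflTransGen (fun x y => A x y ∧ ¬ H a y ∧ y ≠ a) u q := by
    clear hqd
    induction hpq with
    | refl => exact l1 u .refl p hp.1 hp.2 hup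
    | tail _ h2 ih => exact l1 _ ih _ h2.2.1 h2.2.2 h2.1
  obtain ⟨z, hz, hz1, hz2, hzd⟩ := l2 q hq hqd
  rcases h.total _ _ had with e | e
  · exact hz1 (h.moral _ _ _ e hzd hz2.symm)
  · have h1 : Relation.ReflTransGen A u z := reflTransGen_mono (fun _ _ h => h.1) hz
    exact h.acyclic a (((Relation.TransGen.single hau).trans_left h1).tail hzd |>.tail e)

/-- Two nonadjacent neighbours of `a` are not linked by a path that avoids the neighbourhood
of `a`. -/
theorem IsMoralOrientation.no_hole (h : IsMoralOrientation H A) {a u d p q : V}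
    (hau : H a u) (had : H a d) (hud : u ≠ d) (hnud : ¬ H u d)
    (hp : ¬ H a p ∧ p ≠ a) (hup : H u p) (hqd : H q d)
    (hpq : Relation.ReflTransGen (fun x y => H x y ∧ ¬ H a y ∧ y ≠ a) p q) : False := by
  rcases h.total _ _ hau with e | e
  · exact h.no_hole_aux e had hud hnud hp hup hqd hpq
  rcases h.total _ _ had with e' | e'
  · have hq : ∀ z, Relation.ReflTransGen (fun x y => H x y ∧ ¬ H a y ∧ y ≠ a) p z →
        (¬ H a z ∧ z ≠ a) ∧
        Relation.ReflTransGen (fun x y => H x y ∧ ¬ H a y ∧ y ≠ a) z p := by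
      intro z hz
      induction hz with
      | refl => exact ⟨hp, .refl⟩
      | tail _ h2 ih => exact ⟨h2.2, .head ⟨h.symm _ _ h2.1, ih.1⟩ ih.2⟩
    exact h.no_hole_aux e' hau hud.symm (fun h' => hnud (h.symm _ _ h')) (hq q hpq).1
      (h.symm _ _ hqd) (h.symm _ _ hup) (hq q hpq).2
  · exact hnud (h.moral _ _ _ e e' hud)

/-- Let `a` be the earlier of the two and `u'` the last neighbour of `a` on the path. The search
property for `a`, `b`, `u'` yields `d` before `b`, adjacent to `b` but not to `u'`. If `d` is
adjacent to `a`, the rest of the path is a hole at `a`; otherwise `a`, `d` is a pair with smaller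
maximum, still linked by a late path through `b`. -/
theorem IsMoralOrientation.no_late_path (h : IsMoralOrientation H A) {τ : V → ℕ}
    (hτ : Function.Injective τ)
    (hP : ∀ a b c, τ a < τ b → τ b < τ c → H a c → ¬ H a b → Relation.ReflTransGen H b c →
      ∃ d, τ d < τ b ∧ H d b ∧ ¬ H d c) :
    ∀ (N : ℕ) (a b u w : V), max (τ a) (τ b) = N → a ≠ b → ¬ H a b → H a u → H w b → N < τ u →
      Relation.ReflTransGen (fun x y => H x y ∧ N < τ x ∧ N < τ y) u w → False := by
  intro N
  induction N using Nat.strong_induction_on with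
  | _ N ih =>
  have main : ∀ (a b u w : V), τ a < τ b → τ b = N → ¬ H a b → H a u → H w b →
      N < τ u → Relation.ReflTransGen (fun x y => H x y ∧ N < τ x ∧ N < τ y) u w → False := by
    intro a b u w hab hN hnab hau hwb hu huw
    -- the last neighbour of `a` on the path
    have ext : ∀ z, Relation.ReflTransGen (fun x y => H x y ∧ N < τ x ∧ N < τ y) u z →
        ∃ u', H a u' ∧ N < τ u' ∧
          (u' = z ∨ ∃ p, H u' p ∧ N < τ p ∧ (¬ H a p ∧ p ≠ a) ∧
            Relation.ReflTransGen (fun x y => H x y ∧ N < τ x ∧ N < τ y) p z ∧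
            Relation.ReflTransGen (fun x y => H x y ∧ ¬ H a y ∧ y ≠ a) p z) := by
      intro z hz
      induction hz with
      | refl => exact ⟨u, hau, hu, Or.inl rfl⟩
      | @tail y z hy hyz ih2 =>
        by_cases haz : H a z
        · exact ⟨z, haz, hyz.2.2, Or.inl rfl⟩
        have hza : z ≠ a := by rintro rfl; have := hyz.2.2; omega
        obtain ⟨u', h1, h2, h3⟩ := ih2
        refine ⟨u', h1, h2, Or.inr ?_⟩
        rcases h3 with rfl | ⟨p, h4, h5, h6, h7, h8⟩
        · exact ⟨z, hyz.1, hyz.2.2, ⟨haz, hza⟩, .refl, .refl⟩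
        · exact ⟨p, h4, h5, h6, h7.tail hyz, h8.tail ⟨hyz.1, haz, hza⟩⟩
    obtain ⟨u', hau', hu', hp⟩ := ext w huw
    have hba : b ≠ a := by rintro rfl; omega
    -- normal form: a nonempty path from `u'` to `b` after `u'`
    obtain ⟨p, hu'p, hpS, hpb, hconn, hlate⟩ : ∃ p, H u' p ∧ (¬ H a p ∧ p ≠ a) ∧
        Relation.ReflTransGen (fun x y => H x y ∧ ¬ H a y ∧ y ≠ a) p b ∧
        Relation.ReflTransGen H b u' ∧
        (∀ M, M < N → Relation.ReflTransGen (fun x y => H x y ∧ M < τ x ∧ M < τ y) u' b) := by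
      have hrev : ∀ x y, Relation.ReflTransGen H x y → Relation.ReflTransGen H y x :=
        fun x y hxy => reflTransGen_symm (fun _ _ h' => h.symm _ _ h') hxy
      rcases hp with rfl | ⟨p, h4, h5, h6, h7, h8⟩
      · exact ⟨b, hwb, ⟨hnab, hba⟩, .refl, .single (h.symm _ _ hwb),
          fun M hM => .single ⟨hwb, by omega, by omega⟩⟩
      · refine ⟨p, h4, h6, h8.tail ⟨hwb, hnab, hba⟩, ?_, ?_⟩
        · exact hrev _ _ ((Relation.ReflTransGen.head h4 (reflTransGen_mono (fun _ _ h => h.1) h7)).tail hwb)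
        · intro M hM
          have h7' : Relation.ReflTransGen (fun x y => H x y ∧ M < τ x ∧ M < τ y) p w :=
            reflTransGen_mono (fun x y hxy => ⟨hxy.1, by omega, by omega⟩) h7
          have hw : N < τ w := by
            rcases Relation.ReflTransGen.cases_tail h7 with e | ⟨_, _, e⟩
            · rw [e]; exact h5
            · exact e.2.2
          exact (Relation.ReflTransGen.head ⟨h4, by omega, by omega⟩ h7').tail
            ⟨hwb, by omega, by omega⟩
    obtain ⟨d, hdb, hHdb, hndu⟩ := hP a b u' hab (by omega) hau' hnab hconn
    by_cases hda : H d a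
    · exact h.no_hole hau' (h.symm _ _ hda) (by rintro rfl; omega)
        (fun h' => hndu (h.symm _ _ h')) hpS hu'p (h.symm _ _ hHdb) hpb
    · have hlt : max (τ a) (τ d) < N := by omega
      exact ih _ hlt a d u' b rfl (by rintro rfl; exact hnab hHdb)
        (fun h' => hda (h.symm _ _ h')) hau' (h.symm _ _ hHdb) (by omega) (hlate _ hlt)
  intro a b u w hN hab hnab hau hwb hu huw
  have hne : τ a ≠ τ b := fun h' => hab (hτ h')
  rcases Nat.lt_or_gt_of_ne hne with hlt | hlt
  · exact main a b u w hlt (by omega) hnab hau hwb hu huw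
  · have hw : N < τ w := by
      rcases Relation.ReflTransGen.cases_tail huw with e | ⟨_, _, e⟩
      · rw [e]; exact hu
      · exact e.2.2
    exact main b a w u hlt (by omega) (fun h' => hnab (h.symm _ _ h')) (h.symm _ _ hwb)
      (h.symm _ _ hau) hw
      (reflTransGen_symm (fun _ _ h' => ⟨h.symm _ _ h'.1, h'.2.2, h'.2.1⟩) huw)

/-- An ordering with the maximum cardinality search property is a perfect ordering. -/
theorem IsMoralOrientation.perfect (h : IsMoralOrientation H A) {τ : V → ℕ}
    (hτ : Function.Injective τ)
    (hP : ∀ a b c, τ a < τ b → τ b < τ c → H a c → ¬ H a b → Relation.ReflTransGen H b c →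
      ∃ d, τ d < τ b ∧ H d b ∧ ¬ H d c) {a b c : V}
    (hac : τ a < τ c) (hbc : τ b < τ c) (hHa : H a c) (hHb : H b c) (hab : a ≠ b) : H a b := by
  by_contra hn
  -- Two nonadjacent earlier neighbours of `c` are linked by the path that consists of `c` alone.
  exact h.no_late_path hτ hP _ a b c c rfl hab hn hHa (h.symm _ _ hHb) (by omega) .refl

end PerfectOrientation
end CausalGraph

/-! ### Combinatorics of MPDAGs: buckets, search orders, branching -/

namespace CausalGraph

/-! ### Buckets of maximally oriented graphs -/

variable {V : Type*} {G D : Digraph V}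

theorem UndirEdge.symm {u v : V} (h : UndirEdge G u v) : UndirEdge G v u := ⟨h.2, h.1⟩

theorem Adjacent.symm {u v : V} (h : Adjacent G u v) : Adjacent G v u := Or.symm h

theorem adjacent_iff {u v : V} :
    Adjacent G u v ↔ UndirEdge G u v ∨ DirEdge G u v ∨ DirEdge G v u := by
  unfold Adjacent UndirEdge DirEdge; tauto

theorem adj_iff {u v : V} : G.Adj u v ↔ UndirEdge G u v ∨ DirEdge G u v := by
  unfold UndirEdge DirEdge; tauto

/-- `u` and `v` are linked by a path of undirected edges. -/
def SameBucket (G : Digraph V) : V → V → Prop := Relation.ReflTransGen (UndirEdge G)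

theorem SameBucket.symm {u v : V} (h : SameBucket G u v) : SameBucket G v u :=
  reflTransGen_symm (fun _ _ h => h.symm) h

/-- R1 forces `u` and `d` to be adjacent, and R2 for `d`, `u`, `c` forbids the arc from `d` to `u`.
-/
theorem IsMPDAG.dir_or_undir (hG : IsMPDAG G) {u c d : V} (h1 : DirEdge G u c)
    (h2 : UndirEdge G c d) : DirEdge G u d ∨ UndirEdge G u d := by
  have hud : u ≠ d := by rintro rfl; exact h1.2 h2.1
  by_contra hn
  have h3 := hG.closedR1 u c d
  have h4 := hG.closedR2 d u c
  have h5 := h2.symm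
  unfold MeekR1 Adjacent at h3
  unfold MeekR2 at h4
  have h6 := @adjacent_iff _ G u d
  unfold Adjacent at h6
  tauto

/-- Each parent is joined to `d` by an arc into `d` or an undirected edge. A mixed pair contradicts
R1 at `d`, two undirected edges contradict R3. -/
theorem IsMPDAG.vStructure_undir (hG : IsMPDAG G) {u c v d : V} (h : VStructure G u c v)
    (hcd : UndirEdge G c d) : VStructure G u d v := by
  obtain ⟨huv, huc, hvc, hn⟩ := h
  have hud := hG.dir_or_undir huc hcd
  have hvd := hG.dir_or_undir hvc hcd
  rcases hud with hud | hud <;> rcases hvd with hvd | hvd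
  · exact ⟨huv, hud, hvd, hn⟩
  · exact absurd ⟨huv, hud, hvd.symm, hn⟩ (hG.closedR1 u d v)
  · exact absurd ⟨huv.symm, hvd, hud.symm, fun h => hn h.symm⟩ (hG.closedR1 v d u)
  · exact absurd ⟨huv, hud.symm, hcd.symm, hvd.symm, huc, hvc, hn⟩ (hG.closedR3 d u c v)

theorem IsMPDAG.vStructure_sameBucket (hG : IsMPDAG G) {u c v d : V} (h : VStructure G u c v)
    (hcd : SameBucket G c d) : VStructure G u d v := by
  induction hcd with
  | refl => exact h
  | tail _ h2 ih => exact hG.vStructure_undir ih h2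

/-- Otherwise the v-structure would travel through the bucket to `u` and give an arc from `u` to
itself. -/
theorem IsMPDAG.not_sameBucket_of_vStructure (hG : IsMPDAG G) {u c v : V}
    (h : VStructure G u c v) : ¬ SameBucket G c u := fun hc =>
  let h' := (hG.vStructure_sameBucket h hc).2.1
  h'.2 h'.1

theorem IsMPDAG.dir_or_sameBucket (hG : IsMPDAG G) {u c d : V} (h1 : DirEdge G u c)
    (h2 : SameBucket G c d) : DirEdge G u d ∨ SameBucket G u d := by
  induction h2 with
  | refl => exact Or.inl h1
  | tail _ h3 ih =>
    rcases ih with h | h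
    · exact (hG.dir_or_undir h h3).imp id Relation.ReflTransGen.single
    · exact Or.inr (h.tail h3)

theorem IsPDAG.wellFounded [Finite V] (hG : IsPDAG G) : WellFounded (DirEdge G) := by
  have : Std.Irrefl (Relation.TransGen (DirEdge G)) := ⟨hG.noDirectedCycle⟩
  have := Finite.wellFounded_of_trans_of_irrefl (Relation.TransGen (DirEdge G))
  exact Subrelation.wf (fun h => Relation.TransGen.single h) this

/-! ### Maximum cardinality search -/

def ParentClosed (G : Digraph V) (X : Finset V) : Prop := ∀ u x, DirEdge G u x → x ∈ X → u ∈ X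

/-- `y` is unvisited and all its directed parents are visited. -/
def Ready (G : Digraph V) (X : Finset V) (y : V) : Prop := y ∉ X ∧ ∀ u, DirEdge G u y → u ∈ X

open Classical in
/-- The number of visited vertices with an edge to `y`. -/
noncomputable def lab (G : Digraph V) (X : Finset V) (y : V) : ℕ :=
  (X.filter fun x => G.Adj x y).card

/-- `x` is a ready vertex of maximum label. -/
def IsTop (G : Digraph V) (X : Finset V) (x : V) : Prop :=
  Ready G X x ∧ ∀ y, Ready G X y → lab G X y ≤ lab G X x

/-- Every visited `p` counted at `y` is counted at `u`: nonadjacent `p` and `u` would give R1 or a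
v-structure at `y` with the parent `u` inside the bucket, and an arc from `u` to `p` is impossible
because `X` contains the parents of its members. -/
theorem IsMPDAG.lab_le_of_dir (hG : IsMPDAG G) {X : Finset V} (hX : ParentClosed G X) {u y : V}
    (huy : DirEdge G u y) (hu : u ∉ X) (hB : SameBucket G u y) : lab G X y ≤ lab G X u := by
  classical
  unfold lab
  apply Finset.card_le_card
  intro p hp
  simp only [Finset.mem_filter] at hp ⊢
  refine ⟨hp.1, ?_⟩
  have hpu : p ≠ u := by rintro rfl; exact hu hp.1
  have hadj : Adjacent G p u := by
    by_contra hn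
    rcases adj_iff.1 hp.2 with h | h
    · exact hG.closedR1 u y p ⟨hpu.symm, huy, h.symm, fun h' => hn h'.symm⟩
    · exact hG.not_sameBucket_of_vStructure
        ⟨hpu.symm, huy, h, fun h' => hn h'.symm⟩ hB.symm
  rcases adjacent_iff.1 hadj with h | h | h
  · exact h.1
  · exact h.1
  · exact absurd (hX _ _ h hp.1) hu

/-- A vertex of the bucket that is not ready has an unvisited parent. This parent lies in the
bucket, since otherwise it would also be a parent of the ready vertex `x`, and its label is at least
as large; so the claim climbs along directed edges to a ready vertex. -/
theorem IsMPDAG.lab_le_of_sameBucket [Finite V] (hG : IsMPDAG G) {X : Finset V}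
    (hX : ParentClosed G X) {x : V} (hx : IsTop G X x) (y : V) (hy : y ∉ X)
    (hxy : SameBucket G x y) : lab G X y ≤ lab G X x := by
  induction y using hG.toIsPDAG.wellFounded.induction with
  | _ y ih =>
  by_cases hr : Ready G X y
  · exact hx.2 y hr
  · obtain ⟨u, huy, hu⟩ : ∃ u, DirEdge G u y ∧ u ∉ X := by
      by_contra hn
      push Not at hn
      exact hr ⟨hy, hn⟩
    rcases hG.dir_or_sameBucket huy hxy.symm with h | h
    · exact absurd (hx.1.2 _ h) hu
    · exact (hG.lab_le_of_dir hX huy hu (h.trans hxy)).trans (ih u huy hu h.symm)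

theorem IsPDAG.exists_ready [Finite V] (hG : IsPDAG G) {X : Finset V} {y : V} (hy : y ∉ X) :
    ∃ x, Ready G X x := by
  obtain ⟨x, hx, hmin⟩ := hG.wellFounded.has_min {y | y ∉ X} ⟨y, hy⟩
  exact ⟨x, hx, fun u hu => by_contra fun hn => hmin u hn hu⟩

/-! ### Orientations along an ordering -/

/-- The undirected edges of `G` are oriented along `τ`. -/
def orient (G : Digraph V) (τ : V → ℕ) : Digraph V where
  Adj u v := DirEdge G u v ∨ (UndirEdge G u v ∧ τ u < τ v)

theorem IsConsistentExtension.adjacent_iff (h : IsConsistentExtension D G) (hG : IsMPDAG G)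
    {u v : V} : Adjacent D u v ↔ Adjacent G u v := by
  by_cases huv : u = v
  · subst huv
    have h1 := hG.loopless u
    have h2 := h.isDAG.allDirected u u
    unfold Adjacent; tauto
  · have := congrArg (fun S => S.Adj u v) h.sameSkeleton
    simp only [skel, Digraph.toSimpleGraphInclusive, SimpleGraph.fromRel_adj, eq_iff_iff] at this
    unfold Adjacent; tauto

theorem IsDAG.dirEdge_iff (h : IsDAG D) {u v : V} : DirEdge D u v ↔ D.Adj u v :=
  ⟨fun h => h.1, fun h' => ⟨h', h.allDirected _ _ h'⟩⟩

/-- Nonadjacent parents would form a v-structure of `D`, hence of `G`, and those have their parents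
outside the bucket of `c`. Only one of the two parents needs to be in the bucket. -/
theorem IsConsistentExtension.moral (h : IsConsistentExtension D G) (hG : IsMPDAG G) {u v c : V}
    (hu : D.Adj u c) (hv : D.Adj v c) (huv : u ≠ v) (hB : SameBucket G c u) :
    Adjacent G u v := by
  by_contra hn
  have h1 : VStructure D u c v := ⟨huv, h.isDAG.dirEdge_iff.2 hu, h.isDAG.dirEdge_iff.2 hv,
    fun h' => hn ((h.adjacent_iff hG).1 h')⟩
  exact hG.not_sameBucket_of_vStructure ((h.sameVStructures _ _ _).1 h1) hB

theorem IsConsistentExtension.isMoralOrientation (h : IsConsistentExtension D G)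
    (hG : IsMPDAG G) : IsMoralOrientation (fun x y => Adjacent G x y ∧ SameBucket G x y)
      (fun x y => D.Adj x y ∧ SameBucket G x y) where
  symm _ _ h := ⟨h.1.symm, h.2.symm⟩
  total x y hxy := by
    rcases (h.adjacent_iff hG).2 hxy.1 with e | e
    · exact Or.inl ⟨e, hxy.2⟩
    · exact Or.inr ⟨e, hxy.2.symm⟩
  sub x y hxy := ⟨(h.adjacent_iff hG).1 (Or.inl hxy.1), hxy.2⟩
  acyclic x hx := h.isDAG.noDirectedCycle x
    (Relation.TransGen.mono (fun _ _ h' => h.isDAG.dirEdge_iff.2 h'.1) _ _ hx)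
  moral u v c hu hv huv := ⟨h.moral hG hu.1 hv.1 huv hu.2.symm, hu.2.trans hv.2.symm⟩

/-- Acyclicity holds because all edges ascend along `τ`. A new v-structure cannot use one directed
and one undirected edge by R1, nor two undirected edges by `hmoral`. -/
theorem orient_isConsistentExtension (hG : IsMPDAG G) {τ : V → ℕ} (hτ : Function.Injective τ)
    (htop : ∀ u v, DirEdge G u v → τ u < τ v)
    (hmoral : ∀ a b c, τ a < τ c → τ b < τ c → UndirEdge G a c → UndirEdge G b c → a ≠ b →
      Adjacent G a b) : IsConsistentExtension (orient G τ) G := by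
  have hlt : ∀ u v, (orient G τ).Adj u v → τ u < τ v := by
    rintro u v (h | h)
    · exact htop _ _ h
    · exact h.2
  have hdag : IsDAG (orient G τ) := by
    refine ⟨fun u v h h' => by have := hlt _ _ h; have := hlt _ _ h'; omega, fun v hv => ?_⟩
    have : ∀ u w, Relation.TransGen (DirEdge (orient G τ)) u w → τ u < τ w := by
      intro u w h
      induction h with
      | single h => exact hlt _ _ h.1
      | tail _ h ih => exact ih.trans (hlt _ _ h.1)
    exact lt_irrefl _ (this v v hv)
  have hadj : ∀ u v, Adjacent (orient G τ) u v ↔ Adjacent G u v := by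
    intro u v
    rw [CausalGraph.adjacent_iff (G := G)]
    constructor
    · rintro ((h | h) | (h | h))
      · exact Or.inr (Or.inl h)
      · exact Or.inl h.1
      · exact Or.inr (Or.inr h)
      · exact Or.inl h.1.symm
    · rintro (h | h | h)
      · have huv : u ≠ v := by rintro rfl; exact hG.loopless _ h.1
        rcases Nat.lt_or_gt_of_ne (fun h' => huv (hτ h')) with e | e
        · exact Or.inl (Or.inr ⟨h, e⟩)
        · exact Or.inr (Or.inr ⟨h.symm, e⟩)
      · exact Or.inl (Or.inl h)
      · exact Or.inr (Or.inl h)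
  refine ⟨hdag, ?_, fun u v h => Or.inl h, fun u c v => ⟨?_, ?_⟩⟩
  · ext u v
    simp only [skel, Digraph.toSimpleGraphInclusive, SimpleGraph.fromRel_adj]
    have := hadj u v
    unfold Adjacent at this
    tauto
  · rintro ⟨huv, h1, h2, h3⟩
    rw [hadj] at h3
    rcases h1.1 with h1 | h1 <;> rcases h2.1 with h2 | h2
    · exact ⟨huv, h1, h2, h3⟩
    · exact absurd ⟨huv, h1, h2.1.symm, h3⟩ (hG.closedR1 u c v)
    · exact absurd ⟨huv.symm, h2, h1.1.symm, fun h => h3 h.symm⟩ (hG.closedR1 v c u)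
    · exact absurd (hmoral u v c h1.2 h2.2 h1.1 h2.1 huv) h3
  · rintro ⟨huv, h1, h2, h3⟩
    exact ⟨huv, hdag.dirEdge_iff.2 (Or.inl h1), hdag.dirEdge_iff.2 (Or.inl h2),
      fun h => h3 ((hadj u v).1 h)⟩

/-- It is enough to compare every parent along an undirected edge with the last such parent. -/
theorem moral_of_last_parent [Finite V] (hG : IsMPDAG G) {τ : V → ℕ} (hτ : Function.Injective τ)
    (htop : ∀ u v, DirEdge G u v → τ u < τ v)
    (hlast : ∀ a p c, UndirEdge G a c → UndirEdge G p c → τ a < τ p → τ p < τ c →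
      (∀ q, UndirEdge G q c → τ q < τ c → τ q ≤ τ p) → Adjacent G a p) :
    ∀ (N : ℕ) (a b c : V), τ c = N → τ a < τ c → τ b < τ c → UndirEdge G a c → UndirEdge G b c →
      a ≠ b → Adjacent G a b := by
  intro N
  induction N using Nat.strong_induction_on with
  | _ N ih =>
  intro a b c hN hac hbc ha hb hab
  obtain ⟨p, ⟨hp1, hp2⟩, hp3⟩ := Set.exists_max_image {q | UndirEdge G q c ∧ τ q < τ c} τ
    (Set.toFinite _) ⟨a, ha, hac⟩
  have hmax : ∀ q, UndirEdge G q c → τ q < τ c → τ q ≤ τ p := fun q h1 h2 => hp3 q ⟨h1, h2⟩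
  have key : ∀ q, UndirEdge G q c → τ q < τ c → q ≠ p →
      τ q < τ p ∧ (UndirEdge G q p ∨ DirEdge G q p) := by
    intro q h1 h2 h3
    have h4 : τ q < τ p := lt_of_le_of_ne (hmax q h1 h2) fun h => h3 (hτ h)
    rcases adjacent_iff.1 (hlast q p c h1 hp1 h4 hp2 hmax) with h | h | h
    · exact ⟨h4, Or.inl h⟩
    · exact ⟨h4, Or.inr h⟩
    · have := htop _ _ h; omega
  by_cases hap : a = p
  · subst hap
    obtain ⟨h1, h2⟩ := key b hb hbc hab.symm
    exact (hlast b a c hb hp1 h1 hp2 hmax).symm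
  by_cases hbp : b = p
  · subst hbp
    obtain ⟨h1, h2⟩ := key a ha hac hab
    exact hlast a b c ha hp1 h1 hp2 hmax
  obtain ⟨hap', ea⟩ := key a ha hac hap
  obtain ⟨hbp', eb⟩ := key b hb hbc hbp
  -- Both `a` and `b` now precede `p` and are joined to it. Two undirected edges reduce the claim to
  -- the earlier child `p`; in the mixed cases R1 gives adjacency; two arcs into `p` from
  -- nonadjacent vertices would be R3 at `c`.
  rcases ea with ea | ea <;> rcases eb with eb | eb
  · exact ih (τ p) (by omega) a b p rfl hap' hbp' ea eb hab
  · by_contra hn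
    exact hG.closedR1 b p a ⟨hab.symm, eb, ea.symm, fun h => hn h.symm⟩
  · by_contra hn
    exact hG.closedR1 a p b ⟨hab, ea, eb.symm, hn⟩
  · by_contra hn
    exact hG.closedR3 c a p b ⟨hab, ha.symm, hp1.symm, hb.symm, ea, eb, hn⟩

/-! ### Maximum cardinality search orders are moral -/

section Search

variable [Fintype V]

/-- The vertices that `τ` places before `b`. -/
def before (τ : V → ℕ) (b : V) : Finset V := Finset.univ.filter fun y => τ y < τ b

theorem mem_before {τ : V → ℕ} {a b : V} : a ∈ before τ b ↔ τ a < τ b := by simp [before]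

/-- The orientation of the buckets by `D` is moral, so `IsMoralOrientation.perfect` applies once the
search property holds for the adjacency inside buckets. That property compares labels: when `b` was
chosen, no unvisited vertex of its bucket had a larger label. -/
theorem moral_of_isTop (hG : IsMPDAG G) (hD : IsConsistentExtension D G) {τ : V → ℕ}
    (hτ : Function.Injective τ) (htop : ∀ b, IsTop G (before τ b) b) {a b c : V}
    (hac : τ a < τ c) (hbc : τ b < τ c) (ha : UndirEdge G a c) (hb : UndirEdge G b c)
    (hab : a ≠ b) : Adjacent G a b := by
  classical
  have hpar : ∀ u v, DirEdge G u v → τ u < τ v := fun u v h => mem_before.1 ((htop v).1.2 u h)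
  refine ((hD.isMoralOrientation hG).perfect hτ ?_ hac hbc ⟨Or.inl ha.1, .single ha⟩
    ⟨Or.inl hb.1, .single hb⟩ hab).1
  clear hac hbc ha hb hab a b c
  intro a b c hab hbc hac hnab hbc'
  have hB : SameBucket G b c := by
    have : ∀ z, Relation.ReflTransGen (fun x y => Adjacent G x y ∧ SameBucket G x y) b z →
        SameBucket G b z := by
      intro z hz
      induction hz with
      | refl => exact .refl
      | tail _ h ih => exact ih.trans h.2
    exact this c hbc'
  have hX : ParentClosed G (before τ b) := fun u x hux hx =>
    mem_before.2 ((hpar _ _ hux).trans (mem_before.1 hx))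
  have hle := hG.lab_le_of_sameBucket hX (htop b) c (by rw [mem_before]; omega) hB
  have hAac : G.Adj a c := by
    rcases adjacent_iff.1 hac.1 with h | h | h
    · exact h.1
    · exact h.1
    · have := hpar _ _ h; omega
  have hnAab : ¬ G.Adj a b := fun h => hnab ⟨Or.inl h, hac.2.trans hB.symm⟩
  -- If every visited neighbour counted at `b` were counted at `c`, then `a`, counted only at `c`,
  -- would make the label of `c` strictly larger.
  obtain ⟨d, hdX, hdb, hdc⟩ : ∃ d ∈ before τ b, G.Adj d b ∧ ¬ G.Adj d c := by
    by_contra hn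
    push Not at hn
    refine absurd hle (not_le.2 (Finset.card_lt_card ?_))
    rw [Finset.ssubset_iff]
    refine ⟨a, by simp [hnAab], ?_⟩
    intro d hd
    rw [Finset.mem_insert, Finset.mem_filter] at hd
    rw [Finset.mem_filter]
    rcases hd with rfl | hd
    · exact ⟨mem_before.2 hab, hAac⟩
    · exact ⟨hd.1, hn d hd.1 hd.2⟩
  rw [mem_before] at hdX
  refine ⟨d, hdX, ⟨Or.inl hdb, ?_⟩, ?_⟩
  · rcases adj_iff.1 hdb with h | h
    · exact .single h
    -- An arc into `b` from outside the bucket would enter `c` as well, but `d` has no edge to `c`.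
    · rcases hG.dir_or_sameBucket h hB with h' | h'
      · exact absurd h'.1 hdc
      · exact h'.trans hB.symm
  · rintro ⟨h, -⟩
    rcases adjacent_iff.1 h with h | h | h
    · exact hdc h.1
    · exact hdc h.1
    · have := hpar _ _ h; omega

end Search

/-! ### Branching -/

/-- `y` is linked to `v` by undirected edges between ready vertices with the label of `v`. -/
def Cand (G : Digraph V) (X : Finset V) (v y : V) : Prop :=
  Relation.ReflTransGen
    (fun a b => UndirEdge G a b ∧ Ready G X b ∧ lab G X b = lab G X v) v y

theorem Cand.ready {X : Finset V} {v y : V} (hv : Ready G X v) (h : Cand G X v y) :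
    Ready G X y ∧ lab G X y = lab G X v := by
  rcases Relation.ReflTransGen.cases_tail h with rfl | ⟨_, _, h⟩
  · exact ⟨hv, rfl⟩
  · exact h.2

theorem Cand.isTop {X : Finset V} {v y : V} (hv : IsTop G X v) (h : Cand G X v y) :
    IsTop G X y := by
  obtain ⟨h1, h2⟩ := h.ready hv.1
  exact ⟨h1, fun z hz => h2 ▸ hv.2 z hz⟩

/-- In `D`, every undirected edge of `G` from `x` to an unvisited vertex leaves `x`. -/
def LeavesTo (G D : Digraph V) (X : Finset V) (x : V) : Prop :=
  ∀ z, z ∉ X → UndirEdge G x z → D.Adj x z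

/-- Take a candidate `x` without candidate ancestors along an arc of `D`. If some undirected edge
from an unvisited vertex entered `x`, then a minimal such neighbour `y` would be ready, and by
morality every visited vertex counted at `x` is counted at `y`. So `y` would be a candidate before
`x`. -/
theorem exists_cand_leavesTo [Finite V] (hG : IsMPDAG G) (hD : IsConsistentExtension D G)
    {X : Finset V} {v : V} (hX : ParentClosed G X) (hv : IsTop G X v)
    (hDX : ∀ p ∈ X, ∀ z, z ∉ X → UndirEdge G p z → D.Adj p z) :
    ∃ x, Cand G X v x ∧ LeavesTo G D X x := by
  classical
  have hDP : IsPDAG D := ⟨fun v h => hD.isDAG.allDirected v v h h, hD.isDAG.noDirectedCycle⟩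
  have hAdj : ∀ {u v}, D.Adj u v → DirEdge D u v := fun h => hD.isDAG.dirEdge_iff.2 h
  obtain ⟨x, hx, hmin⟩ := hDP.wellFounded.has_min {x | Cand G X v x} ⟨v, .refl⟩
  refine ⟨x, hx, fun z hz hxz => ?_⟩
  by_contra hn
  have hxt := Cand.isTop hv hx
  obtain ⟨y, ⟨hyX, hxy, hyx⟩, hymin⟩ := hDP.wellFounded.has_min
    {y | y ∉ X ∧ UndirEdge G x y ∧ D.Adj y x}
    ⟨z, hz, hxz, ((hD.adjacent_iff hG).2 (Or.inl hxz.1)).resolve_left hn⟩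
  -- An unvisited directed parent `u` of `y` would be joined to `x` by an undirected edge. Oriented
  -- into `x` it contradicts the minimality of `y`; oriented out of `x` it closes a cycle of `D`
  -- through `u` and `y`.
  have hyr : Ready G X y := by
    refine ⟨hyX, fun u hu => by_contra fun huX => ?_⟩
    have hux : UndirEdge G u x := by
      rcases hG.dir_or_undir hu hxy.symm with h | h
      · exact absurd (hxt.1.2 _ h) huX
      · exact h
    refine hymin u ⟨huX, hux.symm, ?_⟩ (hAdj (hD.keepsDirected _ _ hu))
    by_contra hn'
    have hxu : D.Adj x u := ((hD.adjacent_iff hG).2 (Or.inl hux.1)).resolve_left hn'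
    exact hD.isDAG.noDirectedCycle x (((Relation.TransGen.single (hAdj hxu)).tail
      (hAdj (hD.keepsDirected _ _ hu))).tail (hAdj hyx))
  have hle : lab G X x ≤ lab G X y := by
    apply Finset.card_le_card
    intro p hp
    simp only [Finset.mem_filter] at hp ⊢
    refine ⟨hp.1, ?_⟩
    have hpx : D.Adj p x := by
      rcases adj_iff.1 hp.2 with h | h
      · exact hDX p hp.1 x hxt.1.1 h
      · exact hD.keepsDirected _ _ h
    have hpy : y ≠ p := by rintro rfl; exact hyX hp.1
    rcases adjacent_iff.1 (hD.moral hG hyx hpx hpy (.single hxy)) with h | h | h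
    · exact h.2
    · exact absurd (hX _ _ h hp.1) hyX
    · exact h.1
  have hyc : Cand G X v y :=
    hx.tail ⟨hxy, hyr, le_antisymm (hv.2 y hyr) ((hx.ready hv.1).2 ▸ hle)⟩
  exact hmin y hyc (hAdj hyx)

/-- Since all edges leave `x`, morality shows that whatever can be reached from `x` by undirected
edges among ready vertices can be reached along arcs of `D`. In particular some such arc enters `y`,
from an unvisited vertex, whereas all those edges should leave `y`. -/
theorem leavesTo_unique (hG : IsMPDAG G) (hD : IsConsistentExtension D G) {X : Finset V}
    {v x y : V} (hv : Ready G X v) (hx : Cand G X v x) (hy : Cand G X v y)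
    (hDx : LeavesTo G D X x) (hDy : LeavesTo G D X y) : x = y := by
  by_contra hxy
  set R : V → V → Prop := fun p q => D.Adj p q ∧ UndirEdge G p q ∧ Ready G X p with hR
  have hxr := hx.ready hv
  have l1 : ∀ q, Relation.ReflTransGen R x q → ∀ q', Ready G X q → Ready G X q' →
      UndirEdge G q q' → Relation.ReflTransGen R x q' := by
    intro q hq
    induction hq with
    | refl =>
      intro q' h1 h2 h3
      exact .single ⟨hDx q' h2.1 h3, h3, hxr.1⟩
    | @tail p q hp hpq ih =>
      intro q' h1 h2 h3
      rcases (hD.adjacent_iff hG).2 (Or.inl h3.1) with e | e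
      · exact (hp.tail hpq).tail ⟨e, h3, h1⟩
      · by_cases hpq' : p = q'
        · exact hpq' ▸ hp
        · rcases adjacent_iff.1 (hD.moral hG hpq.1 e hpq' (.single hpq.2.1.symm)) with h | h | h
          · exact ih q' hpq.2.2 h2 h
          · exact absurd (h2.2 _ h) hpq.2.2.1
          · exact absurd (hpq.2.2.2 _ h) h2.1
  have l2 : Relation.ReflTransGen R x v := by
    have : ∀ z, Cand G X v z → Relation.ReflTransGen R x z → Relation.ReflTransGen R x v := by
      intro z hz
      induction hz with
      | refl => exact id
      | @tail p q hp hpq ih =>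
        intro h
        exact ih (l1 q h p hpq.2.1 (Cand.ready hv hp).1 hpq.1.symm)
    exact this x hx .refl
  have l3 : Relation.ReflTransGen R x y := by
    have : ∀ z, Cand G X v z → Relation.ReflTransGen R x z := by
      intro z hz
      induction hz with
      | refl => exact l2
      | @tail p q hp hpq ih => exact l1 p ih q (Cand.ready hv hp).1 hpq.2.1 hpq.1
    exact this y hy
  rcases Relation.ReflTransGen.cases_tail l3 with h | ⟨p, _, h⟩
  · exact hxy h.symm
  · exact hD.isDAG.allDirected _ _ h.1 (hDy p h.2.2.1 h.2.1.symm)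

end CausalGraph

namespace CausalGraph

/-! ### The search tree -/

variable {V : Type*} [DecidableEq V] {G D : Digraph V}

/-- A list of vertices as visited by the search. -/
inductive MCSPrefix (G : Digraph V) : List V → Prop
  | nil : MCSPrefix G []
  | snoc {xs x} : MCSPrefix G xs → IsTop G xs.toFinset x → MCSPrefix G (xs ++ [x])

theorem MCSPrefix.nodup {xs : List V} (h : MCSPrefix G xs) : xs.Nodup := by
  induction h with
  | nil => exact List.nodup_nil
  | snoc _ hx ih =>
    have := hx.1.1
    rw [List.mem_toFinset] at this
    rw [List.nodup_append]
    refine ⟨ih, List.nodup_singleton _, ?_⟩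
    rintro a ha b hb rfl
    rw [List.mem_singleton] at hb
    exact this (hb ▸ ha)

theorem MCSPrefix.parentClosed {xs : List V} (h : MCSPrefix G xs) :
    ParentClosed G xs.toFinset := by
  induction h with
  | nil => intro u x _ hx; simp at hx
  | snoc _ hx ih =>
    intro u y huy hy
    simp only [List.mem_toFinset, List.mem_append, List.mem_singleton] at hy ⊢
    rcases hy with hy | rfl
    · exact Or.inl (by simpa using ih u y huy (by simpa using hy))
    · exact Or.inl (by simpa using hx.1.2 u huy)

theorem MCSPrefix.of_snoc {xs : List V} {x : V} (h : MCSPrefix G (xs ++ [x])) :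
    MCSPrefix G xs ∧ IsTop G xs.toFinset x := by
  generalize hys : xs ++ [x] = ys at h
  cases h with
  | nil => simp at hys
  | snoc h1 h2 =>
    obtain ⟨rfl, h⟩ := List.append_inj' hys rfl
    obtain rfl : x = _ := by simpa using h
    exact ⟨h1, h2⟩

theorem MCSPrefix.take {xs : List V} (h : MCSPrefix G xs) (j : ℕ) :
    MCSPrefix G (xs.take j) := by
  induction h with
  | nil => simpa using MCSPrefix.nil
  | @snoc xs x h1 h2 ih =>
    rcases Nat.lt_or_ge xs.length j with hj | hj
    · rw [List.take_of_length_le (by simp; omega)]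
      exact h1.snoc h2
    · rw [List.take_append_of_le_length hj]
      exact ih

theorem MCSPrefix.isTop {xs : List V} (h : MCSPrefix G xs) (j : ℕ) (hj : j < xs.length) :
    IsTop G (xs.take j).toFinset xs[j] := by
  have h1 := h.take (j + 1)
  rw [List.take_succ_eq_append_getElem hj] at h1
  exact h1.of_snoc.2

theorem mem_take_iff_idxOf_lt {xs : List V} (hn : xs.Nodup) {j : ℕ} (hj : j ≤ xs.length)
    {a : V} : a ∈ xs.take j ↔ xs.idxOf a < j := by
  constructor
  · intro h
    obtain ⟨i, hi, rfl⟩ := List.getElem_of_mem h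
    rw [List.getElem_take, hn.idxOf_getElem]
    simp at hi; omega
  · intro h
    have h1 : xs.idxOf a < xs.length := by omega
    rw [List.mem_take_iff_getElem]
    exact ⟨xs.idxOf a, by omega, List.getElem_idxOf h1⟩

theorem MCSPrefix.isTop_before [Fintype V] {xs : List V} (h : MCSPrefix G xs)
    (hall : ∀ v, v ∈ xs) (b : V) : IsTop G (before (fun v => xs.idxOf v) b) b := by
  have hb : xs.idxOf b < xs.length := List.idxOf_lt_length_iff.2 (hall b)
  have h1 := h.isTop _ hb
  have h2 : (xs.take (xs.idxOf b)).toFinset = before (fun v => xs.idxOf v) b := by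
    ext a
    rw [List.mem_toFinset, mem_before, mem_take_iff_idxOf_lt h.nodup hb.le]
  rwa [List.getElem_idxOf, h2] at h1

theorem idxOf_injective {xs : List V} (hall : ∀ v, v ∈ xs) :
    Function.Injective fun v => xs.idxOf v := by
  intro a b hab
  exact (List.idxOf_inj (hall a)).1 hab

/-- `D` is a consistent extension of `G` compatible with visiting `xs` first. -/
def InExt (G : Digraph V) (xs : List V) (D : Digraph V) : Prop :=
  IsConsistentExtension D G ∧
    ∀ (j : ℕ) (hj : j < xs.length), LeavesTo G D (xs.take j).toFinset xs[j]

theorem inExt_nil : InExt G [] D ↔ IsConsistentExtension D G := by simp [InExt]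

theorem inExt_snoc {xs : List V} {x : V} :
    InExt G (xs ++ [x]) D ↔ InExt G xs D ∧ LeavesTo G D xs.toFinset x := by
  constructor
  · rintro ⟨h1, h2⟩
    refine ⟨⟨h1, fun j hj => ?_⟩, ?_⟩
    · have := h2 j (by simp; omega)
      rwa [List.take_append_of_le_length hj.le, List.getElem_append_left hj] at this
    · have := h2 xs.length (by simp)
      simpa using this
  · rintro ⟨⟨h1, h2⟩, h3⟩
    refine ⟨h1, fun j hj => ?_⟩
    rcases Nat.lt_or_ge j xs.length with h | h
    · rw [List.take_append_of_le_length h.le, List.getElem_append_left h]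
      exact h2 j h
    · obtain rfl : j = xs.length := by simp at hj; omega
      simpa using h3

theorem InExt.take {xs : List V} (h : InExt G xs D) (j : ℕ) : InExt G (xs.take j) D := by
  refine ⟨h.1, fun i hi => ?_⟩
  have hi' : i < j ∧ i < xs.length := by simpa using hi
  have := h.2 i hi'.2
  rw [List.getElem_take, List.take_take]
  rwa [min_eq_left hi'.1.le]

theorem InExt.leaves {xs : List V} (h : InExt G xs D) :
    ∀ p ∈ xs.toFinset, ∀ z, z ∉ xs.toFinset → UndirEdge G p z → D.Adj p z := by
  intro p hp z hz hpz
  rw [List.mem_toFinset] at hp hz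
  obtain ⟨j, hj, rfl⟩ := List.getElem_of_mem hp
  exact h.2 j hj z (fun h' => hz (List.mem_of_mem_take (List.mem_toFinset.1 h'))) hpz

theorem inExt_iff_cand [Finite V] (hG : IsMPDAG G) {xs : List V} (hxs : MCSPrefix G xs) {v : V}
    (hv : IsTop G xs.toFinset v) :
    InExt G xs D ↔ ∃ x, Cand G xs.toFinset v x ∧ InExt G (xs ++ [x]) D := by
  constructor
  · intro h
    obtain ⟨x, h1, h2⟩ := exists_cand_leavesTo hG h.1 hxs.parentClosed hv h.leaves
    exact ⟨x, h1, inExt_snoc.2 ⟨h, h2⟩⟩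
  · rintro ⟨x, -, h⟩
    exact (inExt_snoc.1 h).1

/-- On a complete path every undirected edge has an endpoint visited first, and the edge must leave
it; so no freedom remains. -/
theorem inExt_orient [Fintype V] (hG : IsMPDAG G) {xs : List V} (hxs : MCSPrefix G xs)
    (hall : ∀ v, v ∈ xs)
    (hext : IsConsistentExtension (orient G fun v => xs.idxOf v) G) :
    InExt G xs D ↔ D = orient G fun v => xs.idxOf v := by
  have hfwd : ∀ D, InExt G xs D → ∀ u v, UndirEdge G u v → xs.idxOf u < xs.idxOf v →
      D.Adj u v := by
    intro D h u v huv hlt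
    have hu : xs.idxOf u < xs.length := List.idxOf_lt_length_iff.2 (hall u)
    have := h.2 _ hu v (by rw [List.mem_toFinset, mem_take_iff_idxOf_lt hxs.nodup hu.le]; omega)
    rw [List.getElem_idxOf] at this
    exact this huv
  constructor
  · intro h
    ext u v
    constructor
    · intro huv
      rcases adjacent_iff.1 ((h.1.adjacent_iff hG).1 (Or.inl huv)) with e | e | e
      · right
        refine ⟨e, ?_⟩
        by_contra hn
        have hne : u ≠ v := by rintro rfl; exact hG.loopless _ e.1
        have hne' : xs.idxOf u ≠ xs.idxOf v := fun h' => hne (idxOf_injective hall h')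
        exact h.1.isDAG.allDirected _ _ huv (hfwd D h v u e.symm (by simp only at hn; omega))
      · exact Or.inl e
      · exact absurd (h.1.keepsDirected _ _ e) (h.1.isDAG.allDirected _ _ huv)
    · rintro (e | e)
      · exact h.1.keepsDirected _ _ e
      · exact hfwd D h u v e.1 e.2
  · rintro rfl
    refine ⟨hext, fun j hj z hz hxz => Or.inr ⟨hxz, ?_⟩⟩
    rw [List.mem_toFinset, mem_take_iff_idxOf_lt hxs.nodup hj.le] at hz
    simp only [hxs.nodup.idxOf_getElem]
    have hne : xs.idxOf z ≠ j := by
      rintro rfl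
      rw [List.getElem_idxOf] at hxz
      exact hG.loopless _ hxz.1
    omega

theorem MCSPrefix.orient_isConsistentExtension [Fintype V] (hG : IsMPDAG G) {xs : List V}
    (hxs : MCSPrefix G xs) (hall : ∀ v, v ∈ xs)
    (hmoral : ∀ a b c, xs.idxOf a < xs.idxOf c → xs.idxOf b < xs.idxOf c → UndirEdge G a c →
      UndirEdge G b c → a ≠ b → Adjacent G a b) :
    IsConsistentExtension (orient G fun v => xs.idxOf v) G :=
  CausalGraph.orient_isConsistentExtension hG (idxOf_injective hall)
    (fun u v h => mem_before.1 ((hxs.isTop_before hall v).1.2 u h)) hmoral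

theorem MCSPrefix.moral [Fintype V] (hG : IsMPDAG G) (hD : IsConsistentExtension D G)
    {xs : List V} (hxs : MCSPrefix G xs) (hall : ∀ v, v ∈ xs) :
    ∀ a b c, xs.idxOf a < xs.idxOf c → xs.idxOf b < xs.idxOf c → UndirEdge G a c →
      UndirEdge G b c → a ≠ b → Adjacent G a b := fun _ _ _ h1 h2 h3 h4 h5 =>
  moral_of_isTop hG hD (idxOf_injective hall) (hxs.isTop_before hall) h1 h2 h3 h4 h5

/-- `D` lies below one of the branches `rem j` that are still to be taken at the levels `j` of
the path `xs`. -/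
def Pending (G : Digraph V) (xs : List V) (rem : ℕ → Set V) (D : Digraph V) : Prop :=
  ∃ j < xs.length, ∃ y ∈ rem j, InExt G (xs.take j ++ [y]) D

theorem not_pending_nil {rem : ℕ → Set V} : ¬ Pending G [] rem D := by
  rintro ⟨j, hj, -⟩; simp at hj

theorem pending_snoc {xs : List V} {x : V} {rem : ℕ → Set V} :
    Pending G (xs ++ [x]) rem D ↔
      Pending G xs rem D ∨ ∃ y ∈ rem xs.length, InExt G (xs ++ [y]) D := by
  constructor
  · rintro ⟨j, hj, y, hy, h⟩
    rcases Nat.lt_or_ge j xs.length with h' | h'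
    · rw [List.take_append_of_le_length h'.le] at h
      exact Or.inl ⟨j, h', y, hy, h⟩
    · obtain rfl : j = xs.length := by simp at hj; omega
      rw [List.take_append_of_le_length le_rfl, List.take_length] at h
      exact Or.inr ⟨y, hy, h⟩
  · rintro (⟨j, hj, y, hy, h⟩ | ⟨y, hy, h⟩)
    · exact ⟨j, by simp; omega, y, hy, by rwa [List.take_append_of_le_length hj.le]⟩
    · refine ⟨xs.length, by simp, y, hy, ?_⟩
      rwa [List.take_append_of_le_length le_rfl, List.take_length]

theorem pending_congr {xs : List V} {rem rem' : ℕ → Set V}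
    (h : ∀ j < xs.length, rem j = rem' j) : Pending G xs rem D ↔ Pending G xs rem' D := by
  constructor
  · rintro ⟨j, hj, y, hy, h'⟩; exact ⟨j, hj, y, h j hj ▸ hy, h'⟩
  · rintro ⟨j, hj, y, hy, h'⟩; exact ⟨j, hj, y, (h j hj).symm ▸ hy, h'⟩

/-- The branches still to be taken are other candidates of their level. -/
def RemOk (G : Digraph V) (xs : List V) (rem : ℕ → Set V) : Prop :=
  ∀ (j : ℕ) (hj : j < xs.length), ∀ y ∈ rem j,
    Cand G (xs.take j).toFinset xs[j] y ∧ y ≠ xs[j]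

/-- A pending branch starts at another candidate of some level, and by `leavesTo_unique` one
extension cannot leave two candidates of a level. This is what prevents repeated output. -/
theorem not_pending_of_inExt (hG : IsMPDAG G) {xs : List V} {rem : ℕ → Set V}
    (hxs : MCSPrefix G xs) (hrem : RemOk G xs rem) (hD : InExt G xs D) :
    ¬ Pending G xs rem D := by
  rintro ⟨j, hj, y, hy, h⟩
  obtain ⟨h1, h2⟩ := hrem j hj y hy
  have h3 := hD.take (j + 1)
  rw [List.take_succ_eq_append_getElem hj] at h3
  exact h2 (leavesTo_unique hG hD.1 (hxs.isTop j hj).1 h1 .refl (inExt_snoc.1 h).2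
    (inExt_snoc.1 h3).2)

end CausalGraph

/-! ### A structured language and its compilation to the word RAM -/

namespace WordRAM

/-! ### A structured language with named variables and arrays -/

/-- The variables of the enumeration program. -/
inductive Var
  | n | L | i | run | x | y | f | j | b | w | p | h | len
  deriving DecidableEq

/-- The arrays of the enumeration program. -/
inductive Arr
  | row | deg | tgt | flg | adj | last | lab | blk | bkt | blen | pos | ord | time | rlist | rlen
  | rptr | mark
  deriving DecidableEq

/-- Only distinctness matters. Variables occupy even registers, at twice these numbers, which leaves
the odd ones to the base address and to scratch values. -/
def Var.code : Var → ℕ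
  | n => 0 | L => 3 | i => 4 | run => 5 | x => 6 | y => 7 | f => 8 | j => 9
  | b => 10 | w => 11 | p => 12 | h => 13 | len => 14

def Arr.code : Arr → ℕ
  | row => 0 | deg => 1 | tgt => 2 | flg => 3 | adj => 4 | last => 5 | lab => 6 | blk => 7
  | bkt => 8 | blen => 9 | pos => 10 | ord => 11 | time => 12 | rlist => 13 | rlen => 14
  | rptr => 15 | mark => 16

theorem Var.code_injective : Function.Injective Var.code := by
  intro a b h
  cases a <;> cases b <;> first | rfl | (simp [Var.code] at h)

theorem Arr.code_injective : Function.Injective Arr.code := by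
  intro a b h
  cases a <;> cases b <;> first | rfl | (simp [Arr.code] at h)

theorem Arr.code_lt (a : Arr) : a.code < 32 := by cases a <;> simp [Arr.code]

/-- Contents of the variables and arrays, and the words written so far. -/
structure St where
  v : Var → ℕ
  a : Arr → ℕ → ℕ
  out : List ℕ

def St.set (σ : St) (x : Var) (k : ℕ) : St := { σ with v := Function.update σ.v x k }

def St.sto (σ : St) (id : Arr) (i k : ℕ) : St :=
  { σ with a := Function.update σ.a id (Function.update (σ.a id) i k) }

def St.emit (σ : St) (k : ℕ) : St := { σ with out := σ.out ++ [k] }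

@[simp] theorem St.set_v (σ : St) (x y : Var) (k : ℕ) :
    (σ.set x k).v y = if y = x then k else σ.v y := by simp [St.set, Function.update_apply]
@[simp] theorem St.set_a (σ : St) (x : Var) (k : ℕ) : (σ.set x k).a = σ.a := rfl
@[simp] theorem St.set_out (σ : St) (x : Var) (k : ℕ) : (σ.set x k).out = σ.out := rfl
@[simp] theorem St.sto_v (σ : St) (id : Arr) (i k : ℕ) : (σ.sto id i k).v = σ.v := rfl
@[simp] theorem St.sto_a (σ : St) (id id' : Arr) (i k : ℕ) :
    (σ.sto id i k).a id' = if id' = id then Function.update (σ.a id) i k else σ.a id' := by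
  simp [St.sto, Function.update_apply]
@[simp] theorem St.sto_out (σ : St) (id : Arr) (i k : ℕ) : (σ.sto id i k).out = σ.out := rfl
@[simp] theorem St.emit_v (σ : St) (k : ℕ) : (σ.emit k).v = σ.v := rfl
@[simp] theorem St.emit_a (σ : St) (k : ℕ) : (σ.emit k).a = σ.a := rfl
@[simp] theorem St.emit_out (σ : St) (k : ℕ) : (σ.emit k).out = σ.out ++ [k] := rfl

/-- A machine: word bound, first address of the arrays, bound for indices and sums, input. -/
structure Mach where
  W : ℕ
  B : ℕ
  lim : ℕ
  inp : ℕ → ℕ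
  -- For indices below `lim` every array address, and every intermediate value in its computation,
  -- is a machine word.
  hW : B + 32 * lim + 32 ≤ W

/-- Scratch register number `d`. -/
def scr (d : ℕ) : ℕ := 2 * d + 3

/-- The state `s` of the machine represents `σ`. -/
structure Rep (μ : Mach) (σ : St) (s : State) : Prop where
  var : ∀ x : Var, s.reg (2 * x.code) = σ.v x
  base : s.reg 1 = μ.B
  -- The arrays are interleaved: cells with the same index share a block of 32. The stride is a
  -- power of two, so an index is scaled by five doublings.
  arr : ∀ id i, s.mem (μ.B + 32 * i + id.code) = σ.a id i
  inp : ∀ i < μ.B, s.mem i = μ.inp i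

theorem Rep.setScr {μ : Mach} {σ : St} {s : State} (h : Rep μ σ s) (d k : ℕ) :
    Rep μ σ (s.setReg (scr d) k) := by
  refine ⟨fun x => ?_, ?_, h.arr, h.inp⟩
  · rw [← h.var x]
    exact Function.update_of_ne (show 2 * x.code ≠ 2 * d + 3 by omega) k s.reg
  · rw [← h.base]
    exact Function.update_of_ne (show 1 ≠ 2 * d + 3 by omega) k s.reg

theorem Rep.setVar {μ : Mach} {σ : St} {s : State} (h : Rep μ σ s) (x : Var) (k : ℕ) :
    Rep μ (σ.set x k) (s.setReg (2 * x.code) k) := by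
  refine ⟨fun y => ?_, ?_, h.arr, h.inp⟩
  · rw [St.set_v, ← h.var y]
    by_cases hxy : y = x
    · subst hxy; simp [State.setReg]
    · rw [if_neg hxy]
      refine Function.update_of_ne (fun h' => hxy (Var.code_injective ?_)) _ _
      omega
  · rw [← h.base]
    exact Function.update_of_ne (by omega) _ _

theorem Rep.setArr {μ : Mach} {σ : St} {s : State} (h : Rep μ σ s) (id : Arr) (i k : ℕ) :
    Rep μ (σ.sto id i k) (s.setMem (μ.B + 32 * i + id.code) k) := by
  refine ⟨h.var, h.base, fun id' i' => ?_, fun j hj => ?_⟩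
  · rw [St.sto_a]
    have e1 := id.code_lt
    have e2 := id'.code_lt
    by_cases hid : id' = id
    · subst hid
      rw [if_pos rfl]
      by_cases hi : i' = i
      · subst hi; simp [State.setMem]
      · rw [Function.update_of_ne hi, ← h.arr]
        exact Function.update_of_ne (by omega) _ _
    · rw [if_neg hid, ← h.arr]
      refine Function.update_of_ne (fun h' => hid (Arr.code_injective ?_)) _ _
      omega
  · rw [← h.inp j hj]
    exact Function.update_of_ne (by omega) _ _

theorem Rep.emit {μ : Mach} {σ : St} {s : State} (h : Rep μ σ s) (k : ℕ) : Rep μ (σ.emit k) s :=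
  ⟨h.var, h.base, h.arr, h.inp⟩

/-- Expressions. -/
inductive Ex
  | c (k : ℕ)
  | v (x : Var)
  | add (e f : Ex)
  | sub (e f : Ex)
  | a (id : Arr) (e : Ex)
  | inp (e : Ex)

instance (k : ℕ) : OfNat Ex k := ⟨Ex.c k⟩
instance : Add Ex := ⟨Ex.add⟩
instance : Sub Ex := ⟨Ex.sub⟩

def Ex.eval (μ : Mach) (σ : St) : Ex → ℕ
  | c k => k
  | v x => σ.v x
  | add e f => e.eval μ σ + f.eval μ σ
  | sub e f => e.eval μ σ - f.eval μ σ
  | a id e => σ.a id (e.eval μ σ)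
  | inp e => μ.inp (e.eval μ σ)

/-- The expression can be evaluated on the machine. -/
def Ex.Ok (μ : Mach) (σ : St) : Ex → Prop
  | c k => k < μ.lim
  | v _ => True
  | add e f => e.Ok μ σ ∧ f.Ok μ σ ∧ e.eval μ σ + f.eval μ σ < μ.lim
  | sub e f => e.Ok μ σ ∧ f.Ok μ σ
  | a _ e => e.Ok μ σ ∧ e.eval μ σ < μ.lim
  | inp e => e.Ok μ σ ∧ e.eval μ σ < μ.B

/-- An array access costs the eight steps of `addrProg` and the load. -/
def Ex.cost : Ex → ℕ
  | c _ => 1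
  | v _ => 1
  | add e f => e.cost + f.cost + 1
  | sub e f => e.cost + f.cost + 1
  | a _ e => e.cost + 9
  | inp e => e.cost + 1

section
variable (μ : Mach) (σ : St) (e f : Ex) (k : ℕ)
theorem Ex.eval_ofNat : (OfNat.ofNat k : Ex).eval μ σ = k := rfl
theorem Ex.eval_add : (e + f).eval μ σ = e.eval μ σ + f.eval μ σ := rfl
theorem Ex.eval_sub : (e - f).eval μ σ = e.eval μ σ - f.eval μ σ := rfl
theorem Ex.ok_ofNat : (OfNat.ofNat k : Ex).Ok μ σ ↔ k < μ.lim := Iff.rfl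
theorem Ex.ok_add :
    (e + f).Ok μ σ ↔ e.Ok μ σ ∧ f.Ok μ σ ∧ e.eval μ σ + f.eval μ σ < μ.lim := Iff.rfl
theorem Ex.ok_sub : (e - f).Ok μ σ ↔ e.Ok μ σ ∧ f.Ok μ σ := Iff.rfl
end

/-- Turn an index in scratch register `d` into an address of the array `id`. -/
def addrProg (id : Arr) (d : ℕ) : Prog :=
  .seq (.add (scr d) (scr d) (scr d)) (.seq (.add (scr d) (scr d) (scr d))
    (.seq (.add (scr d) (scr d) (scr d)) (.seq (.add (scr d) (scr d) (scr d))
      (.seq (.add (scr d) (scr d) (scr d)) (.seq (.add (scr d) (scr d) 1)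
        (.seq (.const (scr (d + 1)) id.code) (.add (scr d) (scr d) (scr (d + 1)))))))))

/-- Evaluate an expression into scratch register `d`. -/
def Ex.comp : Ex → ℕ → Prog
  | c k, d => .const (scr d) k
  | v x, d => .move (scr d) (2 * x.code)
  | add e f, d => .seq (e.comp d) (.seq (f.comp (d + 1)) (.add (scr d) (scr d) (scr (d + 1))))
  | sub e f, d => .seq (e.comp d) (.seq (f.comp (d + 1)) (.sub (scr d) (scr d) (scr (d + 1))))
  | a id e, d => .seq (e.comp d) (.seq (addrProg id d) (.load (scr d) (scr d)))
  | inp e, d => .seq (e.comp d) (.load (scr d) (scr d))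

/-- `s'` differs from `s` at most in scratch registers from `d` on. -/
def ScrEq (d : ℕ) (s s' : State) : Prop := ∀ c < d, s'.reg (scr c) = s.reg (scr c)

theorem scrEq_setReg (s : State) {d e : ℕ} (h : d ≤ e) (k : ℕ) :
    ScrEq d s (s.setReg (scr e) k) := fun c hc =>
  Function.update_of_ne (by unfold scr; omega) _ _

theorem ScrEq.trans {d e : ℕ} {s s' s'' : State} (h : ScrEq d s s') (h' : ScrEq e s' s'')
    (hde : d ≤ e) : ScrEq d s s'' := fun c hc => (h' c (by omega)).trans (h c hc)

/-- A run of silent steps. -/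
def sil (k : ℕ) : List Event := List.replicate k .silent

theorem sil_add (j k : ℕ) : sil j ++ sil k = sil (j + k) := by
  simp [sil]

theorem addrProg_exec {μ : Mach} {σ : St} {s : State} (h : Rep μ σ s) (id : Arr) (d : ℕ)
    (hi : s.reg (scr d) < μ.lim) :
    ∃ s', Exec μ.W (addrProg id d) s (sil 8) s' ∧ Rep μ σ s' ∧ ScrEq d s s' ∧
      s'.reg (scr d) = μ.B + 32 * s.reg (scr d) + id.code := by
  have hW := μ.hW
  have hid := id.code_lt
  set i := s.reg (scr d) with hidef
  have hs1 : scr d ≠ 1 := by unfold scr; omega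
  have hs2 : scr (d + 1) ≠ scr d := by unfold scr; omega
  have key : ∀ (s : State) (k : ℕ), s.reg (scr d) = k → Rep μ σ s → k + k < μ.W →
      ∃ s', Exec μ.W (.add (scr d) (scr d) (scr d)) s [.silent] s' ∧ Rep μ σ s' ∧
        ScrEq d s s' ∧ s'.reg (scr d) = 2 * k := by
    intro s k hk hr hlt
    refine ⟨_, Exec.add s _ _ _ (by rw [hk]; exact hlt), hr.setScr _ _,
      scrEq_setReg _ le_rfl _, ?_⟩
    simp [State.setReg, hk]; omega
  obtain ⟨s1, x1, r1, q1, v1⟩ := key s i rfl h (by omega)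
  obtain ⟨s2, x2, r2, q2, v2⟩ := key s1 _ v1 r1 (by omega)
  obtain ⟨s3, x3, r3, q3, v3⟩ := key s2 _ v2 r2 (by omega)
  obtain ⟨s4, x4, r4, q4, v4⟩ := key s3 _ v3 r3 (by omega)
  obtain ⟨s5, x5, r5, q5, v5⟩ := key s4 _ v4 r4 (by omega)
  have x6 := Exec.add s5 (scr d) (scr d) 1 (W := μ.W) (by rw [v5, r5.base]; omega)
  have r6 := r5.setScr d (s5.reg (scr d) + s5.reg 1)
  have q6 := scrEq_setReg s5 (le_refl d) (s5.reg (scr d) + s5.reg 1)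
  have v6 : (s5.setReg (scr d) (s5.reg (scr d) + s5.reg 1)).reg (scr d) = 32 * i + μ.B := by
    simp [State.setReg, v5, r5.base]; omega
  generalize s5.setReg (scr d) (s5.reg (scr d) + s5.reg 1) = s6 at *
  have x7 := Exec.const s6 (scr (d + 1)) id.code (W := μ.W) (by omega)
  have r7 := r6.setScr (d + 1) id.code
  have q7 := scrEq_setReg s6 (Nat.le_succ d) id.code
  have v7 : (s6.setReg (scr (d + 1)) id.code).reg (scr d) = 32 * i + μ.B := by
    rw [← v6]; exact Function.update_of_ne hs2.symm _ _
  have v7' : (s6.setReg (scr (d + 1)) id.code).reg (scr (d + 1)) = id.code := by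
    simp [State.setReg]
  generalize s6.setReg (scr (d + 1)) id.code = s7 at *
  have x8 := Exec.add s7 (scr d) (scr d) (scr (d + 1)) (W := μ.W) (by rw [v7, v7']; omega)
  refine ⟨_, ((x1.seq (x2.seq (x3.seq (x4.seq (x5.seq (x6.seq (x7.seq x8)))))))), r7.setScr _ _,
    ((((((q1.trans q2 le_rfl).trans q3 le_rfl).trans q4 le_rfl).trans q5 le_rfl).trans q6
      le_rfl).trans q7 le_rfl).trans (scrEq_setReg _ le_rfl _) le_rfl, ?_⟩
  simp [State.setReg, v7, v7']; omega

theorem Ex.comp_exec {μ : Mach} {σ : St} (e : Ex) (d : ℕ) {s : State} (h : Rep μ σ s)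
    (hok : e.Ok μ σ) :
    ∃ s', Exec μ.W (e.comp d) s (sil e.cost) s' ∧ Rep μ σ s' ∧ ScrEq d s s' ∧
      s'.reg (scr d) = e.eval μ σ := by
  have hW := μ.hW
  have hbin : ∀ (e f : Ex),
      (∀ (d : ℕ) {s : State}, Rep μ σ s → e.Ok μ σ →
        ∃ s', Exec μ.W (e.comp d) s (sil e.cost) s' ∧ Rep μ σ s' ∧ ScrEq d s s' ∧
        s'.reg (scr d) = e.eval μ σ) →
      (∀ (d : ℕ) {s : State}, Rep μ σ s → f.Ok μ σ →
        ∃ s', Exec μ.W (f.comp d) s (sil f.cost) s' ∧ Rep μ σ s' ∧ ScrEq d s s' ∧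
        s'.reg (scr d) = f.eval μ σ) → e.Ok μ σ → f.Ok μ σ →
      ∀ (d : ℕ) {s : State}, Rep μ σ s → ∃ s1 s2, Exec μ.W (e.comp d) s (sil e.cost) s1 ∧
        Exec μ.W (f.comp (d + 1)) s1 (sil f.cost) s2 ∧ Rep μ σ s2 ∧ ScrEq d s s2 ∧
        s2.reg (scr d) = e.eval μ σ ∧ s2.reg (scr (d + 1)) = f.eval μ σ := by
    intro e f ihe ihf he hf d s h
    obtain ⟨s1, x1, r1, q1, v1⟩ := ihe d h he
    obtain ⟨s2, x2, r2, q2, v2⟩ := ihf (d + 1) r1 hf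
    exact ⟨s1, s2, x1, x2, r2, q1.trans q2 (Nat.le_succ _), (q2 d (by omega)).trans v1, v2⟩
  induction e generalizing d s with
  | c k =>
    simp only [Ex.Ok] at hok
    exact ⟨_, Exec.const s _ _ (by omega), h.setScr _ _, scrEq_setReg _ le_rfl _,
      by simp [State.setReg, Ex.eval]⟩
  | v x =>
    exact ⟨_, Exec.move s _ _, h.setScr _ _, scrEq_setReg _ le_rfl _,
      by simp [State.setReg, Ex.eval, h.var]⟩
  | add e f ihe ihf =>
    obtain ⟨s1, s2, x1, x2, r2, q2, v1, v2⟩ := hbin e f ihe ihf hok.1 hok.2.1 d h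
    have hlt := hok.2.2
    have x3 := Exec.add s2 (scr d) (scr d) (scr (d + 1)) (W := μ.W) (by rw [v1, v2]; omega)
    refine ⟨s2.setReg (scr d) (s2.reg (scr d) + s2.reg (scr (d + 1))), ?_, r2.setScr _ _,
      q2.trans (scrEq_setReg _ le_rfl _) le_rfl, ?_⟩
    · have := x1.seq (x2.seq x3)
      rwa [show [Event.silent] = sil 1 from rfl, sil_add, sil_add, ← Nat.add_assoc] at this
    · simp [State.setReg, Ex.eval, v1, v2]
  | sub e f ihe ihf =>
    obtain ⟨s1, s2, x1, x2, r2, q2, v1, v2⟩ := hbin e f ihe ihf hok.1 hok.2 d h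
    have x3 := Exec.sub s2 (scr d) (scr d) (scr (d + 1)) (W := μ.W)
    refine ⟨s2.setReg (scr d) (s2.reg (scr d) - s2.reg (scr (d + 1))), ?_, r2.setScr _ _,
      q2.trans (scrEq_setReg _ le_rfl _) le_rfl, ?_⟩
    · have := x1.seq (x2.seq x3)
      rwa [show [Event.silent] = sil 1 from rfl, sil_add, sil_add, ← Nat.add_assoc] at this
    · simp [State.setReg, Ex.eval, v1, v2]
  | a id e ih =>
    obtain ⟨s1, x1, r1, q1, v1⟩ := ih d h hok.1
    obtain ⟨s2, x2, r2, q2, v2⟩ := addrProg_exec r1 id d (v1 ▸ hok.2)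
    have x3 := Exec.load s2 (scr d) (scr d) (W := μ.W)
    refine ⟨s2.setReg (scr d) (s2.mem (s2.reg (scr d))), ?_, r2.setScr _ _, (q1.trans q2 le_rfl).trans (scrEq_setReg _ le_rfl _) le_rfl, ?_⟩
    · have := x1.seq (x2.seq x3)
      rwa [show [Event.silent] = sil 1 from rfl, sil_add, sil_add] at this
    · simp [State.setReg, Ex.eval, v2, v1, r2.arr]
  | inp e ih =>
    obtain ⟨s1, x1, r1, q1, v1⟩ := ih d h hok.1
    have x3 := Exec.load s1 (scr d) (scr d) (W := μ.W)
    refine ⟨s1.setReg (scr d) (s1.mem (s1.reg (scr d))), ?_, r1.setScr _ _, q1.trans (scrEq_setReg _ le_rfl _) le_rfl, ?_⟩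
    · have := x1.seq x3
      rwa [show [Event.silent] = sil 1 from rfl, sil_add] at this
    · simp only [State.setReg, Ex.eval, v1, Function.update_self]
      exact r1.inp _ hok.2

/-- Tests. -/
inductive Tst
  | lt (e f : Ex)
  | eq (e f : Ex)

def Tst.Holds (μ : Mach) (σ : St) : Tst → Prop
  | lt e f => e.eval μ σ < f.eval μ σ
  | eq e f => e.eval μ σ = f.eval μ σ

def Tst.Ok (μ : Mach) (σ : St) : Tst → Prop
  | lt e f => e.Ok μ σ ∧ f.Ok μ σ
  | eq e f => e.Ok μ σ ∧ f.Ok μ σ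

def Tst.cost : Tst → ℕ
  | lt e f => e.cost + f.cost
  | eq e f => e.cost + f.cost

def Tst.test : Tst → Test
  | lt _ _ => .lt (scr 0) (scr 1)
  | eq _ _ => .eq (scr 0) (scr 1)

/-- Evaluate both sides of a test. -/
def Tst.comp : Tst → Prog
  | lt e f => .seq (e.comp 0) (f.comp 1)
  | eq e f => .seq (e.comp 0) (f.comp 1)

theorem Tst.comp_exec {μ : Mach} {σ : St} (t : Tst) {s : State} (h : Rep μ σ s)
    (hok : t.Ok μ σ) :
    ∃ s', Exec μ.W t.comp s (sil t.cost) s' ∧ Rep μ σ s' ∧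
      (t.test.Holds s' ↔ t.Holds μ σ) := by
  cases t with
  | lt e f =>
    obtain ⟨s1, x1, r1, -, v1⟩ := e.comp_exec 0 h hok.1
    obtain ⟨s2, x2, r2, q2, v2⟩ := f.comp_exec 1 r1 hok.2
    refine ⟨s2, ?_, r2, ?_⟩
    · have := x1.seq x2
      rwa [sil_add] at this
    · simp only [Tst.test, Test.Holds, Tst.Holds, v2, (q2 0 (by omega)).trans v1]
  | eq e f =>
    obtain ⟨s1, x1, r1, -, v1⟩ := e.comp_exec 0 h hok.1
    obtain ⟨s2, x2, r2, q2, v2⟩ := f.comp_exec 1 r1 hok.2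
    refine ⟨s2, ?_, r2, ?_⟩
    · have := x1.seq x2
      rwa [sil_add] at this
    · simp only [Tst.test, Test.Holds, Tst.Holds, v2, (q2 0 (by omega)).trans v1]

/-- Commands. -/
inductive Cmd
  | skip
  | set (x : Var) (e : Ex)
  | sto (id : Arr) (e f : Ex)
  | write (e : Ex)
  | seq (c d : Cmd)
  | ite (t : Tst) (c d : Cmd)
  | loop (t : Tst) (c : Cmd)

infixr:60 " ;; " => Cmd.seq

def Cmd.comp : Cmd → Prog
  | skip => .skip
  | set x e => .seq (e.comp 0) (.move (2 * x.code) (scr 0))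
  | sto id e f => .seq (e.comp 0) (.seq (addrProg id 0) (.seq (f.comp 1) (.store (scr 0) (scr 1))))
  | write e => .seq (e.comp 0) (.write (scr 0))
  | seq c d => .seq c.comp d.comp
  | ite t c d => .seq t.comp (.ite t.test c.comp d.comp)
  | .loop t c => .seq t.comp (.loop t.test (.seq c.comp t.comp))

/-- From `σ`, command `c` runs in at most `k` steps, without completing a solution, to a state
that satisfies `Q`. -/
def wp (μ : Mach) (c : Cmd) (k : ℕ) (Q : St → Prop) (σ : St) : Prop :=
  ∀ s, Rep μ σ s → ∃ t s' σ', Exec μ.W c.comp s t s' ∧ Rep μ σ' s' ∧ Event.done ∉ t ∧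
    σ'.out = σ.out ++ written t ∧ t.length ≤ k ∧ Q σ'

theorem written_append (t t' : List Event) : written (t ++ t') = written t ++ written t' :=
  List.filterMap_append

theorem written_sil (k : ℕ) : written (sil k) = [] := by
  cases k with
  | zero => rfl
  | succ k => simp [sil, List.replicate_succ, written]

theorem done_notMem_sil (k : ℕ) : Event.done ∉ sil k := by
  intro h
  have := List.eq_of_mem_replicate h
  simp at this

theorem length_sil (k : ℕ) : (sil k).length = k := List.length_replicate

/-! ### Rules for commands with step bounds -/

variable {μ : Mach} {σ : St} {Q Q' : St → Prop} {c d : Cmd}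

theorem wp_mono {k k' : ℕ} (h : wp μ c k Q σ) (hk : k ≤ k') (hQ : ∀ σ, Q σ → Q' σ) :
    wp μ c k' Q' σ := by
  intro s hs
  obtain ⟨t, s', σ', h1, h2, h3, h4, h5, h6⟩ := h s hs
  exact ⟨t, s', σ', h1, h2, h3, h4, h5.trans hk, hQ _ h6⟩

theorem wp_skip (h : Q σ) : wp μ .skip 1 Q σ := fun s hs =>
  ⟨_, s, σ, Exec.skip s, hs, by simp, by simp [written], by simp, h⟩

theorem wp_seq {k1 k2 : ℕ} (h : wp μ c k1 (wp μ d k2 Q) σ) : wp μ (c ;; d) (k1 + k2) Q σ := by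
  intro s hs
  obtain ⟨t, s', σ', h1, h2, h3, h4, h5, h6⟩ := h s hs
  obtain ⟨t', s'', σ'', g1, g2, g3, g4, g5, g6⟩ := h6 s' h2
  refine ⟨_, _, _, h1.seq g1, g2, by simp [h3, g3], ?_, by simp; omega, g6⟩
  rw [g4, h4, written_append, List.append_assoc]

theorem wp_set {x : Var} {e : Ex} (hok : e.Ok μ σ) (h : Q (σ.set x (e.eval μ σ))) :
    wp μ (.set x e) (e.cost + 1) Q σ := by
  intro s hs
  obtain ⟨s1, x1, r1, -, v1⟩ := e.comp_exec 0 hs hok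
  have x2 := Exec.move s1 (2 * x.code) (scr 0) (W := μ.W)
  have r2 := r1.setVar x (s1.reg (scr 0))
  rw [v1] at r2 x2
  have x3 := x1.seq x2
  rw [show [Event.silent] = sil 1 from rfl, sil_add] at x3
  exact ⟨_, _, _, x3, r2, done_notMem_sil _, by simp [written_sil], (length_sil _).le, h⟩

theorem wp_sto {id : Arr} {e f : Ex} (he : e.Ok μ σ) (hf : f.Ok μ σ) (hl : e.eval μ σ < μ.lim)
    (h : Q (σ.sto id (e.eval μ σ) (f.eval μ σ))) :
    wp μ (.sto id e f) (e.cost + f.cost + 9) Q σ := by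
  intro s hs
  obtain ⟨s1, x1, r1, -, v1⟩ := e.comp_exec 0 hs he
  obtain ⟨s2, x2, r2, -, v2⟩ := addrProg_exec r1 id 0 (v1 ▸ hl)
  obtain ⟨s3, x3, r3, q3, v3⟩ := f.comp_exec 1 r2 hf
  have x4 := Exec.store s3 (scr 0) (scr 1) (W := μ.W)
  rw [(q3 0 (by omega)).trans v2, v3, v1] at x4
  have x5 := x1.seq (x2.seq (x3.seq x4))
  rw [show [Event.silent] = sil 1 from rfl, sil_add, sil_add, sil_add] at x5
  exact ⟨_, _, _, x5, r3.setArr _ _ _, done_notMem_sil _, by simp [written_sil],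
    by rw [length_sil]; omega, h⟩

theorem wp_write {e : Ex} (hok : e.Ok μ σ) (h : Q (σ.emit (e.eval μ σ))) :
    wp μ (.write e) (e.cost + 1) Q σ := by
  intro s hs
  obtain ⟨s1, x1, r1, -, v1⟩ := e.comp_exec 0 hs hok
  have x2 := Exec.write s1 (scr 0) (W := μ.W)
  rw [v1] at x2
  refine ⟨_, _, _, x1.seq x2, r1.emit _, ?_, ?_, ?_, h⟩
  · simp [done_notMem_sil]
  · rw [written_append, written_sil]; rfl
  · simp [length_sil]

theorem wp_ite {t : Tst} {k : ℕ} (hok : t.Ok μ σ) (h1 : t.Holds μ σ → wp μ c k Q σ)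
    (h2 : ¬ t.Holds μ σ → wp μ d k Q σ) : wp μ (.ite t c d) (t.cost + 1 + k) Q σ := by
  intro s hs
  obtain ⟨s1, x1, r1, v1⟩ := t.comp_exec hs hok
  by_cases ht : t.Holds μ σ
  · obtain ⟨u, s', σ', g1, g2, g3, g4, g5, g6⟩ := h1 ht s1 r1
    refine ⟨_, _, _, x1.seq (Exec.ite_true (v1.2 ht) g1), g2, ?_, ?_, ?_, g6⟩
    · simp [done_notMem_sil, g3]
    · rw [written_append, written_sil, g4]; rfl
    · simp [length_sil]; omega
  · obtain ⟨u, s', σ', g1, g2, g3, g4, g5, g6⟩ := h2 ht s1 r1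
    refine ⟨_, _, _, x1.seq (Exec.ite_false (mt v1.1 ht) g1), g2, ?_, ?_, ?_, g6⟩
    · simp [done_notMem_sil, g3]
    · rw [written_append, written_sil, g4]; rfl
    · simp [length_sil]; omega

/-- Loops; the index of the invariant is the remaining budget of steps. -/
theorem wp_loop {t : Tst} (I : ℕ → St → Prop) {k : ℕ}
    (hI : ∀ k σ, I k σ → t.Ok μ σ ∧
      (t.Holds μ σ → ∃ k1 k2, k1 + k2 + t.cost + 1 ≤ k ∧ wp μ c k1 (I k2) σ) ∧
      (¬ t.Holds μ σ → 1 ≤ k ∧ Q σ)) (h : I k σ) :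
    wp μ (.loop t c) (t.cost + k) Q σ := by
  -- The compiled loop evaluates its test before the first round and again at the end of every
  -- round, so the induction speaks about states in which the operands of the test already lie in
  -- the scratch registers.
  have main : ∀ k σ s, I k σ → Rep μ σ s → (t.test.Holds s ↔ t.Holds μ σ) →
      ∃ u s' σ', Exec μ.W (.loop t.test (.seq c.comp t.comp)) s u s' ∧ Rep μ σ' s' ∧
        Event.done ∉ u ∧ σ'.out = σ.out ++ written u ∧ u.length ≤ k ∧ Q σ' := by
    intro k
    induction k using Nat.strong_induction_on with
    | _ k ih =>
    intro σ s hk hs ht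
    obtain ⟨hok, h1, h2⟩ := hI k σ hk
    by_cases hh : t.Holds μ σ
    · obtain ⟨k1, k2, hle, hw⟩ := h1 hh
      obtain ⟨u, s1, σ1, g1, g2, g3, g4, g5, g6⟩ := hw s hs
      obtain ⟨s2, x2, r2, v2⟩ := t.comp_exec g2 (hI _ _ g6).1
      obtain ⟨u', s3, σ3, f1, f2, f3, f4, f5, f6⟩ := ih k2 (by omega) σ1 s2 g6 r2 v2
      refine ⟨_, s3, σ3, Exec.loop_true (ht.2 hh) (g1.seq x2) f1, f2, ?_, ?_, ?_, f6⟩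
      · simp [g3, f3, done_notMem_sil]
      · have : written (Event.silent :: (u ++ sil t.cost ++ u')) = written u ++ written u' := by
          have := written_append [Event.silent] (u ++ sil t.cost ++ u')
          simp only [List.singleton_append] at this
          rw [this, written_append, written_append, written_sil]
          simp [written]
        rw [this, f4, g4, List.append_assoc]
      · simp [length_sil]; omega
    · obtain ⟨hk1, hq⟩ := h2 hh
      exact ⟨_, s, σ, Exec.loop_false (mt ht.1 hh), hs, by simp, by simp [written], by simp; omega, hq⟩
  intro s hs
  obtain ⟨s1, x1, r1, v1⟩ := t.comp_exec hs (hI _ _ h).1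
  obtain ⟨u, s', σ', g1, g2, g3, g4, g5, g6⟩ := main k σ s1 h r1 v1
  refine ⟨_, s', σ', x1.seq g1, g2, by simp [g3, done_notMem_sil], ?_, ?_, g6⟩
  · rw [written_append, written_sil, g4]; rfl
  · simp [length_sil]; omega

/-- The running time of a command without loops. -/
def Cmd.cost : Cmd → ℕ
  | skip => 1
  | set _ e => e.cost + 1
  | sto _ e f => e.cost + f.cost + 9
  | write e => e.cost + 1
  | seq c d => c.cost + d.cost
  | ite t c d => t.cost + 1 + (c.cost + d.cost)
  | .loop _ _ => 0

/-- Verification conditions of a command without loops. -/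
def Cmd.vc (μ : Mach) : Cmd → (St → Prop) → St → Prop
  | skip, Q, σ => Q σ
  | set x e, Q, σ => e.Ok μ σ ∧ Q (σ.set x (e.eval μ σ))
  | sto id e f, Q, σ => e.Ok μ σ ∧ f.Ok μ σ ∧ e.eval μ σ < μ.lim ∧
      Q (σ.sto id (e.eval μ σ) (f.eval μ σ))
  | write e, Q, σ => e.Ok μ σ ∧ Q (σ.emit (e.eval μ σ))
  | seq c d, Q, σ => c.vc μ (d.vc μ Q) σ
  | ite t c d, Q, σ => t.Ok μ σ ∧ (t.Holds μ σ → c.vc μ Q σ) ∧ (¬ t.Holds μ σ → d.vc μ Q σ)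
  | .loop _ _, _, _ => False

theorem Cmd.vc_mono (c : Cmd) (h : c.vc μ Q σ) (hQ : ∀ σ, Q σ → Q' σ) : c.vc μ Q' σ := by
  induction c generalizing Q Q' σ with
  | skip => exact hQ _ h
  | set x e => exact ⟨h.1, hQ _ h.2⟩
  | sto id e f => exact ⟨h.1, h.2.1, h.2.2.1, hQ _ h.2.2.2⟩
  | write e => exact ⟨h.1, hQ _ h.2⟩
  | seq c d ihc ihd => exact ihc h fun σ h' => ihd h' hQ
  | ite t c d ihc ihd =>
    exact ⟨h.1, fun ht => ihc (h.2.1 ht) hQ, fun ht => ihd (h.2.2 ht) hQ⟩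
  | loop t c => exact h

theorem wp_of_vc (c : Cmd) (h : c.vc μ Q σ) : wp μ c c.cost Q σ := by
  induction c generalizing Q σ with
  | skip => exact wp_skip h
  | set x e => exact wp_set h.1 h.2
  | sto id e f => exact wp_sto h.1 h.2.1 h.2.2.1 h.2.2.2
  | write e => exact wp_write h.1 h.2
  | seq c d ihc ihd => exact wp_seq (wp_mono (ihc h) le_rfl fun σ h' => ihd h')
  | ite t c d ihc ihd =>
    exact wp_ite h.1 (fun ht => wp_mono (ihc (h.2.1 ht)) (by omega) fun _ => id)
      (fun ht => wp_mono (ihd (h.2.2 ht)) (by omega) fun _ => id)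
  | loop t c => exact h.elim

end WordRAM

/-! ### The arrays of the search: graph, buckets, labels -/

namespace WordRAM

open CausalGraph

attribute [simp] Cmd.vc Ex.Ok Ex.eval Tst.Ok Tst.Holds Ex.eval_ofNat Ex.eval_add Ex.eval_sub
  Ex.ok_ofNat Ex.ok_add Ex.ok_sub

/-! ### Frames and the representation of the graph -/

/-- `σ'` differs from `σ` at most in the arrays `as` and the variables `vs`. -/
structure Fr (as : List Arr) (vs : List Var) (σ σ' : St) : Prop where
  arr : ∀ id, id ∉ as → σ'.a id = σ.a id
  var : ∀ x, x ∉ vs → σ'.v x = σ.v x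
  out : σ'.out = σ.out

theorem Fr.refl (as vs) (σ : St) : Fr as vs σ σ := ⟨fun _ _ => rfl, fun _ _ => rfl, rfl⟩

theorem Fr.mono {as as' : List Arr} {vs vs' : List Var} {σ σ' : St} (h : Fr as vs σ σ')
    (ha : ∀ id ∈ as, id ∈ as') (hv : ∀ x ∈ vs, x ∈ vs') : Fr as' vs' σ σ' :=
  ⟨fun id hid => h.arr id fun h' => hid (ha id h'), fun x hx => h.var x fun h' => hx (hv x h'),
    h.out⟩

theorem Fr.trans {as : List Arr} {vs : List Var} {σ σ' σ'' : St} (h : Fr as vs σ σ')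
    (h' : Fr as vs σ' σ'') : Fr as vs σ σ'' :=
  ⟨fun id hid => (h'.arr id hid).trans (h.arr id hid),
    fun x hx => (h'.var x hx).trans (h.var x hx), h'.out.trans h.out⟩

@[simp] theorem Fr.refl_iff (as vs) (σ : St) : Fr as vs σ σ ↔ True := iff_true_intro (.refl _ _ _)

@[simp] theorem Fr.set_iff {as vs} {σ σ' : St} {x : Var} {k : ℕ} (hx : x ∈ vs) :
    Fr as vs σ (σ'.set x k) ↔ Fr as vs σ σ' := by
  have key : ∀ y, y ∉ vs → (σ'.set x k).v y = σ'.v y := by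
    intro y hy
    rw [St.set_v, if_neg]
    rintro rfl; exact hy hx
  exact ⟨fun h => ⟨h.arr, fun y hy => (key y hy).symm.trans (h.var y hy), h.out⟩,
    fun h => ⟨h.arr, fun y hy => (key y hy).trans (h.var y hy), h.out⟩⟩

@[simp] theorem Fr.sto_iff {as vs} {σ σ' : St} {id : Arr} {i k : ℕ} (hx : id ∈ as) :
    Fr as vs σ (σ'.sto id i k) ↔ Fr as vs σ σ' := by
  have key : ∀ y, y ∉ as → (σ'.sto id i k).a y = σ'.a y := by
    intro y hy
    rw [St.sto_a, if_neg]
    rintro rfl; exact hy hx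
  exact ⟨fun h => ⟨fun y hy => (key y hy).symm.trans (h.arr y hy), h.var, h.out⟩,
    fun h => ⟨fun y hy => (key y hy).trans (h.arr y hy), h.var, h.out⟩⟩

/-- `sl x` lists the vertices `y` with an edge from `x` to `y`, with flag `1` for directed and `0`
for undirected edges. -/
structure SuccList {n : ℕ} (G : Digraph (Fin n)) (sl : Fin n → List (Fin n × ℕ)) : Prop where
  nodup : ∀ x, ((sl x).map Prod.fst).Nodup
  mem : ∀ x y f, (y, f) ∈ sl x ↔ DirEdge G x y ∧ f = 1 ∨ UndirEdge G x y ∧ f = 0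

/-- The arrays that describe the graph. -/
structure Stat {n : ℕ} (G : Digraph (Fin n)) (sl : Fin n → List (Fin n × ℕ)) (σ : St) :
    Prop where
  size : σ.v .n = n
  row : ∀ x ≤ n, σ.a .row x = x * n
  deg : ∀ x : Fin n, σ.a .deg x = (sl x).length
  tgt : ∀ (x : Fin n) (j : ℕ) (hj : j < (sl x).length), σ.a .tgt (x * n + j) = ((sl x)[j]).1
  flg : ∀ (x : Fin n) (j : ℕ) (hj : j < (sl x).length), σ.a .flg (x * n + j) = ((sl x)[j]).2
  adj : ∀ x y : Fin n, σ.a .adj (x * n + y) = 1 ↔ Adjacent G x y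

/-- The bound for indices and sums is large enough for `n` vertices. -/
def Room (μ : Mach) (n : ℕ) : Prop := (n + 2) * (n + 2) + 64 + μ.B ≤ μ.lim

theorem Stat.fr {n : ℕ} {G : Digraph (Fin n)} {sl : Fin n → List (Fin n × ℕ)}
    {σ σ' : St} {as vs} (h : Stat G sl σ) (hf : Fr as vs σ σ')
    (ha : ∀ id ∈ as, id ∉ [Arr.row, .deg, .tgt, .flg, .adj]) (hv : ∀ x ∈ vs, x ≠ Var.n) :
    Stat G sl σ' := by
  have e : ∀ id ∈ [Arr.row, .deg, .tgt, .flg, .adj], σ'.a id = σ.a id := fun id hid =>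
    hf.arr id fun h' => ha id h' hid
  refine ⟨(hf.var _ fun h' => hv _ h' rfl).trans h.size, ?_, ?_, ?_, ?_, ?_⟩
  · rw [e _ (by simp)]; exact h.row
  · rw [e _ (by simp)]; exact h.deg
  · rw [e _ (by simp)]; exact h.tgt
  · rw [e _ (by simp)]; exact h.flg
  · rw [e _ (by simp)]; exact h.adj

theorem Room.idx {μ : Mach} {n l j : ℕ} (h : Room μ n) (hl : l ≤ n) (hj : j ≤ n + 2) :
    l * n + j + μ.B + 8 < μ.lim := by
  unfold Room at h
  have h1 : l * n ≤ n * n := Nat.mul_le_mul_right _ hl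
  have h2 : (n + 2) * (n + 2) = n * n + 4 * n + 4 := by ring
  omega

theorem Room.small {μ : Mach} {n j : ℕ} (h : Room μ n) (hj : j ≤ n + 2) :
    j + μ.B + 8 < μ.lim := by
  have := h.idx (Nat.zero_le n) hj
  omega

/-! ### Bucket lists -/

/-- The buckets hold exactly the vertices in `S`, vertex `y` in bucket `lb y`. -/
structure Lists {n : ℕ} (lb : Fin n → ℕ) (S : Finset (Fin n)) (σ : St) : Prop where
  pos_lt : ∀ y ∈ S, σ.a .pos y < σ.a .blen (lb y)
  bkt_pos : ∀ y ∈ S, σ.a .bkt (lb y * n + σ.a .pos y) = y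
  mem : ∀ l ≤ n, ∀ j < σ.a .blen l, ∃ y ∈ S, lb y = l ∧ σ.a .pos y = j

theorem Lists.fr {n : ℕ} {lb lb' : Fin n → ℕ} {S S' : Finset (Fin n)} {σ σ' : St} {as vs}
    (h : Lists lb S σ) (hf : Fr as vs σ σ') (ha : ∀ id ∈ as, id ∉ [Arr.bkt, .blen, .pos])
    (hlb : ∀ y ∈ S, lb' y = lb y) (hS : S' = S) : Lists lb' S' σ' := by
  subst hS
  have e : ∀ id ∈ [Arr.bkt, .blen, .pos], σ'.a id = σ.a id := fun id hid =>
    hf.arr id fun h' => ha id h' hid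
  refine ⟨fun y hy => ?_, fun y hy => ?_, ?_⟩
  · rw [e _ (by simp), e _ (by simp), hlb y hy]; exact h.pos_lt y hy
  · rw [e _ (by simp), e _ (by simp), hlb y hy]; exact h.bkt_pos y hy
  · rw [e _ (by simp), e _ (by simp)]
    intro l hl j hj
    obtain ⟨y, hy, h1, h2⟩ := h.mem l hl j hj
    exact ⟨y, hy, (hlb y hy).trans h1, h2⟩

theorem Lists.blen_le {n : ℕ} {lb : Fin n → ℕ} {S : Finset (Fin n)} {σ : St} (h : Lists lb S σ)
    {l : ℕ} (hl : l ≤ n) : σ.a .blen l ≤ S.card := by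
  have : Finset.range (σ.a .blen l) ⊆ S.image fun y : Fin n => σ.a .pos y := by
    intro j hj
    obtain ⟨y, hy, -, h2⟩ := h.mem l hl j (Finset.mem_range.1 hj)
    exact Finset.mem_image.2 ⟨y, hy, h2⟩
  simpa using (Finset.card_le_card this).trans Finset.card_image_le

theorem mul_add_inj {n l l' j j' : ℕ} (hj : j < n) (hj' : j' < n)
    (h : l * n + j = l' * n + j') : l = l' ∧ j = j' := by
  have h1 : (l * n + j) / n = l := by
    rw [mul_comm, Nat.mul_add_div (by omega), Nat.div_eq_of_lt hj, add_zero]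
  have h2 : (l' * n + j') / n = l' := by
    rw [mul_comm, Nat.mul_add_div (by omega), Nat.div_eq_of_lt hj', add_zero]
  have : l = l' := by rw [← h1, ← h2, h]
  subst this
  exact ⟨rfl, by omega⟩

/-- Deletion in constant time: the last entry `w` of the bucket takes over the place of `y`. The
case `w = y` is included. -/
theorem Lists.remove {n : ℕ} {lb : Fin n → ℕ} {S : Finset (Fin n)} {σ σ' : St} (h : Lists lb S σ)
    (hlb : ∀ y, lb y ≤ n) {y w : Fin n} (hy : y ∈ S) (hw : w ∈ S) (hwy : lb w = lb y)
    (hwp : σ.a .pos w = σ.a .blen (lb y) - 1)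
    (h1 : σ'.a .blen = Function.update (σ.a .blen) (lb y) (σ.a .blen (lb y) - 1))
    (h2 : σ'.a .bkt = Function.update (σ.a .bkt) (lb y * n + σ.a .pos y) w)
    (h3 : σ'.a .pos = Function.update (σ.a .pos) w (σ.a .pos y)) :
    Lists lb (S.erase y) σ' := by
  have hn : ∀ z ∈ S, σ.a .pos z < n := fun z hz =>
    (h.pos_lt z hz).trans_le ((h.blen_le (hlb z)).trans (S.card_le_univ.trans (by simp)))
  have hinj : ∀ z ∈ S, ∀ z' ∈ S, lb z = lb z' → σ.a .pos z = σ.a .pos z' → z = z' := by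
    intro z hz z' hz' e1 e2
    have e3 := h.bkt_pos z hz
    rw [e1, e2, h.bkt_pos z' hz'] at e3
    exact (Fin.ext e3).symm
  have hyl := h.pos_lt y hy
  have hwl := h.pos_lt w hw
  refine ⟨fun z hz => ?_, fun z hz => ?_, fun l hl j hj => ?_⟩
  · obtain ⟨hzy, hz⟩ := Finset.mem_erase.1 hz
    have hzl := h.pos_lt z hz
    simp only [h1, h3, Function.update_apply, Fin.val_inj]
    by_cases hzw : z = w
    · subst hzw
      rw [if_pos rfl, if_pos hwy]
      have : σ.a .pos y ≠ σ.a .pos z := fun e => hzy (hinj _ hz _ hy hwy e.symm)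
      omega
    · rw [if_neg hzw]
      split_ifs with e
      · have : σ.a .pos z ≠ σ.a .pos w := fun e' => hzw (hinj _ hz _ hw (e.trans hwy.symm) e')
        rw [e] at hzl
        omega
      · exact hzl
  · obtain ⟨hzy, hz⟩ := Finset.mem_erase.1 hz
    simp only [h2, h3, Function.update_apply, Fin.val_inj]
    by_cases hzw : z = w
    · subst hzw
      rw [if_pos rfl, if_pos (by rw [hwy])]
    · rw [if_neg hzw, if_neg, h.bkt_pos z hz]
      intro e
      obtain ⟨e1, e2⟩ := mul_add_inj (hn z hz) (hn y hy) e
      exact hzy (hinj _ hz _ hy e1 e2)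
  · simp only [h1, Function.update_apply] at hj
    have hj' : j < σ.a .blen l := by
      split_ifs at hj with e
      · subst e; omega
      · exact hj
    obtain ⟨z, hz, e1, e2⟩ := h.mem l hl j hj'
    by_cases hzy : z = y
    · subst hzy
      rw [if_pos e1.symm, ← e2] at hj
      have hne : w ≠ z := by rintro rfl; omega
      refine ⟨w, Finset.mem_erase.2 ⟨hne, hw⟩, hwy.trans e1, ?_⟩
      rw [h3, Function.update_self, e2]
    · refine ⟨z, Finset.mem_erase.2 ⟨hzy, hz⟩, e1, ?_⟩
      have hne : z ≠ w := by
        rintro rfl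
        rw [if_pos (e1.symm.trans hwy), ← e2] at hj
        omega
      rw [h3, Function.update_of_ne (fun e => hne (Fin.ext e)), e2]

theorem Lists.insert {n : ℕ} {lb : Fin n → ℕ} {S : Finset (Fin n)} {σ σ' : St} (h : Lists lb S σ)
    (hlb : ∀ y, lb y ≤ n) {y : Fin n} (hy : y ∉ S)
    (h1 : σ'.a .blen = Function.update (σ.a .blen) (lb y) (σ.a .blen (lb y) + 1))
    (h2 : σ'.a .bkt = Function.update (σ.a .bkt) (lb y * n + σ.a .blen (lb y)) y)
    (h3 : σ'.a .pos = Function.update (σ.a .pos) y (σ.a .blen (lb y))) :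
    Lists lb (insert y S) σ' := by
  have hS : S.card < n := by
    have := Finset.card_lt_univ_of_notMem hy
    simpa using this
  have hn : ∀ z ∈ S, σ.a .pos z < n := fun z hz =>
    (h.pos_lt z hz).trans_le ((h.blen_le (hlb z)).trans hS.le)
  have hb : σ.a .blen (lb y) < n := (h.blen_le (hlb y)).trans_lt hS
  refine ⟨fun z hz => ?_, fun z hz => ?_, fun l hl j hj => ?_⟩
  · simp only [h1, h3, Function.update_apply, Fin.val_inj]
    by_cases hzy : z = y
    · subst hzy; simp
    · have := h.pos_lt z (Finset.mem_of_mem_insert_of_ne hz hzy)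
      rw [if_neg hzy]
      split_ifs with e
      · rw [e] at this; omega
      · exact this
  · simp only [h2, h3, Function.update_apply, Fin.val_inj]
    by_cases hzy : z = y
    · subst hzy; simp
    · have hz' := Finset.mem_of_mem_insert_of_ne hz hzy
      rw [if_neg hzy, if_neg, h.bkt_pos z hz']
      intro e
      obtain ⟨e1, e2⟩ := mul_add_inj (hn z hz') hb e
      have := h.pos_lt z hz'
      rw [e1] at this
      omega
  · have key : j < σ.a .blen l → ∃ z ∈ Insert.insert y S, lb z = l ∧ σ'.a .pos z = j := by
      intro hj'
      obtain ⟨z, hz, e1, e2⟩ := h.mem l hl j hj'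
      refine ⟨z, Finset.mem_insert_of_mem hz, e1, ?_⟩
      have hne : z ≠ y := by rintro rfl; exact hy hz
      rw [h3, Function.update_of_ne (fun e => hne (Fin.ext e)), e2]
    by_cases e : l = lb y
    · subst e
      rw [h1, Function.update_self] at hj
      by_cases hj' : j < σ.a .blen (lb y)
      · exact key hj'
      · exact ⟨y, Finset.mem_insert_self _ _, rfl, by rw [h3, Function.update_self]; omega⟩
    · rw [h1, Function.update_of_ne e] at hj
      exact key hj

/-- Remove the vertex in `y` from its bucket. -/
def removeY : Cmd :=
  .set .b (Ex.a .blen (Ex.a .lab (Ex.v .y)) - 1) ;;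
  .sto .blen (Ex.a .lab (Ex.v .y)) (Ex.v .b) ;;
  .set .w (Ex.a .bkt (Ex.a .row (Ex.a .lab (Ex.v .y)) + Ex.v .b)) ;;
  .sto .bkt (Ex.a .row (Ex.a .lab (Ex.v .y)) + Ex.a .pos (Ex.v .y)) (Ex.v .w) ;;
  .sto .pos (Ex.v .w) (Ex.a .pos (Ex.v .y))

/-- Put the vertex in `y` into its bucket. -/
def insertY : Cmd :=
  .set .b (Ex.a .blen (Ex.a .lab (Ex.v .y))) ;;
  .sto .bkt (Ex.a .row (Ex.a .lab (Ex.v .y)) + Ex.v .b) (Ex.v .y) ;;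
  .sto .pos (Ex.v .y) (Ex.v .b) ;;
  .sto .blen (Ex.a .lab (Ex.v .y)) (Ex.v .b + 1)

variable {n : ℕ} {μ : Mach} {G : Digraph (Fin n)} {sl : Fin n → List (Fin n × ℕ)} {σ : St}

theorem removeY_vc (hR : Room μ n) (hS : Stat G sl σ) {lb : Fin n → ℕ} {S : Finset (Fin n)}
    (hL : Lists lb S σ) (hlb : ∀ y, lb y ≤ n) {y : Fin n} (hy : y ∈ S) (hvy : σ.v .y = y)
    (hly : σ.a .lab y = lb y) :
    removeY.vc μ (fun σ' => Lists lb (S.erase y) σ' ∧ Fr [.bkt, .blen, .pos] [.b, .w] σ σ') σ := by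
  have h1 := hL.pos_lt y hy
  have h2 := (hL.blen_le (hlb y)).trans (S.card_le_univ.trans (by simp : _ ≤ n))
  obtain ⟨w, hw, hwl, hwp⟩ := hL.mem (lb y) (hlb y) (σ.a .blen (lb y) - 1) (by omega)
  have h3 : σ.a .bkt (lb y * n + (σ.a .blen (lb y) - 1)) = w := by
    rw [← hwp, ← hwl]; exact hL.bkt_pos w hw
  have h4 := y.isLt
  have h5 := w.isLt
  have h6 := hR.small (j := y) (by omega)
  have h7 := hR.small (j := w) (by omega)
  have h8 := hR.small (j := lb y) (by have := hlb y; omega)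
  have h9 := hR.idx (hlb y) (j := σ.a .blen (lb y) - 1) (by omega)
  have h10 := hR.idx (hlb y) (j := σ.a .pos y) (by omega)
  have h11 := hS.row (lb y) (hlb y)
  simp [removeY, hvy, hly, h11, h3]
  -- The side conditions are bounds on indices and sums; they follow from `Room`.
  repeat refine ⟨by omega, ?_⟩
  exact hL.remove hlb hy hw hwl hwp (by simp) (by simp) (by simp)

theorem insertY_vc (hR : Room μ n) (hS : Stat G sl σ) {lb : Fin n → ℕ} {S : Finset (Fin n)}
    (hL : Lists lb S σ) (hlb : ∀ y, lb y ≤ n) {y : Fin n} (hy : y ∉ S) (hvy : σ.v .y = y)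
    (hly : σ.a .lab y = lb y) :
    insertY.vc μ (fun σ' => Lists lb (insert y S) σ' ∧ Fr [.bkt, .blen, .pos] [.b] σ σ') σ := by
  have h2 := (hL.blen_le (hlb y)).trans (S.card_le_univ.trans (by simp : _ ≤ n))
  have h4 := y.isLt
  have h6 := hR.small (j := y) (by omega)
  have h8 := hR.small (j := lb y) (by have := hlb y; omega)
  have h9 := hR.idx (hlb y) (j := σ.a .blen (lb y)) (by omega)
  have h11 := hS.row (lb y) (hlb y)
  simp [insertY, hvy, hly, h11]
  repeat refine ⟨by omega, ?_⟩
  exact hL.insert hlb hy (by simp) (by simp) (by simp)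

end WordRAM

namespace WordRAM

open CausalGraph

/-! ### Visiting a vertex -/

/-- The body advances the counter itself, since `J j` fixes the value of `jv`. A round costs the
body, the two sides of the test and the comparison, hence `k + e.cost + 2`. -/
theorem wp_for {μ : Mach} {σ : St} {jv : Var} {e : Ex} {N k : ℕ} {body : Cmd} (J : ℕ → St → Prop)
    (hJ : ∀ j ≤ N, ∀ σ, J j σ → σ.v jv = j ∧ e.Ok μ σ ∧ e.eval μ σ = N)
    (hstep : ∀ j < N, ∀ σ, J j σ → wp μ body k (J (j + 1)) σ) (h : J 0 σ) :
    wp μ (.loop (.lt (Ex.v jv) e) body) (e.cost + 2 + N * (k + e.cost + 2)) (J N) σ := by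
  have hc : (Tst.lt (Ex.v jv) e).cost = e.cost + 1 := by simp [Tst.cost, Ex.cost]; omega
  have := wp_loop (μ := μ) (t := .lt (Ex.v jv) e) (c := body) (Q := J N) (σ := σ)
    (fun m σ => ∃ j ≤ N, J j σ ∧ (N - j) * (k + e.cost + 2) + 1 ≤ m)
    (k := N * (k + e.cost + 2) + 1) ?_ ⟨0, Nat.zero_le _, h, by simp⟩
  · exact wp_mono this (by omega) fun _ => id
  · rintro m σ ⟨j, hjN, hj, hm⟩
    obtain ⟨h1, h2, h3⟩ := hJ j hjN σ hj
    refine ⟨by simpa using h2, ?_, ?_⟩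
    · simp only [Tst.Holds, Ex.eval, h1, h3]
      intro hlt
      refine ⟨k, (N - (j + 1)) * (k + e.cost + 2) + 1, ?_, wp_mono (hstep j hlt σ hj) le_rfl
        fun σ' h' => ⟨j + 1, hlt, h', le_rfl⟩⟩
      have : N - j = N - (j + 1) + 1 := by omega
      rw [this, Nat.add_mul] at hm
      omega
    · simp only [Tst.Holds, Ex.eval, h1, h3]
      intro hn
      obtain rfl : j = N := by omega
      exact ⟨by omega, hj⟩

section
variable {V : Type*} [Fintype V] [DecidableEq V]

open Classical in
/-- The unvisited directed parents of `y`. -/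
noncomputable def openParents (G : Digraph V) (X : Finset V) (y : V) : Finset V :=
  Finset.univ.filter fun u => DirEdge G u y ∧ u ∉ X

/-- The number of unvisited directed parents, plus one for a visited vertex. -/
noncomputable def blk (G : Digraph V) (X : Finset V) (y : V) : ℕ :=
  (openParents G X y).card + if y ∈ X then 1 else 0

variable {G : Digraph V} {X : Finset V} {x y : V}

theorem mem_openParents {u : V} : u ∈ openParents G X y ↔ DirEdge G u y ∧ u ∉ X := by
  simp [openParents]

/-- The extra one for visited vertices turns readiness into a single comparison with zero. -/
theorem blk_eq_zero : blk G X y = 0 ↔ Ready G X y := by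
  unfold blk Ready
  rw [Nat.add_eq_zero_iff, Finset.card_eq_zero, Finset.eq_empty_iff_forall_notMem]
  simp only [mem_openParents]
  constructor
  · rintro ⟨h1, h2⟩
    refine ⟨fun h => by simp [h] at h2, fun u hu => ?_⟩
    by_contra hn
    exact h1 u ⟨hu, hn⟩
  · rintro ⟨h1, h2⟩
    exact ⟨fun u hu => hu.2 (h2 u hu.1), by simp [h1]⟩

open Classical in
theorem lab_insert (hx : x ∉ X) :
    lab G (insert x X) y = lab G X y + if G.Adj x y then 1 else 0 := by
  unfold lab
  rw [Finset.filter_insert]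
  split_ifs
  · rw [Finset.card_insert_of_notMem (by simp [hx])]
  · rfl

theorem openParents_insert : openParents G (insert x X) y = (openParents G X y).erase x := by
  ext u; simp [mem_openParents]; tauto

open Classical in
theorem blk_insert (hx : x ∉ X) (hyx : y ≠ x) :
    blk G X y = blk G (insert x X) y + if DirEdge G x y then 1 else 0 := by
  unfold blk
  rw [openParents_insert]
  simp only [Finset.mem_insert, hyx, false_or]
  by_cases h : DirEdge G x y
  · have := Finset.card_erase_add_one (mem_openParents.2 ⟨h, hx⟩)
    rw [if_pos h]; omega
  · rw [if_neg h, Finset.erase_eq_of_notMem fun h' => h (mem_openParents.1 h').1, add_zero]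

theorem lab_le_card : lab G X y ≤ Fintype.card V := by
  unfold lab
  exact Finset.card_le_univ _

theorem blk_le_card (hG : ∀ v, ¬ G.Adj v v) : blk G X y ≤ Fintype.card V := by
  unfold blk
  have := Finset.card_lt_univ_of_notMem
    (show y ∉ openParents G X y from fun h => hG y (mem_openParents.1 h).1.1)
  split_ifs <;> omega

/-- `f` on `A`, `g` elsewhere. -/
def mix (A : Finset V) (f g : V → ℕ) (y : V) : ℕ := if y ∈ A then f y else g y

/-- While the successors of a vertex are processed, the stored values pass one by one from those of
the old visited set to those of the new one; `mix` describes the stages between. -/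
theorem update_mix (A : Finset V) (f g : V → ℕ) (y : V) :
    Function.update (mix A f g) y (f y) = mix (insert y A) f g := by
  ext z
  by_cases h : z = y
  · subst h; simp [mix]
  · simp [mix, h]

end

variable {n : ℕ} {μ : Mach} {G : Digraph (Fin n)} {sl : Fin n → List (Fin n × ℕ)} {σ : St}

/-- Labels, blocking counts and buckets. -/
structure Dyn (lb bk : Fin n → ℕ) (σ : St) : Prop where
  lab : ∀ y : Fin n, σ.a .lab y = lb y
  blk : ∀ y : Fin n, σ.a .blk y = bk y
  lists : Lists lb (Finset.univ.filter fun y => bk y = 0) σ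

theorem Dyn.fr {lb bk : Fin n → ℕ} {σ' : St} {as vs} (h : Dyn lb bk σ) (hf : Fr as vs σ σ')
    (ha : ∀ id ∈ as, id ∉ [Arr.bkt, .blen, .pos, .lab, .blk]) : Dyn lb bk σ' := by
  have e : ∀ id ∈ [Arr.lab, .blk], σ'.a id = σ.a id := fun id hid =>
    hf.arr id fun h' => ha id h' (by simp at hid ⊢; tauto)
  refine ⟨?_, ?_, h.lists.fr hf (fun id hid h' => ha id hid (by simp at h' ⊢; tauto))
    (fun _ _ => rfl) rfl⟩
  · rw [e _ (by simp)]; exact h.lab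
  · rw [e _ (by simp)]; exact h.blk

/-- Set the label and the blocking count of the vertex in `y`, and update the buckets. -/
def touch (e1 e2 : Ex) : Cmd :=
  .ite (.eq (Ex.a .blk (Ex.v .y)) 0) removeY .skip ;;
  .sto .lab (Ex.v .y) e1 ;;
  .sto .blk (Ex.v .y) e2 ;;
  .ite (.eq (Ex.a .blk (Ex.v .y)) 0) insertY .skip

/-- The vertex leaves its bucket under the old label and enters a bucket only after both values are
stored, so no vertex is listed under a wrong label. The new values are read after the removal, which
is why `h1` and `h2` quantify over all states within the frame. -/
theorem touch_vc (hR : Room μ n) (hS : Stat G sl σ) {lb bk : Fin n → ℕ} (hD : Dyn lb bk σ)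
    (hlb : ∀ y, lb y ≤ n) {y : Fin n} (hvy : σ.v .y = y) {e1 e2 : Ex} {l' b' : ℕ} (hl' : l' ≤ n)
    (h1 : ∀ σ', Fr [.bkt, .blen, .pos] [.b, .w] σ σ' → e1.Ok μ σ' ∧ e1.eval μ σ' = l')
    (h2 : ∀ σ', Fr [.bkt, .blen, .pos, .lab] [.b, .w] σ σ' → e2.Ok μ σ' ∧ e2.eval μ σ' = b') :
    (touch e1 e2).vc μ (fun σ' => Dyn (Function.update lb y l') (Function.update bk y b') σ' ∧
      Fr [.bkt, .blen, .pos, .lab, .blk] [.b, .w] σ σ') σ := by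
  have h6 := hR.small (j := y) (by have := y.isLt; omega)
  -- the bucket operation at the start
  have first : (Cmd.ite (.eq (Ex.a .blk (Ex.v .y)) 0) removeY .skip).vc μ
      (fun σ' => Lists lb ((Finset.univ.filter fun y => bk y = 0).erase y) σ' ∧
        Fr [.bkt, .blen, .pos] [.b, .w] σ σ') σ := by
    refine ⟨by simp; omega, fun ht => ?_, fun ht => ?_⟩
    · simp [hvy, hD.blk] at ht
      exact removeY_vc hR hS hD.lists hlb (by simp [ht]) hvy (hD.lab y)
    · simp [hvy, hD.blk] at ht
      exact ⟨hD.lists.fr (.refl [] [] σ) (by simp) (fun _ _ => rfl)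
        (Finset.erase_eq_of_notMem (by simp [ht])), .refl _ _ _⟩
  change (Cmd.ite (.eq (Ex.a .blk (Ex.v .y)) 0) removeY .skip).vc μ _ σ
  refine Cmd.vc_mono _ first fun σ1 ⟨hL1, hF1⟩ => ?_
  have hv1 : σ1.v .y = y := (hF1.var _ (by simp)).trans hvy
  obtain ⟨ok1, ev1⟩ := h1 σ1 hF1
  simp only [Cmd.vc]
  refine ⟨trivial, ok1, by simp [hv1]; omega, ?_⟩
  rw [ev1, show (Ex.v .y).eval μ σ1 = y from hv1]
  set σ2 := σ1.sto .lab y l' with hσ2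
  have hF2 : Fr [.bkt, .blen, .pos, .lab] [.b, .w] σ σ2 := by
    rw [hσ2, Fr.sto_iff (by simp)]
    exact hF1.mono (by simp) (by simp)
  have hv2 : σ2.v .y = y := hv1
  obtain ⟨ok2, ev2⟩ := h2 σ2 hF2
  refine ⟨trivial, ok2, by simp [hv2]; omega, ?_⟩
  rw [ev2, show (Ex.v .y).eval μ σ2 = y from hv2]
  set σ3 := σ2.sto .blk y b' with hσ3
  have hF3 : Fr [.bkt, .blen, .pos, .lab, .blk] [.b, .w] σ σ3 := by
    rw [hσ3, Fr.sto_iff (by simp)]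
    exact hF2.mono (by simp) (by simp)
  have hv3 : σ3.v .y = y := hv1
  have hlab : ∀ z : Fin n, σ3.a .lab z = Function.update lb y l' z := by
    intro z
    simp only [hσ3, hσ2, St.sto_a, Function.update_apply, Fin.val_inj, reduceCtorEq, if_false,
      if_true, hF1.arr .lab (by simp), hD.lab z]
  have hblk : ∀ z : Fin n, σ3.a .blk z = Function.update bk y b' z := by
    intro z
    simp only [hσ3, hσ2, St.sto_a, Function.update_apply, Fin.val_inj, reduceCtorEq, if_false,
      if_true, hF1.arr .blk (by simp), hD.blk z]
  have hL3 : Lists (Function.update lb y l') ((Finset.univ.filter fun y => bk y = 0).erase y)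
      σ3 := by
    refine hL1.fr (as := [.lab, .blk]) (vs := []) (by simp [hσ3, hσ2]) (by simp)
      (fun z hz => ?_) rfl
    rw [Function.update_of_ne (Finset.ne_of_mem_erase hz)]
  have hlb' : ∀ z, Function.update lb y l' z ≤ n := by
    intro z
    rw [Function.update_apply]
    split_ifs
    · exact hl'
    · exact hlb z
  refine ⟨by simp [hv3]; omega, fun ht => ?_, fun ht => ?_⟩
  · simp [hv3, hblk] at ht
    refine Cmd.vc_mono _ (insertY_vc hR (hS.fr hF3 (by decide) (by decide)) hL3 hlb'
      (y := y) (by simp) hv3 (hlab y)) fun σ4 ⟨hL4, hF4⟩ => ⟨⟨?_, ?_, ?_⟩, ?_⟩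
    · rw [hF4.arr _ (by simp)]; exact hlab
    · rw [hF4.arr _ (by simp)]; exact hblk
    · convert hL4 using 1
      ext z
      by_cases hz : z = y
      · subst hz; simp [ht]
      · simp [hz]
    · exact hF3.trans (hF4.mono (by simp) (by simp))
  · simp [hv3, hblk] at ht
    refine ⟨⟨hlab, hblk, ?_⟩, hF3⟩
    convert hL3 using 1
    ext z
    by_cases hz : z = y
    · subst hz; simp [ht]
    · simp [hz]

end WordRAM

/-! ### Visiting a vertex and undoing the visit -/

namespace WordRAM

open CausalGraph

/-- A bound for the running time of the loop bodies. -/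
def KB : ℕ := 400

/-- Visit the vertex in `x` at level `L`; `i` is kept at least the largest label of a ready
vertex. -/
def visitBody : Cmd :=
  .set .y (Ex.a .tgt (Ex.a .row (Ex.v .x) + Ex.v .j)) ;;
  .set .f (Ex.a .flg (Ex.a .row (Ex.v .x) + Ex.v .j)) ;;
  touch (Ex.a .lab (Ex.v .y) + 1) (Ex.a .blk (Ex.v .y) - Ex.v .f) ;;
  .ite (.eq (Ex.a .blk (Ex.v .y)) 0)
    (.ite (.lt (Ex.v .i) (Ex.a .lab (Ex.v .y))) (.set .i (Ex.a .lab (Ex.v .y))) .skip) .skip ;;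
  .set .j (Ex.v .j + 1)

def visitHead : Cmd :=
  .set .y (Ex.v .x) ;;
  removeY ;;
  .sto .blk (Ex.v .x) 1 ;;
  .sto .time (Ex.v .x) (Ex.v .L) ;;
  .sto .ord (Ex.v .L) (Ex.v .x) ;;
  .set .j 0

def visit : Cmd := visitHead ;; .loop (.lt (Ex.v .j) (Ex.a .deg (Ex.v .x))) visitBody

/-- Undo the visit of the vertex in `x`. -/
def unvisitBody : Cmd :=
  .set .y (Ex.a .tgt (Ex.a .row (Ex.v .x) + Ex.v .j)) ;;
  .set .f (Ex.a .flg (Ex.a .row (Ex.v .x) + Ex.v .j)) ;;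
  touch (Ex.a .lab (Ex.v .y) - 1) (Ex.a .blk (Ex.v .y) + Ex.v .f) ;;
  .set .j (Ex.v .j + 1)

def unvisitTail : Cmd :=
  .sto .blk (Ex.v .x) 0 ;;
  .set .y (Ex.v .x) ;;
  insertY

def unvisit : Cmd :=
  .set .j 0 ;; .loop (.lt (Ex.v .j) (Ex.a .deg (Ex.v .x))) unvisitBody ;; unvisitTail

section
variable {n : ℕ} {G : Digraph (Fin n)} {sl : Fin n → List (Fin n × ℕ)} {X : Finset (Fin n)}
  {x y : Fin n}

/-- The first `j` vertices of a list of successors. -/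
def firsts (l : List (Fin n × ℕ)) (j : ℕ) : Finset (Fin n) := ((l.take j).map Prod.fst).toFinset

theorem firsts_zero (l : List (Fin n × ℕ)) : firsts l 0 = ∅ := by simp [firsts]

theorem firsts_succ {l : List (Fin n × ℕ)} {j : ℕ} (hj : j < l.length) :
    firsts l (j + 1) = insert l[j].1 (firsts l j) := by
  unfold firsts
  rw [List.take_succ_eq_append_getElem hj, List.map_append]
  ext z
  simp only [List.mem_toFinset, List.mem_append, Finset.mem_insert, List.map_cons, List.map_nil,
    List.mem_singleton]
  tauto

theorem SuccList.notMem_firsts (hl : SuccList G sl) {j : ℕ} (hj : j < (sl x).length) :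
    (sl x)[j].1 ∉ firsts (sl x) j := by
  intro h
  unfold firsts at h
  rw [List.mem_toFinset, List.map_take, List.mem_take_iff_getElem] at h
  obtain ⟨i, hi, he⟩ := h
  simp at hi
  have := (hl.nodup x).getElem_inj_iff (i := i) (j := j) (hi := by simp; omega)
    (hj := by simpa using hj)
  simp at this he
  have := this.1 he
  omega

theorem SuccList.adj_iff (hl : SuccList G sl) : G.Adj x y ↔ ∃ f, (y, f) ∈ sl x := by
  simp only [hl.mem]
  rw [CausalGraph.adj_iff]
  constructor
  · rintro (h | h)
    · exact ⟨0, Or.inr ⟨h, rfl⟩⟩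
    · exact ⟨1, Or.inl ⟨h, rfl⟩⟩
  · rintro ⟨f, h | h⟩
    · exact Or.inr h.1
    · exact Or.inl h.1

theorem SuccList.mem_firsts_length (hl : SuccList G sl) :
    y ∈ firsts (sl x) (sl x).length ↔ G.Adj x y := by
  rw [hl.adj_iff]
  simp [firsts]

theorem SuccList.length_le (hl : SuccList G sl) : (sl x).length ≤ n := by
  have := (hl.nodup x).length_le_card
  simpa using this

theorem SuccList.entry (hl : SuccList G sl) (hx : x ∉ X) (hG : ∀ v, ¬ G.Adj v v) {f : ℕ}
    (h : (y, f) ∈ sl x) : y ≠ x ∧ lab G (insert x X) y = lab G X y + 1 ∧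
      blk G X y = blk G (insert x X) y + f ∧ f ≤ 1 := by
  have hxy : G.Adj x y := hl.adj_iff.2 ⟨f, h⟩
  have hne : y ≠ x := by rintro rfl; exact hG _ hxy
  refine ⟨hne, by rw [lab_insert hx, if_pos hxy], ?_⟩
  rw [blk_insert hx hne]
  rcases (hl.mem x y f).1 h with ⟨h1, rfl⟩ | ⟨h1, rfl⟩
  · rw [if_pos h1]; simp
  · rw [if_neg fun h' => h'.2 h1.2]; simp

theorem insert_of_not_adj (hx : x ∉ X) (hyx : y ≠ x) (h : ¬ G.Adj x y) :
    lab G (insert x X) y = lab G X y ∧ blk G (insert x X) y = blk G X y := by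
  refine ⟨by rw [lab_insert hx, if_neg h, add_zero], ?_⟩
  rw [blk_insert hx hyx, if_neg fun h' => h h'.1, add_zero]

/-- A ready vertex has no unvisited parent, so after the visit its count consists of the mark for
being visited alone. -/
theorem insert_self_values (hG : ∀ v, ¬ G.Adj v v) (hx : Ready G X x) :
    lab G (insert x X) x = lab G X x ∧ blk G (insert x X) x = 1 := by
  refine ⟨by rw [lab_insert hx.1, if_neg (hG x), add_zero], ?_⟩
  unfold blk
  have : openParents G (insert x X) x = ∅ := by
    ext u
    simp only [mem_openParents, Finset.mem_insert, Finset.notMem_empty, iff_false, not_and, not_not]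
    exact fun h => Or.inr (hx.2 u h)
  simp [this]

end

variable {n : ℕ} {μ : Mach} {G : Digraph (Fin n)} {sl : Fin n → List (Fin n × ℕ)} {σ : St}
  {X : Finset (Fin n)}

theorem lab_le_size {y : Fin n} : lab G X y ≤ n := by
  simpa using lab_le_card (G := G) (X := X) (y := y)

theorem blk_le_size (hG : ∀ v, ¬ G.Adj v v) {y : Fin n} : blk G X y ≤ n := by
  simpa using blk_le_card (X := X) (y := y) hG

theorem mix_le {A : Finset (Fin n)} {f g : Fin n → ℕ} {m : ℕ} (hf : ∀ y, f y ≤ m)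
    (hg : ∀ y, g y ≤ m) (y : Fin n) : mix A f g y ≤ m := by
  unfold mix; split_ifs
  · exact hf y
  · exact hg y

/-- The last conjunct is needed for the amortised bound: `i` only moves to the label of a vertex
that is ready after the visit. -/
theorem visitBody_vc (hR : Room μ n) (hG : ∀ v, ¬ G.Adj v v) (hl : SuccList G sl)
    (hS : Stat G sl σ) {x : Fin n} (hx : x ∉ X) {j : ℕ} (hj : j < (sl x).length)
    (hvx : σ.v .x = x) (hvj : σ.v .j = j)
    (hD : Dyn (mix (insert x (firsts (sl x) j)) (lab G (insert x X)) (lab G X))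
      (mix (insert x (firsts (sl x) j)) (blk G (insert x X)) (blk G X)) σ)
    (hi : ∀ y, mix (insert x (firsts (sl x) j)) (blk G (insert x X)) (blk G X) y = 0 →
      mix (insert x (firsts (sl x) j)) (lab G (insert x X)) (lab G X) y ≤ σ.v .i) :
    visitBody.vc μ (fun σ' =>
      Dyn (mix (insert x (firsts (sl x) (j + 1))) (lab G (insert x X)) (lab G X))
        (mix (insert x (firsts (sl x) (j + 1))) (blk G (insert x X)) (blk G X)) σ' ∧
      Fr [.bkt, .blen, .pos, .lab, .blk] [.b, .w, .y, .f, .j, .i] σ σ' ∧ σ'.v .j = j + 1 ∧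
      (∀ y, mix (insert x (firsts (sl x) (j + 1))) (blk G (insert x X)) (blk G X) y = 0 →
        mix (insert x (firsts (sl x) (j + 1))) (lab G (insert x X)) (lab G X) y ≤ σ'.v .i) ∧
      (σ'.v .i = σ.v .i ∨ ∃ y, blk G (insert x X) y = 0 ∧ lab G (insert x X) y = σ'.v .i ∧
        y ∈ insert x (firsts (sl x) (j + 1)))) σ := by
  obtain ⟨y, f, hp⟩ : ∃ y f, (sl x)[j] = (y, f) := ⟨_, _, rfl⟩
  have hmem : (y, f) ∈ sl x := hp ▸ List.getElem_mem hj
  have hlen := hl.length_le (x := x)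
  obtain ⟨hyx, hly, hby, hf1⟩ := hl.entry hx hG hmem
  have hyA : y ∉ insert x (firsts (sl x) j) := by
    have := hl.notMem_firsts hj
    rw [hp] at this
    simpa [hyx] using this
  have hA : insert x (firsts (sl x) (j + 1)) = insert y (insert x (firsts (sl x) j)) := by
    rw [firsts_succ hj, hp, Finset.insert_comm]
  rw [hA]
  set A := insert x (firsts (sl x) j) with hAdef
  set lb := mix A (lab G (insert x X)) (lab G X) with hlb
  set bk := mix A (blk G (insert x X)) (blk G X) with hbk
  have hlby : lb y = lab G X y := by simp [hlb, mix, hyA]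
  have hbky : bk y = blk G X y := by simp [hbk, mix, hyA]
  have hrow := hS.row x x.isLt.le
  have htgt := hS.tgt x j hj
  have hflg := hS.flg x j hj
  rw [hp] at htgt hflg
  have b1 := hR.idx x.isLt.le (j := j) (by omega)
  have b2 := hR.small (j := x) (by have := x.isLt; omega)
  have b3 := hR.small (j := y) (by have := y.isLt; omega)
  have b4 := hR.small (j := lab G (insert x X) y) (by have := lab_le_size (G := G) (X := insert x X) (y := y); omega)
  have b5 := hR.small (j := j) (by omega)
  simp [visitBody, hvx, hvj, hrow, htgt, hflg]
  repeat refine ⟨by omega, ?_⟩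
  set σ2 := (σ.set .y y).set .f f with hσ2
  have hF2 : Fr [] [.y, .f] σ σ2 := by simp [hσ2]
  refine Cmd.vc_mono _ (touch_vc hR (hS.fr hF2 (by decide) (by decide))
    (hD.fr hF2 (by decide)) (mix_le (fun _ => lab_le_size) (fun _ => lab_le_size))
    (y := y) (l' := lab G (insert x X) y) (b' := blk G (insert x X) y) (by simp [hσ2])
    lab_le_size ?_ ?_) ?_
  · intro σ' hF
    have e1 : σ'.v .y = y := by rw [hF.var _ (by simp)]; simp [hσ2]
    have e2 : σ'.a .lab y = lab G X y := by
      rw [hF.arr _ (by simp)]; simp [hσ2, hD.lab, hlby]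
    simp [e1, e2, hly]; omega
  · intro σ' hF
    have e1 : σ'.v .y = y := by rw [hF.var _ (by simp)]; simp [hσ2]
    have e3 : σ'.v .f = f := by rw [hF.var _ (by simp)]; simp [hσ2]
    have e2 : σ'.a .blk y = blk G X y := by
      rw [hF.arr _ (by simp)]; simp [hσ2, hD.blk, hbky]
    simp [e1, e2, e3, hby]; omega
  · rintro σ3 ⟨hD3, hF3⟩
    rw [hlb, hbk, update_mix, update_mix] at hD3
    have hF : Fr [.bkt, .blen, .pos, .lab, .blk] [.b, .w, .y, .f, .j, .i] σ σ3 :=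
      (hF2.mono (by simp) (by simp)).trans (hF3.mono (by simp) (by simp))
    have hy3 : σ3.v .y = y := by rw [hF3.var _ (by simp)]; simp [hσ2]
    have hj3 : σ3.v .j = j := by rw [hF3.var _ (by simp)]; simp [hσ2, hvj]
    have hi3 : σ3.v .i = σ.v .i := by rw [hF3.var _ (by simp)]; simp [hσ2]
    have hly3 : σ3.a .lab y = lab G (insert x X) y := by simp [hD3.lab, mix]
    have hby3 : σ3.a .blk y = blk G (insert x X) y := by simp [hD3.blk, mix]
    have hother : ∀ z, z ≠ y → mix (insert y A) (blk G (insert x X)) (blk G X) z = 0 →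
        mix (insert y A) (lab G (insert x X)) (lab G X) z ≤ σ.v .i := by
      intro z hz h
      have := hi z
      simp only [hbk, hlb, mix, Finset.mem_insert, hz, false_or] at this h ⊢
      exact this h
    have hDfr : ∀ k, Dyn (mix (insert y A) (lab G (insert x X)) (lab G X))
        (mix (insert y A) (blk G (insert x X)) (blk G X)) (σ3.set .j k) := fun k =>
      hD3.fr (as := []) (vs := [.j]) (by simp) (by simp)
    have hDfr' : ∀ m k, Dyn (mix (insert y A) (lab G (insert x X)) (lab G X))
        (mix (insert y A) (blk G (insert x X)) (blk G X)) ((σ3.set .i m).set .j k) := fun m k =>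
      hD3.fr (as := []) (vs := [.j, .i]) (by simp) (by simp)
    have hymix : mix (insert y A) (lab G (insert x X)) (lab G X) y = lab G (insert x X) y := by
      simp [mix]
    simp [hy3, hj3, hly3, hby3, hi3, hF, hDfr, hDfr']
    refine ⟨by omega, fun h0 => ⟨by omega, fun hlt => ⟨by omega, by omega, ?_, ?_⟩,
      fun hge => ⟨by omega, ?_⟩⟩, fun h0 => ⟨by omega, ?_⟩⟩
    · intro z hz
      by_cases hzy : z = y
      · subst hzy; rw [hymix]
      · exact (hother z hzy hz).trans hlt.le
    · exact Or.inr ⟨y, h0, rfl, by simp⟩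
    · intro z hz
      by_cases hzy : z = y
      · subst hzy; rw [hymix]; exact hge
      · exact hother z hzy hz
    · intro z hz
      by_cases hzy : z = y
      · subst hzy; simp [mix] at hz; exact absurd hz h0
      · exact hother z hzy hz

end WordRAM

namespace WordRAM

open CausalGraph

variable {n : ℕ} {μ : Mach} {G : Digraph (Fin n)} {sl : Fin n → List (Fin n × ℕ)} {σ : St}
  {X : Finset (Fin n)}

theorem Fr.sub {as as' : List Arr} {vs vs' : List Var} {σ σ' σ'' : St} (h : Fr as vs σ σ')
    (h' : Fr as' vs' σ' σ'') (ha : ∀ id ∈ as', id ∈ as) (hv : ∀ x ∈ vs', x ∈ vs) :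
    Fr as vs σ σ'' := h.trans (h'.mono ha hv)

theorem Dyn.congr {lb bk lb' bk' : Fin n → ℕ} (h : Dyn lb bk σ) (h1 : ∀ y, lb y = lb' y)
    (h2 : ∀ y, bk y = bk' y) : Dyn lb' bk' σ := by
  obtain rfl : lb = lb' := funext h1
  obtain rfl : bk = bk' := funext h2
  exact h

theorem visitHead_vc (hR : Room μ n) (hG : ∀ v, ¬ G.Adj v v) (hS : Stat G sl σ) {x : Fin n}
    (hx : Ready G X x) (hvx : σ.v .x = x) {L : ℕ} (hL : σ.v .L = L) (hLn : L < n)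
    (hD : Dyn (lab G X) (blk G X) σ) :
    visitHead.vc μ (fun σ' =>
      Dyn (mix {x} (lab G (insert x X)) (lab G X)) (mix {x} (blk G (insert x X)) (blk G X)) σ' ∧
      Fr [.bkt, .blen, .pos, .lab, .blk, .time, .ord] [.b, .w, .y, .j] σ σ' ∧ σ'.v .j = 0 ∧
      σ'.a .time = Function.update (σ.a .time) x L ∧
      σ'.a .ord = Function.update (σ.a .ord) L x) σ := by
  obtain ⟨hl1, hb1⟩ := insert_self_values hG hx
  have b1 := hR.small (j := x) (by have := x.isLt; omega)
  have b2 := hR.small (j := L) (by omega)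
  have h0 := blk_eq_zero.2 hx
  have hF1 : Fr [] [.y] σ (σ.set .y x) := by simp
  have hD1 := hD.fr hF1 (by decide)
  change (Ex.v .x).Ok μ σ ∧ removeY.vc μ _ (σ.set .y _)
  rw [show (Ex.v .x).eval μ σ = x from hvx]
  refine ⟨trivial, ?_⟩
  refine Cmd.vc_mono _ (removeY_vc hR (hS.fr hF1 (by decide) (by decide)) hD1.lists
    (fun _ => lab_le_size) (y := x) (by simp [h0]) (by simp) (hD1.lab x)) fun σ2 ⟨hL2, hF2⟩ => ?_
  have hx2 : σ2.v .x = x := by rw [hF2.var _ (by simp)]; simp [hvx]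
  have hL2' : σ2.v .L = L := by rw [hF2.var _ (by simp)]; simp [hL]
  have hF : Fr [.bkt, .blen, .pos, .lab, .blk, .time, .ord] [.b, .w, .y, .j] σ σ2 :=
    (hF1.mono (by simp) (by simp)).sub hF2 (by simp) (by simp)
  have et : σ2.a .time = σ.a .time := by rw [hF2.arr _ (by simp)]; simp
  have eo : σ2.a .ord = σ.a .ord := by rw [hF2.arr _ (by simp)]; simp
  simp [hx2, hL2', hF, et, eo]
  repeat refine ⟨by omega, ?_⟩
  refine ⟨fun y => ?_, fun y => ?_, ?_⟩
  · simp only [St.set_a, St.sto_a, reduceCtorEq, if_false, hF2.arr .lab (by simp), hD.lab]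
    unfold mix
    split_ifs with h
    · rw [Finset.mem_singleton] at h; rw [h, hl1]
    · rfl
  · simp only [St.set_a, St.sto_a, reduceCtorEq, if_false, if_true, hF2.arr .blk (by simp),
      Function.update_apply, Fin.val_inj, hD.blk, mix, Finset.mem_singleton]
    by_cases h : y = x
    · subst h; simp [hb1]
    · simp [h]
  · refine hL2.fr (as := [.blk, .time, .ord]) (vs := [.j]) (by simp) (by simp) (fun z hz => ?_) ?_
    · simp [mix, Finset.ne_of_mem_erase hz]
    · ext z
      by_cases h : z = x
      · subst h; simp [mix, hb1]
      · simp [mix, h]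

/-- The contents of the data structures after visiting the vertices of `X`. -/
abbrev DynX (G : Digraph (Fin n)) (X : Finset (Fin n)) (σ : St) : Prop := Dyn (lab G X) (blk G X) σ

/-- One round per edge leaving `x`; vertices that are not successors keep their values. That the new
`i` is the old one or an attained label is what `lab_le_freeIn` turns into a bound on its growth. -/
theorem visit_wp (hR : Room μ n) (hG : ∀ v, ¬ G.Adj v v) (hl : SuccList G sl)
    (hS : Stat G sl σ) {x : Fin n} (hx : Ready G X x) (hvx : σ.v .x = x) {L : ℕ}
    (hL : σ.v .L = L) (hLn : L < n) (hD : DynX G X σ)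
    (hi : ∀ y, Ready G X y → lab G X y ≤ σ.v .i) :
    wp μ visit (KB * ((sl x).length + 1)) (fun σ' => DynX G (insert x X) σ' ∧
      Fr [.bkt, .blen, .pos, .lab, .blk, .time, .ord] [.b, .w, .y, .f, .j, .i] σ σ' ∧
      σ'.a .time = Function.update (σ.a .time) x L ∧
      σ'.a .ord = Function.update (σ.a .ord) L x ∧
      (∀ y, Ready G (insert x X) y → lab G (insert x X) y ≤ σ'.v .i) ∧
      (σ'.v .i = σ.v .i ∨
        ∃ y, Ready G (insert x X) y ∧ lab G (insert x X) y = σ'.v .i)) σ := by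
  set J : ℕ → St → Prop := fun j σ' =>
    Dyn (mix (insert x (firsts (sl x) j)) (lab G (insert x X)) (lab G X))
      (mix (insert x (firsts (sl x) j)) (blk G (insert x X)) (blk G X)) σ' ∧
    Fr [.bkt, .blen, .pos, .lab, .blk, .time, .ord] [.b, .w, .y, .f, .j, .i] σ σ' ∧
    σ'.v .j = j ∧ σ'.a .time = Function.update (σ.a .time) x L ∧
    σ'.a .ord = Function.update (σ.a .ord) L x ∧
    (∀ y, mix (insert x (firsts (sl x) j)) (blk G (insert x X)) (blk G X) y = 0 →
      mix (insert x (firsts (sl x) j)) (lab G (insert x X)) (lab G X) y ≤ σ'.v .i) ∧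
    (σ'.v .i = σ.v .i ∨ ∃ y, blk G (insert x X) y = 0 ∧ lab G (insert x X) y = σ'.v .i ∧
        y ∈ insert x (firsts (sl x) j)) with hJ
  obtain ⟨hl1, hb1⟩ := insert_self_values hG hx
  have hhead : visitHead.vc μ (J 0) σ := by
    refine Cmd.vc_mono _ (visitHead_vc hR hG hS hx hvx hL hLn hD) ?_
    rintro σ' ⟨h1, h2, h3, h4, h5⟩
    have hi' : σ'.v .i = σ.v .i := h2.var _ (by simp)
    refine ⟨by simpa [firsts_zero] using h1, h2.mono (by simp) (by simp), h3, h4, h5, ?_,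
      Or.inl hi'⟩
    intro y hy
    simp only [firsts_zero, mix, insert_empty_eq, Finset.mem_singleton] at hy ⊢
    by_cases h : y = x
    · subst h; simp [hb1] at hy
    · rw [if_neg h] at hy ⊢
      rw [hi']; exact hi y (blk_eq_zero.1 hy)
  have hloop : ∀ σ', J 0 σ' → wp μ (.loop (.lt (Ex.v .j) (Ex.a .deg (Ex.v .x))) visitBody)
      (10 + 2 + (sl x).length * (visitBody.cost + 10 + 2)) (J (sl x).length) σ' := by
    intro σ' h0
    refine wp_for (e := Ex.a .deg (Ex.v .x)) J ?_ ?_ h0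
    · rintro j hj σ' ⟨-, hF, hjv, -⟩
      have e1 : σ'.v .x = x := by rw [hF.var _ (by simp), hvx]
      have e2 : σ'.a .deg x = (sl x).length := by rw [hF.arr _ (by simp), hS.deg]
      have b1 := hR.small (j := x) (by have := x.isLt; omega)
      simp [hjv, e1, e2]; omega
    · rintro j hj σ' ⟨h1, h2, h3, h4, h5, h6, h7⟩
      have hS' : Stat G sl σ' := hS.fr h2 (by decide) (by decide)
      refine wp_of_vc _ (Cmd.vc_mono _ (visitBody_vc hR hG hl hS' hx.1 hj
        (by rw [h2.var _ (by simp), hvx]) h3 h1 h6) ?_)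
      rintro σ3 ⟨g1, g2, g3, g4, g5⟩
      refine ⟨g1, h2.sub g2 (by simp) (by simp), g3, by rw [g2.arr _ (by simp), h4],
        by rw [g2.arr _ (by simp), h5], g4, ?_⟩
      rcases g5 with g5 | g5
      · rw [g5]
        refine h7.imp id ?_
        rintro ⟨z, z1, z2, z3⟩
        refine ⟨z, z1, z2, ?_⟩
        rw [firsts_succ hj]
        simp only [Finset.mem_insert] at z3 ⊢
        tauto
      · exact Or.inr g5
  refine wp_mono (wp_seq (wp_mono (wp_of_vc _ hhead) le_rfl hloop)) ?_ ?_
  · have e1 : visitHead.cost ≤ 300 := by decide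
    have e2 : visitBody.cost + 10 + 2 ≤ 400 := by decide
    have e3 := Nat.mul_le_mul_left (sl x).length e2
    unfold KB
    nlinarith
  · rintro σ' ⟨h1, h2, h3, h4, h5, h6, h7⟩
    have hmx : ∀ y, mix (insert x (firsts (sl x) (sl x).length)) (lab G (insert x X)) (lab G X) y =
        lab G (insert x X) y ∧
        mix (insert x (firsts (sl x) (sl x).length)) (blk G (insert x X)) (blk G X) y =
        blk G (insert x X) y := by
      intro y
      unfold mix
      split_ifs with h
      · exact ⟨rfl, rfl⟩
      · rw [Finset.mem_insert, hl.mem_firsts_length, not_or] at h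
        obtain ⟨e1, e2⟩ := insert_of_not_adj hx.1 h.1 h.2
        exact ⟨e1.symm, e2.symm⟩
    refine ⟨h1.congr (fun y => (hmx y).1) (fun y => (hmx y).2), h2, h4, h5, ?_, ?_⟩
    · intro y hy
      have := h6 y (by rw [(hmx y).2]; exact blk_eq_zero.2 hy)
      rwa [(hmx y).1] at this
    · refine h7.imp id ?_
      rintro ⟨y, h8, h9, -⟩
      exact ⟨y, blk_eq_zero.1 h8, h9⟩

theorem unvisitBody_vc (hR : Room μ n) (hG : ∀ v, ¬ G.Adj v v) (hl : SuccList G sl)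
    (hS : Stat G sl σ) {x : Fin n} (hx : x ∉ X) {j : ℕ} (hj : j < (sl x).length)
    (hvx : σ.v .x = x) (hvj : σ.v .j = j)
    (hD : Dyn (mix (firsts (sl x) j) (lab G X) (lab G (insert x X)))
      (mix (firsts (sl x) j) (blk G X) (blk G (insert x X))) σ) :
    unvisitBody.vc μ (fun σ' =>
      Dyn (mix (firsts (sl x) (j + 1)) (lab G X) (lab G (insert x X)))
        (mix (firsts (sl x) (j + 1)) (blk G X) (blk G (insert x X))) σ' ∧
      Fr [.bkt, .blen, .pos, .lab, .blk] [.b, .w, .y, .f, .j] σ σ' ∧ σ'.v .j = j + 1) σ := by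
  obtain ⟨y, f, hp⟩ : ∃ y f, (sl x)[j] = (y, f) := ⟨_, _, rfl⟩
  have hmem : (y, f) ∈ sl x := hp ▸ List.getElem_mem hj
  have hlen := hl.length_le (x := x)
  obtain ⟨hyx, hly, hby, hf1⟩ := hl.entry hx hG hmem
  have hyA : y ∉ firsts (sl x) j := by
    have := hl.notMem_firsts hj
    rwa [hp] at this
  have hA : firsts (sl x) (j + 1) = insert y (firsts (sl x) j) := by
    rw [firsts_succ hj, hp]
  rw [hA]
  set A := firsts (sl x) j with hAdef
  set lb := mix A (lab G X) (lab G (insert x X)) with hlb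
  set bk := mix A (blk G X) (blk G (insert x X)) with hbk
  have hlby : lb y = lab G (insert x X) y := by simp [hlb, mix, hyA]
  have hbky : bk y = blk G (insert x X) y := by simp [hbk, mix, hyA]
  have hrow := hS.row x x.isLt.le
  have htgt := hS.tgt x j hj
  have hflg := hS.flg x j hj
  rw [hp] at htgt hflg
  have b1 := hR.idx x.isLt.le (j := j) (by omega)
  have b2 := hR.small (j := x) (by have := x.isLt; omega)
  have b3 := hR.small (j := y) (by have := y.isLt; omega)
  have b4 := hR.small (j := blk G X y) (by have := blk_le_size hG (X := X) (y := y); omega)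
  have b5 := hR.small (j := j) (by omega)
  simp [unvisitBody, hvx, hvj, hrow, htgt, hflg]
  repeat refine ⟨by omega, ?_⟩
  set σ2 := (σ.set .y y).set .f f with hσ2
  have hF2 : Fr [] [.y, .f] σ σ2 := by simp [hσ2]
  refine Cmd.vc_mono _ (touch_vc hR (hS.fr hF2 (by decide) (by decide))
    (hD.fr hF2 (by decide)) (mix_le (fun _ => lab_le_size) (fun _ => lab_le_size))
    (y := y) (l' := lab G X y) (b' := blk G X y) (by simp [hσ2])
    lab_le_size ?_ ?_) ?_
  · intro σ' hF
    have e1 : σ'.v .y = y := by rw [hF.var _ (by simp)]; simp [hσ2]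
    have e2 : σ'.a .lab y = lab G (insert x X) y := by
      rw [hF.arr _ (by simp)]; simp [hσ2, hD.lab, hlby]
    simp [e1, e2, hly]; omega
  · intro σ' hF
    have e1 : σ'.v .y = y := by rw [hF.var _ (by simp)]; simp [hσ2]
    have e3 : σ'.v .f = f := by rw [hF.var _ (by simp)]; simp [hσ2]
    have e2 : σ'.a .blk y = blk G (insert x X) y := by
      rw [hF.arr _ (by simp)]; simp [hσ2, hD.blk, hbky]
    simp [e1, e2, e3, hby]; omega
  · rintro σ3 ⟨hD3, hF3⟩
    rw [hlb, hbk, update_mix, update_mix] at hD3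
    have hF : Fr [.bkt, .blen, .pos, .lab, .blk] [.b, .w, .y, .f, .j] σ σ3 :=
      (hF2.mono (by simp) (by simp)).trans (hF3.mono (by simp) (by simp))
    have hj3 : σ3.v .j = j := by rw [hF3.var _ (by simp)]; simp [hσ2, hvj]
    simp [hj3, hF]
    exact ⟨by omega, hD3.fr (as := []) (vs := [.j]) (by simp) (by simp)⟩

/-- Labels and counts are restored exactly, the buckets only as sets; the order inside a bucket may
differ, which `Dyn` does not record. -/
theorem unvisit_wp (hR : Room μ n) (hG : ∀ v, ¬ G.Adj v v) (hl : SuccList G sl)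
    (hS : Stat G sl σ) {x : Fin n} (hx : Ready G X x) (hvx : σ.v .x = x)
    (hD : DynX G (insert x X) σ) :
    wp μ unvisit (KB * ((sl x).length + 1)) (fun σ' => DynX G X σ' ∧
      Fr [.bkt, .blen, .pos, .lab, .blk] [.b, .w, .y, .f, .j] σ σ') σ := by
  set J : ℕ → St → Prop := fun j σ' =>
    Dyn (mix (firsts (sl x) j) (lab G X) (lab G (insert x X)))
      (mix (firsts (sl x) j) (blk G X) (blk G (insert x X))) σ' ∧
    Fr [.bkt, .blen, .pos, .lab, .blk] [.b, .w, .y, .f, .j] σ σ' ∧ σ'.v .j = j with hJ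
  obtain ⟨hl1, hb1⟩ := insert_self_values hG hx
  have b1 := hR.small (j := x) (by have := x.isLt; omega)
  have hhead : wp μ (.set .j 0) 2 (J 0) σ := by
    refine wp_of_vc (.set .j 0) ?_
    simp [hJ]
    refine ⟨by omega, ?_⟩
    exact (hD.fr (as := []) (vs := [.j]) (σ' := σ.set .j 0) (by simp) (by simp)).congr
      (by simp [firsts_zero, mix]) (by simp [firsts_zero, mix])
  have hloop : ∀ σ', J 0 σ' → wp μ (.loop (.lt (Ex.v .j) (Ex.a .deg (Ex.v .x))) unvisitBody)
      (10 + 2 + (sl x).length * (unvisitBody.cost + 10 + 2)) (J (sl x).length) σ' := by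
    intro σ' h0
    refine wp_for (e := Ex.a .deg (Ex.v .x)) J ?_ ?_ h0
    · rintro j hj σ' ⟨-, hF, hjv⟩
      have e1 : σ'.v .x = x := by rw [hF.var _ (by simp), hvx]
      have e2 : σ'.a .deg x = (sl x).length := by rw [hF.arr _ (by simp), hS.deg]
      simp [hjv, e1, e2]; omega
    · rintro j hj σ' ⟨h1, h2, h3⟩
      have hS' : Stat G sl σ' := hS.fr h2 (by decide) (by decide)
      refine wp_of_vc _ (Cmd.vc_mono _ (unvisitBody_vc hR hG hl hS' hx.1 hj
        (by rw [h2.var _ (by simp), hvx]) h3 h1) ?_)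
      rintro σ3 ⟨g1, g2, g3⟩
      exact ⟨g1, h2.sub g2 (by simp) (by simp), g3⟩
  have htail : ∀ σ', J (sl x).length σ' → wp μ unvisitTail unvisitTail.cost (fun σ' => DynX G X σ' ∧
      Fr [.bkt, .blen, .pos, .lab, .blk] [.b, .w, .y, .f, .j] σ σ') σ' := by
    rintro σ1 ⟨hD1, hF1, -⟩
    have hx1 : σ1.v .x = x := by rw [hF1.var _ (by simp), hvx]
    apply wp_of_vc
    have hblk0 := blk_eq_zero.2 hx
    have hmxl : ∀ y, mix (firsts (sl x) (sl x).length) (lab G X) (lab G (insert x X)) y =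
        lab G X y := by
      intro y
      unfold mix
      split_ifs with h
      · rfl
      · by_cases hyx : y = x
        · rw [hyx, hl1]
        · rw [hl.mem_firsts_length] at h
          exact (insert_of_not_adj hx.1 hyx h).1
    have hxn : x ∉ firsts (sl x) (sl x).length := fun h => hG x (hl.mem_firsts_length.1 h)
    have hmxb : ∀ y, mix (firsts (sl x) (sl x).length) (blk G X) (blk G (insert x X)) y =
        if y = x then 1 else blk G X y := by
      intro y
      by_cases hyx : y = x
      · subst hyx; simp [mix, hxn, hb1]
      · unfold mix
        rw [if_neg hyx]
        split_ifs with h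
        · rfl
        · rw [hl.mem_firsts_length] at h
          exact (insert_of_not_adj hx.1 hyx h).2
    have hD1' := hD1.congr hmxl hmxb
    simp [unvisitTail, hx1]
    repeat refine ⟨by omega, ?_⟩
    set σ2 := (σ1.sto .blk x 0).set .y x with hσ2
    have hF2 : Fr [.blk] [.y] σ1 σ2 := by simp [hσ2]
    have hlab2 : ∀ z : Fin n, σ2.a .lab z = lab G X z := by simp [hσ2, hD1'.lab]
    refine Cmd.vc_mono _ (insertY_vc hR (hS.fr (hF1.sub hF2 (by simp) (by simp)) (by decide)
      (by decide)) (hD1'.lists.fr hF2 (by simp) (fun _ _ => rfl) rfl)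
      (fun _ => lab_le_size) (y := x) (by simp) (by simp [hσ2]) (hlab2 x)) ?_
    rintro σ3 ⟨hL3, hF3⟩
    refine ⟨⟨?_, ?_, ?_⟩, (hF1.sub hF2 (by simp) (by simp)).sub hF3 (by simp) (by simp)⟩
    · rw [hF3.arr _ (by simp)]; exact hlab2
    · rw [hF3.arr _ (by simp)]
      intro z
      simp only [hσ2, St.set_a, St.sto_a, if_true, Function.update_apply, Fin.val_inj, hD1'.blk]
      by_cases h : z = x
      · subst h; simp [hblk0]
      · simp [h]
    · convert hL3 using 1
      ext z
      by_cases h : z = x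
      · subst h; simp [hblk0]
      · simp [h]
  refine wp_mono (wp_seq (wp_mono hhead le_rfl fun σ1 h1 =>
    wp_seq (wp_mono (hloop σ1 h1) le_rfl htail))) ?_ (fun _ => id)
  have e1 : unvisitTail.cost ≤ 300 := by decide
  have e2 : unvisitBody.cost + 10 + 2 ≤ 400 := by decide
  have e3 := Nat.mul_le_mul_left (sl x).length e2
  unfold KB
  nlinarith

end WordRAM

namespace WordRAM

open CausalGraph

/-! ### Collecting the candidates of a level -/

/-- Append the vertex in `y` to the list of candidates if it is a new one. -/
def addCand : Cmd :=
  .ite (.eq (Ex.a .mark (Ex.v .y)) 0)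
    (.ite (.eq (Ex.a .blk (Ex.v .y)) 0)
      (.ite (.eq (Ex.a .lab (Ex.v .y)) (Ex.a .lab (Ex.v .x)))
        (.sto .mark (Ex.v .y) 1 ;;
          .sto .rlist (Ex.v .p + Ex.v .len) (Ex.v .y) ;;
          .set .len (Ex.v .len + 1)) .skip) .skip) .skip

def candInner : Cmd :=
  .set .y (Ex.a .tgt (Ex.a .row (Ex.v .w) + Ex.v .j)) ;; addCand ;; .set .j (Ex.v .j + 1)

def candOuterHead : Cmd := .set .w (Ex.a .rlist (Ex.v .p + Ex.v .h)) ;; .set .j 0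

def candOuter : Cmd :=
  candOuterHead ;; .loop (.lt (Ex.v .j) (Ex.a .deg (Ex.v .w))) candInner ;;
    .set .h (Ex.v .h + 1)

def candHead : Cmd :=
  .set .p (Ex.a .row (Ex.v .L)) ;; .sto .rlist (Ex.v .p) (Ex.v .x) ;; .sto .mark (Ex.v .x) 1 ;;
  .set .len 1 ;; .set .h 0

def candMid : Cmd :=
  .sto .rlen (Ex.v .L) (Ex.v .len) ;; .sto .rptr (Ex.v .L) 1 ;; .set .h 0

def unmarkBody : Cmd := .sto .mark (Ex.a .rlist (Ex.v .p + Ex.v .h)) 0 ;; .set .h (Ex.v .h + 1)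

/-- List the candidates of level `L`, starting with the vertex in `x`. -/
def collect : Cmd :=
  candHead ;; .loop (.lt (Ex.v .h) (Ex.v .len)) candOuter ;; candMid ;;
    .loop (.lt (Ex.v .h) (Ex.v .len)) unmarkBody

variable {n : ℕ} {μ : Mach} {G : Digraph (Fin n)} {sl : Fin n → List (Fin n × ℕ)} {σ : St}
  {X : Finset (Fin n)} {x : Fin n} {L : ℕ}

/-- The list `rl` of candidates found so far is stored in the rows `L` of `rlist`. -/
structure CandInv (G : Digraph (Fin n)) (X : Finset (Fin n)) (x : Fin n) (L : ℕ) (σ₀ : St)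
    (rl : List (Fin n)) (σ : St) : Prop where
  nodup : rl.Nodup
  head : ∃ t, rl = x :: t
  cand : ∀ z ∈ rl, Cand G X x z
  mark : ∀ z : Fin n, σ.a .mark z = if z ∈ rl then 1 else 0
  len : σ.v .len = rl.length
  rlist : ∀ (h : ℕ) (hh : h < rl.length), σ.a .rlist (L * n + h) = rl[h]
  low : ∀ i < L * n, σ.a .rlist i = σ₀.a .rlist i
  p : σ.v .p = L * n
  fr : Fr [.rlist, .mark] [.p, .len, .h, .w, .j, .y] σ₀ σ

theorem CandInv.length_le {σ₀ : St} {rl : List (Fin n)} (h : CandInv G X x L σ₀ rl σ) :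
    rl.length ≤ n := by simpa using h.nodup.length_le_card

theorem CandInv.fr' {σ₀ σ' : St} {rl : List (Fin n)} (h : CandInv G X x L σ₀ rl σ) {vs}
    (hf : Fr [] vs σ σ') (hv : ∀ v ∈ vs, v ∈ [Var.h, .w, .j, .y]) :
    CandInv G X x L σ₀ rl σ' where
  nodup := h.nodup
  head := h.head
  cand := h.cand
  mark := by rw [hf.arr _ (by simp)]; exact h.mark
  len := by rw [hf.var _ fun h' => by simpa using hv _ h']; exact h.len
  rlist := by rw [hf.arr _ (by simp)]; exact h.rlist
  low := by rw [hf.arr _ (by simp)]; exact h.low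
  p := by rw [hf.var _ fun h' => by simpa using hv _ h']; exact h.p
  fr := h.fr.sub hf (by simp) fun v hv' => by have := hv v hv'; simp at this ⊢; tauto

/-- The test does not look at the type of the edge: a directed edge from the unvisited candidate `z`
would prevent `y` from being ready. -/
theorem addCand_vc (hR : Room μ n) {σ₀ : St} (hD : DynX G X σ₀) (hx : Ready G X x)
    (hvx : σ₀.v .x = x) (hL : L ≤ n) {rl : List (Fin n)}
    (hI : CandInv G X x L σ₀ rl σ) {z y : Fin n} (hz : z ∈ rl) (hzy : G.Adj z y)
    (hvy : σ.v .y = y) :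
    addCand.vc μ (fun σ' => (∃ rl', CandInv G X x L σ₀ rl' σ' ∧ rl <+: rl' ∧
      (Ready G X y → lab G X y = lab G X x → y ∈ rl')) ∧
      Fr [.rlist, .mark] [.len] σ σ') σ := by
  have b1 := hR.small (j := x) (by have := x.isLt; omega)
  have b2 := hR.small (j := y) (by have := y.isLt; omega)
  have hlen := hI.length_le
  have b3 := hR.idx hL (j := rl.length) (by omega)
  have b4 := hR.small (j := rl.length) (by omega)
  have e1 : σ.v .x = x := by rw [hI.fr.var _ (by simp), hvx]
  have e2 : σ.a .lab = σ₀.a .lab := hI.fr.arr _ (by simp)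
  have e3 : σ.a .blk = σ₀.a .blk := hI.fr.arr _ (by simp)
  have old : (Ready G X y → lab G X y = lab G X x → y ∈ rl) →
      (∃ rl', CandInv G X x L σ₀ rl' σ ∧ rl <+: rl' ∧
      (Ready G X y → lab G X y = lab G X x → y ∈ rl')) := fun h =>
    ⟨rl, hI, List.prefix_rfl, h⟩
  simp only [addCand, Cmd.vc, Tst.Ok, Ex.Ok, Tst.Holds, Ex.eval, hvy, e1, e2, e3, hI.mark, hD.lab,
    hD.blk, hI.p, hI.len, Ex.ok_ofNat, Ex.eval_ofNat, Ex.ok_add, Ex.eval_add, blk_eq_zero,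
    true_and, and_true, St.sto_v, St.sto_a, St.set_v, Fr.refl_iff, if_true, reduceCtorEq, if_false]
  refine ⟨⟨by omega, by omega⟩, fun hm => ⟨⟨by omega, by omega⟩, fun hr =>
    ⟨⟨by omega, by omega⟩, fun he => ?_, fun he => ?_⟩, fun hr => ?_⟩, fun hm => ?_⟩
  -- The vertex is new, ready, and has the right label, so it is appended and marked.
  · simp only [and_assoc]
    repeat refine ⟨by omega, ?_⟩
    have hyn : y ∉ rl := by
      intro h; simp [h] at hm
    have hyx : y ∉ X := hr.1
    have hzr := (hI.cand z hz).ready hx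
    refine ⟨⟨rl ++ [y], ⟨?_, ?_, ?_, ?_, ?_, ?_, ?_, ?_, ?_⟩, List.prefix_append _ _,
      fun _ _ => by simp⟩, by simp⟩
    · rw [List.nodup_append]
      refine ⟨hI.nodup, List.nodup_singleton _, ?_⟩
      rintro a ha b hb rfl
      rw [List.mem_singleton] at hb
      exact hyn (hb ▸ ha)
    · obtain ⟨t, ht⟩ := hI.head
      exact ⟨t ++ [y], by simp [ht]⟩
    · intro u hu
      rw [List.mem_append, List.mem_singleton] at hu
      rcases hu with hu | rfl
      · exact hI.cand u hu
      · refine (hI.cand z hz).tail ⟨?_, hr, he⟩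
        rcases adj_iff.1 hzy with h | h
        · exact h
        · exact absurd (hr.2 _ h) hzr.1.1
    · intro u
      simp only [St.set_a, St.sto_a, reduceCtorEq, if_false, if_true, Function.update_apply,
        Fin.val_inj, hI.mark, List.mem_append, List.mem_singleton]
      by_cases h : u = y
      · subst h; simp
      · simp [h]
    · simp
    · intro h hh
      simp only [St.set_a, St.sto_a, if_true, Function.update_apply, reduceCtorEq, if_false]
      by_cases e : h = rl.length
      · subst e; simp
      · have h1 : h < rl.length := by simp at hh; omega
        rw [if_neg (by omega), hI.rlist h h1, List.getElem_append_left h1]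
    · intro i hi
      simp only [St.set_a, St.sto_a, if_true, Function.update_apply, reduceCtorEq, if_false]
      rw [if_neg (by omega), hI.low i hi]
    · simp [hI.p]
    · simp [hI.fr]
  · exact old (fun _ h => absurd h he)
  · exact old (fun h _ => absurd h hr)
  · refine old (fun _ _ => ?_)
    by_contra h
    simp [h] at hm

end WordRAM

/-! ### Correctness and cost of collecting candidates -/

namespace WordRAM

open CausalGraph

variable {n : ℕ} {μ : Mach} {G : Digraph (Fin n)} {sl : Fin n → List (Fin n × ℕ)} {σ : St}
  {X : Finset (Fin n)} {x : Fin n} {L : ℕ}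

theorem candInner_wp (hR : Room μ n) {σ₀ : St} (hl : SuccList G sl) (hS : Stat G sl σ₀)
    (hD : DynX G X σ₀) (hx : Ready G X x)
    (hvx : σ₀.v .x = x) (hL : L ≤ n) {rl : List (Fin n)}
    (hI : CandInv G X x L σ₀ rl σ) {z : Fin n} (hz : z ∈ rl) {h : ℕ} (hvh : σ.v .h = h)
    (hvw : σ.v .w = z) (hvj : σ.v .j = 0) :
    wp μ (.loop (.lt (Ex.v .j) (Ex.a .deg (Ex.v .w))) candInner)
      (10 + 2 + (sl z).length * (candInner.cost + 10 + 2))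
      (fun σ' => σ'.v .h = h ∧ ∃ rl', CandInv G X x L σ₀ rl' σ' ∧ rl <+: rl' ∧
        ∀ y, G.Adj z y → Ready G X y → lab G X y = lab G X x → y ∈ rl') σ := by
  set J : ℕ → St → Prop := fun j σ' => σ'.v .j = j ∧ σ'.v .w = z ∧ σ'.v .h = h ∧
    ∃ rl', CandInv G X x L σ₀ rl' σ' ∧ rl <+: rl' ∧
      ∀ y ∈ firsts (sl z) j, Ready G X y → lab G X y = lab G X x → y ∈ rl' with hJ
  have := wp_for (μ := μ) (jv := .j) (e := Ex.a .deg (Ex.v .w)) (N := (sl z).length)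
    (body := candInner) (k := candInner.cost) (σ := σ) J ?_ ?_
    ⟨hvj, hvw, hvh, rl, hI, List.prefix_rfl, by simp [firsts_zero]⟩
  · refine wp_mono this le_rfl ?_
    rintro σ' ⟨-, -, h1, rl', h2, h3, h4⟩
    exact ⟨h1, rl', h2, h3, fun y hy => h4 y (hl.mem_firsts_length.2 hy)⟩
  · rintro j hj σ' ⟨h1, h2, h3, rl', h4, -⟩
    have e2 : σ'.a .deg z = (sl z).length := by rw [h4.fr.arr _ (by simp), hS.deg]
    have b1 := hR.small (j := z) (by have := z.isLt; omega)
    simp [h1, h2, e2]; omega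
  · rintro j hj σ' ⟨h1, h2, h3, rl', h4, h5, h6⟩
    have hS' := hS.fr h4.fr (by decide) (by decide)
    have hrow := hS'.row z z.isLt.le
    have htgt := hS'.tgt z j hj
    have hlen := hl.length_le (x := z)
    have b1 := hR.idx z.isLt.le (j := j) (by omega)
    have b2 := hR.small (j := z) (by have := z.isLt; omega)
    have b3 := hR.small (j := j) (by omega)
    have hmem : (sl z)[j].1 ∈ firsts (sl z) (sl z).length := by
      unfold firsts
      rw [List.mem_toFinset, List.take_length]
      exact List.mem_map_of_mem (List.getElem_mem hj)
    refine wp_of_vc _ ?_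
    simp [candInner, h1, h2, hrow, htgt]
    repeat refine And.intro (by omega) ?_
    refine Cmd.vc_mono _ (addCand_vc hR hD hx hvx hL (h4.fr' (σ' := σ'.set .y (sl z)[j].1)
      (vs := [.y]) (by simp) (by simp)) (z := z) (h5.mem hz) (hl.mem_firsts_length.1 hmem)
      (by simp)) ?_
    rintro σ3 ⟨⟨rl3, g1, g2, g3⟩, g4⟩
    have hj3 : σ3.v .j = j := by rw [g4.var _ (by simp)]; simp [h1]
    have hw3 : σ3.v .w = z := by rw [g4.var _ (by simp)]; simp [h2]
    have hh3 : σ3.v .h = h := by rw [g4.var _ (by simp)]; simp [h3]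
    simp [hj3, hJ, hw3, hh3]
    repeat refine And.intro (by omega) ?_
    refine ⟨rl3, g1.fr' (vs := [.j]) (by simp) (by simp), h5.trans g2, ?_⟩
    intro y hy hr he
    rw [firsts_succ hj, Finset.mem_insert] at hy
    rcases hy with rfl | hy
    · exact g3 hr he
    · exact g2.mem (h6 y hy hr he)

open Classical in
/-- The set of candidates. -/
noncomputable def candSet (G : Digraph (Fin n)) (X : Finset (Fin n)) (x : Fin n) :
    Finset (Fin n) := Finset.univ.filter (Cand G X x)

theorem mem_candSet {z : Fin n} : z ∈ candSet G X x ↔ Cand G X x z := by simp [candSet]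

/-- The cost of scanning the successors of a vertex. -/
def wt (sl : Fin n → List (Fin n × ℕ)) (z : Fin n) : ℕ := (sl z).length + 1

theorem sum_wt_le {C : Finset (Fin n)} {l : List (Fin n)} (hn : l.Nodup) (hl : ∀ z ∈ l, z ∈ C) :
    (l.map (wt sl)).sum ≤ ∑ z ∈ C, wt sl z := by
  rw [← List.sum_toFinset _ hn]
  exact Finset.sum_le_sum_of_subset fun z hz => hl z (List.mem_toFinset.1 hz)

/-- A graph search whose queue is the output list. Every candidate is scanned once, which gives the
sum of the weights over the candidate set. The current vertex stands at position 0, so the pointer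
value 1 means that exactly the others remain; the marks are cleared again for later calls. -/
theorem collect_wp (hR : Room μ n) (hl : SuccList G sl) (hS : Stat G sl σ)
    (hD : DynX G X σ) (hx : Ready G X x) (hvx : σ.v .x = x) (hvL : σ.v .L = L) (hL : L ≤ n)
    (hmark : ∀ z : Fin n, σ.a .mark z = 0) :
    wp μ collect (3 * KB * ∑ z ∈ candSet G X x, wt sl z) (fun σ' => ∃ rl : List (Fin n),
      rl.Nodup ∧ (∃ t, rl = x :: t) ∧ (∀ z, z ∈ rl ↔ Cand G X x z) ∧
      (∀ (h : ℕ) (hh : h < rl.length), σ'.a .rlist (L * n + h) = rl[h]) ∧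
      (∀ i < L * n, σ'.a .rlist i = σ.a .rlist i) ∧
      σ'.a .rlen = Function.update (σ.a .rlen) L rl.length ∧
      σ'.a .rptr = Function.update (σ.a .rptr) L 1 ∧ (∀ z : Fin n, σ'.a .mark z = 0) ∧
      Fr [.rlist, .mark, .rlen, .rptr] [.p, .len, .h, .w, .j, .y] σ σ') σ := by
  set C := candSet G X x with hC
  set S := ∑ z ∈ C, wt sl z with hSdef
  have b1 := hR.small (j := x) (by have := x.isLt; omega)
  have bL := hR.small (j := L) (by omega)
  have bLn := hR.idx hL (j := n) (by omega)
  have hrow := hS.row L hL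
  have hhead : wp μ candHead candHead.cost
      (fun σ' => CandInv G X x L σ [x] σ' ∧ σ'.v .h = 0) σ := by
    refine wp_of_vc _ ?_
    simp [candHead, hvx, hvL, hrow]
    repeat refine And.intro (by omega) ?_
    refine ⟨by simp, ⟨[], rfl⟩, ?_, ?_, by simp, ?_, ?_, by simp, by simp⟩
    · intro z hz
      rw [List.mem_singleton] at hz
      subst hz; exact .refl
    · intro z; simp [Function.update_apply, Fin.val_inj, hmark]
    · intro h hh
      obtain rfl : h = 0 := by simpa using hh
      simp
    · intro i hi
      simp only [St.set_a, St.sto_a, if_true, reduceCtorEq, if_false, Function.update_apply]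
      rw [if_neg (by omega)]
  set Done : St → Prop := fun σ' => ∃ rl, CandInv G X x L σ rl σ' ∧ ∀ z, z ∈ rl ↔ Cand G X x z
    with hDone
  have hloop : ∀ σ', (CandInv G X x L σ [x] σ' ∧ σ'.v .h = 0) →
      wp μ (.loop (.lt (Ex.v .h) (Ex.v .len)) candOuter) (2 + (KB * S + 1)) Done σ' := by
    rintro σ1 ⟨hI1, hh1⟩
    -- The first `h` entries have been scanned and their qualifying neighbours are listed. The
    -- scanned weight and the remaining budget together cover `KB * S + 1`.
    refine wp_loop (t := .lt (Ex.v .h) (Ex.v .len)) (fun k σ' => ∃ (h : ℕ) (rl : List (Fin n)),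
      CandInv G X x L σ rl σ' ∧ h ≤ rl.length ∧ σ'.v .h = h ∧
      (∀ z ∈ rl.take h, ∀ y, G.Adj z y → Ready G X y → lab G X y = lab G X x → y ∈ rl) ∧
      KB * S + 1 ≤ KB * ((rl.take h).map (wt sl)).sum + k) ?_
      ⟨0, [x], hI1, by simp, hh1, by simp, by simp⟩
    rintro k σ2 ⟨h, rl, hI, hhl, hvh, hcl, hk⟩
    refine ⟨by simp, ?_, ?_⟩
    · simp only [Tst.Holds, Ex.eval, hvh, hI.len]
      intro hlt
      set z := rl[h] with hz
      have hzrl : z ∈ rl := List.getElem_mem hlt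
      have htake : rl.take (h + 1) = rl.take h ++ [z] := List.take_succ_eq_append_getElem hlt
      have hsum : ((rl.take (h + 1)).map (wt sl)).sum = ((rl.take h).map (wt sl)).sum + wt sl z := by
        rw [htake]; simp
      have hle : ((rl.take (h + 1)).map (wt sl)).sum ≤ S :=
        sum_wt_le (hI.nodup.sublist (List.take_sublist _ _)) fun z hz =>
          mem_candSet.2 (hI.cand z (List.mem_of_mem_take hz))
      have hKle := Nat.mul_le_mul_left KB hle
      rw [hsum, Nat.mul_add] at hKle
      have hrlz := hI.rlist h hlt
      have hlen := hI.length_le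
      have b2 := hR.idx hL (j := h) (by omega)
      have b3 := hR.small (j := h) (by omega)
      have hA : wp μ candOuterHead candOuterHead.cost (fun σ' => CandInv G X x L σ rl σ' ∧
          σ'.v .h = h ∧ σ'.v .w = z ∧ σ'.v .j = 0) σ2 := by
        refine wp_of_vc _ ?_
        simp [candOuterHead, hvh, hI.p, hrlz]
        repeat refine And.intro (by omega) ?_
        exact ⟨hI.fr' (σ' := (σ2.set .w z).set .j 0) (vs := [.w, .j]) (by simp) (by simp), by rw [hz]⟩
      have hB : ∀ σ', (σ'.v .h = h ∧ ∃ rl', CandInv G X x L σ rl' σ' ∧ rl <+: rl' ∧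
          ∀ y, G.Adj z y → Ready G X y → lab G X y = lab G X x → y ∈ rl') →
          wp μ (.set .h (Ex.v .h + 1)) 4 (fun σ'' => ∃ (h : ℕ) (rl : List (Fin n)),
      CandInv G X x L σ rl σ'' ∧ h ≤ rl.length ∧ σ''.v .h = h ∧
      (∀ z ∈ rl.take h, ∀ y, G.Adj z y → Ready G X y → lab G X y = lab G X x → y ∈ rl) ∧
      KB * S + 1 ≤ KB * ((rl.take h).map (wt sl)).sum + (k - KB * wt sl z)) σ' := by
        rintro σ3 ⟨hh3, rl', hI3, hpre, hnew⟩
        refine wp_of_vc (.set .h (Ex.v .h + 1)) ?_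
        simp [hh3]
        repeat refine And.intro (by omega) ?_
        have htake' : rl'.take (h + 1) = rl.take (h + 1) := by
          obtain ⟨t, rfl⟩ := hpre
          rw [List.take_append_of_le_length (by omega)]
        refine ⟨rl', hI3.fr' (σ' := σ3.set .h (h + 1)) (vs := [.h]) (by simp) (by simp), ?_, ?_, ?_⟩
        · have := hpre.length_le; omega
        · rw [htake', htake]
          intro u hu y hy hr he
          rw [List.mem_append, List.mem_singleton] at hu
          rcases hu with hu | rfl
          · exact hpre.mem (hcl u hu y hy hr he)
          · exact hnew y hy hr he
        · rw [← List.map_take, htake', hsum, Nat.mul_add]; omega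
      refine ⟨_, k - KB * wt sl z, ?_, wp_seq (wp_mono hA le_rfl fun σ3 ⟨g1, g2, g3, g4⟩ =>
        wp_seq (wp_mono (candInner_wp hR hl hS hD hx hvx hL g1 hzrl g2 g3 g4) le_rfl hB))⟩
      have e1 : candOuterHead.cost ≤ 60 := by decide
      have e2 : candInner.cost + 10 + 2 ≤ 400 := by decide
      have e3 := Nat.mul_le_mul_left (sl z).length e2
      simp only [Tst.cost, Ex.cost]
      have e4 : KB * wt sl z = (sl z).length * 400 + 400 := by unfold KB wt; ring
      omega
    · simp only [Tst.Holds, Ex.eval, hvh, hI.len]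
      intro hlt
      obtain rfl : h = rl.length := by omega
      refine ⟨?_, rl, hI, fun z => ⟨hI.cand z, fun hz => ?_⟩⟩
      · have : ((rl.take rl.length).map (wt sl)).sum ≤ S :=
          sum_wt_le (hI.nodup.sublist (List.take_sublist _ _)) fun z hz =>
            mem_candSet.2 (hI.cand z (List.mem_of_mem_take hz))
        have := Nat.mul_le_mul_left KB this
        omega
      · rw [List.take_length] at hcl
        -- The finished list contains `x` and is closed under the steps that generate the
        -- candidates.
        induction hz with
        | refl => obtain ⟨t, ht⟩ := hI.head; rw [ht]; simp
        | tail _ h2 ih => exact hcl _ ih _ h2.1.1 h2.2.1 h2.2.2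
  have hmid : ∀ σ', Done σ' → wp μ (candMid ;; .loop (.lt (Ex.v .h) (Ex.v .len)) unmarkBody)
      (candMid.cost + (1 + 2 + C.card * (unmarkBody.cost + 1 + 2))) (fun σ' => ∃ rl : List (Fin n),
      rl.Nodup ∧ (∃ t, rl = x :: t) ∧ (∀ z, z ∈ rl ↔ Cand G X x z) ∧
      (∀ (h : ℕ) (hh : h < rl.length), σ'.a .rlist (L * n + h) = rl[h]) ∧
      (∀ i < L * n, σ'.a .rlist i = σ.a .rlist i) ∧
      σ'.a .rlen = Function.update (σ.a .rlen) L rl.length ∧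
      σ'.a .rptr = Function.update (σ.a .rptr) L 1 ∧ (∀ z : Fin n, σ'.a .mark z = 0) ∧
      Fr [.rlist, .mark, .rlen, .rptr] [.p, .len, .h, .w, .j, .y] σ σ') σ' := by
    rintro σ1 ⟨rl, hI, hrl⟩
    have hcard : rl.length = C.card := by
      rw [← List.toFinset_card_of_nodup hI.nodup]
      congr 1
      ext z; rw [List.mem_toFinset, hrl, mem_candSet]
    have hlen := hI.length_le
    have hvL1 : σ1.v .L = L := by rw [hI.fr.var _ (by simp), hvL]
    rw [← hcard]
    set J : ℕ → St → Prop := fun h σ' => σ'.v .h = h ∧ σ'.v .p = L * n ∧ σ'.v .len = rl.length ∧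
      (∀ (h : ℕ) (hh : h < rl.length), σ'.a .rlist (L * n + h) = rl[h]) ∧
      (∀ i < L * n, σ'.a .rlist i = σ.a .rlist i) ∧
      σ'.a .rlen = Function.update (σ.a .rlen) L rl.length ∧
      σ'.a .rptr = Function.update (σ.a .rptr) L 1 ∧
      (∀ z : Fin n, σ'.a .mark z = if z ∈ rl.drop h then 1 else 0) ∧
      Fr [.rlist, .mark, .rlen, .rptr] [.p, .len, .h, .w, .j, .y] σ σ' with hJ
    have h0 : wp μ candMid candMid.cost (J 0) σ1 := by
      refine wp_of_vc _ ?_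
      simp [candMid, hI.len, hvL1]
      repeat refine And.intro (by omega) ?_
      simp only [hJ, St.set_v, St.sto_v, St.set_a, St.sto_a, if_true, reduceCtorEq, if_false, hI.p,
        hI.len, true_and, hI.fr.arr .rlen (by simp), hI.fr.arr .rptr (by simp), List.drop_zero]
      refine ⟨hI.rlist, hI.low, hI.mark, ?_⟩
      simp [hI.fr.mono (as' := [.rlist, .mark, .rlen, .rptr]) (by simp) (fun _ h => h)]
    refine wp_seq (wp_mono h0 le_rfl fun σ2 h2 => ?_)
    refine wp_mono (wp_for (e := Ex.v .len) (k := unmarkBody.cost) J ?_ ?_ h2) le_rfl ?_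
    · rintro j hj σ' ⟨h1, h2, h3, -⟩
      exact ⟨h1, by simp, h3⟩
    · rintro h hh σ' ⟨h1, h2, h3, h4, h5, h6, h7, h8, h9⟩
      have e1 := h4 h hh
      have b2 := hR.idx hL (j := h) (by omega)
      have b3 := hR.small (j := h) (by omega)
      have b4 := hR.small (j := rl[h]) (by have := (rl[h]).isLt; omega)
      refine wp_of_vc _ ?_
      simp [unmarkBody, h1, h2, e1]
      repeat refine And.intro (by omega) ?_
      simp only [hJ, St.set_v, St.sto_v, St.set_a, St.sto_a, if_true, reduceCtorEq, if_false]
      refine ⟨trivial, h2, h3, h4, h5, h6, h7, fun z => ?_, by simpa using h9⟩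
      have hd : rl.drop h = rl[h] :: rl.drop (h + 1) := List.drop_eq_getElem_cons hh
      have hnd : (rl.drop h).Nodup := hI.nodup.sublist (List.drop_sublist _ _)
      rw [hd, List.nodup_cons] at hnd
      rw [Function.update_apply, h8, hd]
      by_cases hz : z = rl[h]
      · subst hz; simp [hnd.1]
      · rw [if_neg (by simpa [Fin.val_inj] using hz)]
        simp only [List.mem_cons, hz, false_or]
    · rintro σ' ⟨h1, h2, h3, h4, h5, h6, h7, h8, h9⟩
      exact ⟨rl, hI.nodup, hI.head, hrl, h4, h5, h6, h7, by simpa using h8, h9⟩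
  refine wp_mono (wp_seq (wp_mono hhead le_rfl fun σ1 h1 =>
    wp_seq (wp_mono (hloop σ1 h1) le_rfl hmid))) ?_ (fun _ => id)
  have hCS : C.card ≤ S := by
    rw [hSdef, Finset.card_eq_sum_ones]
    exact Finset.sum_le_sum fun z _ => by unfold wt; omega
  have hC1 : 1 ≤ C.card := Finset.card_pos.2 ⟨x, mem_candSet.2 .refl⟩
  have e1 : candHead.cost ≤ 100 := by decide
  have e2 : candMid.cost ≤ 100 := by decide
  have e3 : unmarkBody.cost + 1 + 2 ≤ 100 := by decide
  have e4 := Nat.mul_le_mul_left C.card e3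
  unfold KB
  nlinarith

end WordRAM

/-! ### The search path, pending branches, and the descent -/

namespace WordRAM

open CausalGraph

variable {n : ℕ} {μ : Mach} {G D : Digraph (Fin n)} {sl : Fin n → List (Fin n × ℕ)} {σ σ' : St}
  {X : Finset (Fin n)} {x : Fin n} {L : ℕ} {xs : List (Fin n)}

/-! ### The path of the search -/

/-- The branches still to be taken at level `j`. -/
def remSet (G : Digraph (Fin n)) (X : Finset (Fin n)) (v : Fin n) (j : ℕ) (σ : St) :
    Set (Fin n) :=
  {y | if σ.a .rlen j = 0 then Cand G X v y ∧ y ≠ v else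
    ∃ h < n, σ.a .rptr j ≤ h ∧ h < σ.a .rlen j ∧ σ.a .rlist (j * n + h) = y}

/-- If the candidates of level `j` have been collected, they are stored, and the current one is
none of those still to be taken. -/
def LevOk (G : Digraph (Fin n)) (X : Finset (Fin n)) (v : Fin n) (j : ℕ) (σ : St) : Prop :=
  σ.a .rlen j ≠ 0 → ∃ rl : List (Fin n), rl.Nodup ∧ σ.a .rlen j = rl.length ∧
    (∀ (h : ℕ) (hh : h < rl.length), σ.a .rlist (j * n + h) = rl[h]) ∧
    (∀ z ∈ rl, Cand G X v z) ∧ v ∉ rl.drop (σ.a .rptr j)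

/-- The branches still to be taken at the levels of the path `xs`. -/
def remAll (G : Digraph (Fin n)) (xs : List (Fin n)) (σ : St) (j : ℕ) : Set (Fin n) :=
  {y | ∃ hj : j < xs.length, y ∈ remSet G (xs.take j).toFinset xs[j] j σ}

/-- The state describes the path `xs` of the search. -/
structure Inv (G : Digraph (Fin n)) (sl : Fin n → List (Fin n × ℕ)) (xs : List (Fin n))
    (σ : St) : Prop where
  stat : Stat G sl σ
  mcs : MCSPrefix G xs
  len : σ.v .L = xs.length
  ord : ∀ (j : ℕ) (hj : j < xs.length), σ.a .ord j = xs[j]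
  time : ∀ (j : ℕ) (hj : j < xs.length), σ.a .time xs[j] = j
  dyn : DynX G xs.toFinset σ
  mark : ∀ z : Fin n, σ.a .mark z = 0
  lev : ∀ (j : ℕ) (hj : j < xs.length), LevOk G (xs.take j).toFinset xs[j] j σ

/-- The extensions still to be written. -/
def Todo (G : Digraph (Fin n)) (xs : List (Fin n)) (σ : St) : Set (Digraph (Fin n)) :=
  {D | InExt G xs D ∨ Pending G xs (remAll G xs σ) D}

theorem Inv.length_le (h : Inv G sl xs σ) : xs.length ≤ n := by
  simpa using h.mcs.nodup.length_le_card

/-- The rows of the candidate lists below level `L` agree. -/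
structure SameLow (n L : ℕ) (σ σ' : St) : Prop where
  rlen : ∀ j < L, σ'.a .rlen j = σ.a .rlen j
  rptr : ∀ j < L, σ'.a .rptr j = σ.a .rptr j
  rlist : ∀ i < L * n, σ'.a .rlist i = σ.a .rlist i

theorem SameLow.of_fr {as vs} (h : Fr as vs σ σ') (ha : ∀ id ∈ as, id ∉ [Arr.rlen, .rptr, .rlist]) :
    SameLow n L σ σ' := by
  have e : ∀ id ∈ [Arr.rlen, .rptr, .rlist], σ'.a id = σ.a id := fun id hid =>
    h.arr id fun h' => ha id h' hid
  exact ⟨fun _ _ => by rw [e _ (by simp)], fun _ _ => by rw [e _ (by simp)],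
    fun _ _ => by rw [e _ (by simp)]⟩

theorem SameLow.row (h : SameLow n L σ σ') {j k : ℕ} (hj : j < L) (hk : k < n) :
    σ'.a .rlist (j * n + k) = σ.a .rlist (j * n + k) := by
  refine h.rlist _ ?_
  have := Nat.mul_le_mul_right n (show j + 1 ≤ L from hj)
  rw [Nat.add_mul] at this
  omega

theorem SameLow.remSet (h : SameLow n L σ σ') {j : ℕ} (hj : j < L) :
    remSet G X x j σ' = remSet G X x j σ := by
  ext y
  simp only [WordRAM.remSet, Set.mem_ofPred_eq, h.rlen j hj, h.rptr j hj]
  split_ifs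
  · rfl
  · refine exists_congr fun k => and_congr_right fun hk => ?_
    rw [h.row hj hk]

/-- The stored list has at most `n` entries, so it stays within row `j`, and row `j` is not touched
by work on higher levels. -/
theorem SameLow.levOk (h : SameLow n L σ σ') {j : ℕ} (hj : j < L) (hl : LevOk G X x j σ) :
    LevOk G X x j σ' := by
  intro h0
  rw [h.rlen j hj] at h0
  obtain ⟨rl, h1, h2, h3, h4⟩ := hl h0
  refine ⟨rl, h1, (h.rlen j hj).trans h2, fun k hk => ?_, by rwa [h.rptr j hj]⟩
  have : rl.length ≤ n := by simpa using h1.length_le_card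
  rw [h.row hj (by omega), h3]

theorem SameLow.pending (h : SameLow n L σ σ') (hL : xs.length ≤ L) :
    Pending G xs (remAll G xs σ') D ↔ Pending G xs (remAll G xs σ) D := by
  refine pending_congr fun j hj => ?_
  ext y
  simp only [remAll, Set.mem_ofPred_eq, h.remSet (hj.trans_le hL)]

theorem pending_remAll_snoc :
    Pending G (xs ++ [x]) (remAll G (xs ++ [x]) σ) D ↔ Pending G xs (remAll G xs σ) D ∨
      ∃ y ∈ remSet G xs.toFinset x xs.length σ, InExt G (xs ++ [y]) D := by
  rw [pending_snoc]
  refine or_congr (pending_congr fun j hj => ?_) ?_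
  · ext y
    have h1 : j < (xs ++ [x]).length := by simp; omega
    simp only [remAll, Set.mem_ofPred_eq, h1, hj, exists_true_left,
      List.take_append_of_le_length hj.le, List.getElem_append_left hj]
  · simp [remAll]

theorem Inv.remOk (h : Inv G sl xs σ) : RemOk G xs (remAll G xs σ) := by
  rintro j hj y ⟨_, hy⟩
  simp only [remSet, Set.mem_ofPred_eq] at hy
  split_ifs at hy with h0
  · exact hy
  · obtain ⟨rl, h1, h2, h3, h4, h5⟩ := h.lev j hj h0
    obtain ⟨k, -, hk1, hk2, hk3⟩ := hy
    rw [h2] at hk2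
    rw [h3 k hk2, Fin.val_inj] at hk3
    subst hk3
    refine ⟨h4 _ (List.getElem_mem _), fun e => h5 ?_⟩
    rw [← e, List.mem_drop_iff_getElem]
    exact ⟨k - σ.a .rptr j, by omega, by congr 1; omega⟩

/-- A length of zero means that the candidates have not been collected and that all candidates
except `x` are pending. Together with `x` they cover the extensions below the node, so extending the
path changes nothing in what remains to be written. -/
theorem todo_snoc (hG : IsMPDAG G) (hxs : MCSPrefix G xs) (hx : IsTop G xs.toFinset x)
    (h0 : σ.a .rlen xs.length = 0) : Todo G (xs ++ [x]) σ = Todo G xs σ := by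
  ext D
  simp only [Todo, Set.mem_ofPred_eq, pending_remAll_snoc, remSet, h0, if_true]
  rw [inExt_iff_cand hG hxs hx]
  constructor
  · rintro (h | h | ⟨y, h1, h2⟩)
    · exact Or.inl ⟨x, .refl, h⟩
    · exact Or.inr h
    · exact Or.inl ⟨y, h1.1, h2⟩
  · rintro (⟨y, h1, h2⟩ | h)
    · by_cases e : y = x
      · subst e; exact Or.inl h2
      · exact Or.inr (Or.inr ⟨y, ⟨h1, e⟩, h2⟩)
    · exact Or.inr (Or.inl h)

/-- Extending the path by one vertex. -/
theorem Inv.snoc (h : Inv G sl xs σ) (hx : IsTop G xs.toFinset x) {as vs}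
    (hf : Fr as vs σ σ') (ha : ∀ id ∈ as, id ∉ [Arr.row, .deg, .tgt, .flg, .adj, .mark])
    (hv : ∀ x ∈ vs, x ≠ Var.n) (hs : SameLow n xs.length σ σ')
    (hlen : σ'.v .L = xs.length + 1)
    (hord : σ'.a .ord = Function.update (σ.a .ord) xs.length x)
    (htime : σ'.a .time = Function.update (σ.a .time) x xs.length)
    (hdyn : DynX G (insert x xs.toFinset) σ')
    (hlev : LevOk G xs.toFinset x xs.length σ') : Inv G sl (xs ++ [x]) σ' where
  stat := h.stat.fr hf (fun id hid h' => ha id hid (by simp at h' ⊢; tauto)) hv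
  mcs := h.mcs.snoc hx
  len := by simp [hlen]
  ord := by
    intro j hj
    rw [hord]
    rcases Nat.lt_or_ge j xs.length with hj' | hj'
    · rw [Function.update_of_ne hj'.ne, h.ord j hj', List.getElem_append_left hj']
    · obtain rfl : j = xs.length := by simp at hj; omega
      simp
  time := by
    intro j hj
    rw [htime]
    rcases Nat.lt_or_ge j xs.length with hj' | hj'
    · rw [List.getElem_append_left hj', Function.update_of_ne, h.time j hj']
      intro e
      have := hx.1.1
      rw [List.mem_toFinset, ← Fin.ext e] at this
      exact this (List.getElem_mem _)
    · obtain rfl : j = xs.length := by simp at hj; omega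
      simp
  dyn := by
    have : (xs ++ [x]).toFinset = insert x xs.toFinset := by ext z; simp [or_comm]
    rw [this]; exact hdyn
  mark := by rw [hf.arr _ fun h' => ha _ h' (by simp)]; exact h.mark
  lev := by
    intro j hj
    rcases Nat.lt_or_ge j xs.length with hj' | hj'
    · simp only [List.take_append_of_le_length hj'.le, List.getElem_append_left hj']
      exact hs.levOk hj' (h.lev j hj')
    · obtain rfl : j = xs.length := by simp at hj; omega
      simpa using hlev

theorem Inv.fr (h : Inv G sl xs σ) {as vs} (hf : Fr as vs σ σ')
    (ha : ∀ id ∈ as, id ∈ [Arr.last])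
    (hv : ∀ x ∈ vs, x ∉ [Var.n, .L]) : Inv G sl xs σ' where
  stat := h.stat.fr hf (fun id hid h' => by have := ha id hid; simp at this h'; simp [this] at h')
    fun x hx h' => hv x hx (by simp [h'])
  mcs := h.mcs
  len := by rw [hf.var _ fun h' => hv _ h' (by simp)]; exact h.len
  ord := by rw [hf.arr _ fun h' => by simpa using ha _ h']; exact h.ord
  time := by rw [hf.arr _ fun h' => by simpa using ha _ h']; exact h.time
  dyn := h.dyn.fr hf fun id hid h' => by have := ha id hid; simp at this h'; simp [this] at h'
  mark := by rw [hf.arr _ fun h' => by simpa using ha _ h']; exact h.mark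
  lev := fun j hj => (SameLow.of_fr (n := n) (L := xs.length) hf fun id hid h' => by
    have := ha id hid; simp at this h'; simp [this] at h').levOk hj (h.lev j hj)

theorem SameLow.trans {σ'' : St} (h : SameLow n L σ σ') (h' : SameLow n L σ' σ'') :
    SameLow n L σ σ'' :=
  ⟨fun j hj => (h'.rlen j hj).trans (h.rlen j hj), fun j hj => (h'.rptr j hj).trans (h.rptr j hj),
    fun j hj => (h'.rlist j hj).trans (h.rlist j hj)⟩

theorem SameLow.mono {L' : ℕ} (h : SameLow n L σ σ') (hL : L' ≤ L) : SameLow n L' σ σ' :=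
  ⟨fun j hj => h.rlen j (by omega), fun j hj => h.rptr j (by omega),
    fun j hj => h.rlist j (hj.trans_le (Nat.mul_le_mul_right n hL))⟩

theorem SameLow.todo (h : SameLow n L σ σ') (hL : xs.length ≤ L) :
    Todo G xs σ' = Todo G xs σ := by
  ext D; simp only [Todo, Set.mem_ofPred_eq, h.pending hL]

/-! ### Descending to a leaf -/

open Classical in
/-- The number of edges into vertices all of whose directed parents are visited. -/
noncomputable def freeIn (G : Digraph (Fin n)) (X : Finset (Fin n)) : ℕ :=
  ∑ y ∈ Finset.univ.filter (fun y => ∀ u, DirEdge G u y → u ∈ X), lab G Finset.univ y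

theorem lab_mono {Y : Finset (Fin n)} (h : X ⊆ Y) (y : Fin n) : lab G X y ≤ lab G Y y := by
  classical
  unfold lab
  exact Finset.card_le_card fun z hz => by
    rw [Finset.mem_filter] at hz ⊢
    exact ⟨h hz.1, hz.2⟩

theorem freeIn_mono {Y : Finset (Fin n)} (h : X ⊆ Y) : freeIn G X ≤ freeIn G Y := by
  classical
  unfold freeIn
  refine Finset.sum_le_sum_of_subset fun y hy => ?_
  rw [Finset.mem_filter] at hy ⊢
  exact ⟨hy.1, fun u hu => h (hy.2 u hu)⟩

theorem sum_lab_le (hl : SuccList G sl) : ∑ y, lab G Finset.univ y = ∑ x, (sl x).length := by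
  classical
  have h1 : ∀ x, (sl x).length = (Finset.univ.filter fun y => G.Adj x y).card := by
    intro x
    rw [← List.length_map (f := Prod.fst), ← List.toFinset_card_of_nodup (hl.nodup x)]
    congr 1
    ext y
    rw [Finset.mem_filter, hl.adj_iff]
    simp
  simp only [h1, lab, Finset.card_filter]
  rw [Finset.sum_comm]

theorem freeIn_le (hl : SuccList G sl) : freeIn G X ≤ ∑ x, wt sl x := by
  classical
  unfold freeIn
  refine (Finset.sum_le_sum_of_subset (Finset.filter_subset _ _)).trans ?_
  rw [sum_lab_le hl]
  exact Finset.sum_le_sum fun x _ => by unfold wt; omega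

/-- The largest label of a ready vertex grows by at most one, except by labels that are paid for
by edges into vertices that become ready. -/
theorem lab_le_freeIn (hx : x ∉ X) {y : Fin n} {i : ℕ}
    (hi : ∀ y, Ready G X y → lab G X y ≤ i) (hy : Ready G (insert x X) y) :
    lab G (insert x X) y + freeIn G X ≤ i + 1 + freeIn G (insert x X) := by
  classical
  have hm := freeIn_mono (G := G) (Finset.subset_insert x X)
  by_cases h : Ready G X y
  · have h1 := hi y h
    have h2 := lab_insert (G := G) (y := y) hx
    split_ifs at h2 <;> omega
  · have h2 : ¬ ∀ u, DirEdge G u y → u ∈ X := fun h' =>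
      h ⟨fun h'' => hy.1 (Finset.mem_insert_of_mem h''), h'⟩
    have h3 := lab_mono (G := G) (Finset.subset_univ (insert x X)) y
    -- The directed parents of `y` are completed only by visiting `x`, so all edges into `y` are new
    -- in `freeIn`, and their number bounds the label.
    have h4 : lab G Finset.univ y + freeIn G X ≤ freeIn G (insert x X) := by
      unfold freeIn
      rw [← Finset.sum_insert (s := Finset.univ.filter fun y => ∀ u, DirEdge G u y → u ∈ X)
        (by simpa using h2)]
      refine Finset.sum_le_sum_of_subset fun z hz => ?_
      rw [Finset.mem_insert, Finset.mem_filter] at hz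
      rw [Finset.mem_filter]
      rcases hz with rfl | hz
      · exact ⟨Finset.mem_univ _, hy.2⟩
      · exact ⟨Finset.mem_univ _, fun u hu => Finset.mem_insert_of_mem (hz.2 u hu)⟩
    omega

def scanBody : Cmd := .set .i (Ex.v .i - 1)

/-- Decrease `i` to the index of the last nonempty bucket. -/
def scan : Cmd := .loop (.eq (Ex.a .blen (Ex.v .i)) 0) scanBody

theorem scan_wp (hR : Room μ n) (hin : σ.v .i ≤ n) {l : ℕ} (hl : l ≤ σ.v .i)
    (hb : σ.a .blen l ≠ 0) (h0 : ∀ l', l < l' → l' ≤ σ.v .i → σ.a .blen l' = 0) :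
    wp μ scan (30 * (σ.v .i - l) + 20) (fun σ' => Fr [] [.i] σ σ' ∧ σ'.v .i = l) σ := by
  have ht : (Tst.eq (Ex.a .blen (Ex.v .i)) 0).cost ≤ 15 := by decide
  refine wp_mono (wp_loop (t := .eq (Ex.a .blen (Ex.v .i)) 0) (fun m σ' => Fr [] [.i] σ σ' ∧
    σ'.v .i ≤ σ.v .i ∧ l ≤ σ'.v .i ∧ 30 * (σ'.v .i - l) + 1 ≤ m) ?_
    ⟨.refl _ _ _, le_rfl, hl, le_rfl⟩) (by omega) fun _ => id
  rintro m σ1 ⟨h1, h2, h3, h4⟩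
  have b1 := hR.small (j := σ1.v .i) (by omega)
  have hb1 : σ1.a .blen = σ.a .blen := h1.arr _ (by simp)
  refine ⟨by simp; omega, fun hh => ?_, fun hh => ?_⟩
  · have hb' : σ1.a .blen (σ1.v .i) = 0 := hh
    have hlt : l < σ1.v .i := lt_of_le_of_ne h3 fun e => hb (by rw [← hb1, e, hb'])
    refine ⟨scanBody.cost, m - 30, ?_, wp_of_vc _ ?_⟩
    · have : scanBody.cost = 4 := rfl
      omega
    · simp [scanBody, h1]
      omega
  · have hb' : σ1.a .blen (σ1.v .i) ≠ 0 := hh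
    refine ⟨by omega, h1, ?_⟩
    by_contra hne
    exact hb' (by rw [hb1]; exact h0 _ (by omega) h2)

/-- The vertex that is chosen next. -/
theorem exists_top (hG : IsMPDAG G) (hD : DynX G X σ) (hT : ∃ y, y ∉ X) :
    ∃ x, IsTop G X x ∧ σ.a .blen (lab G X x) ≠ 0 ∧
      σ.a .bkt (lab G X x * n + (σ.a .blen (lab G X x) - 1)) = x ∧
      ∀ l ≤ n, lab G X x < l → σ.a .blen l = 0 := by
  classical
  obtain ⟨y0, hy0⟩ := hT
  obtain ⟨y1, hy1⟩ := hG.exists_ready hy0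
  obtain ⟨y, hy, hmax⟩ := Finset.exists_max_image (Finset.univ.filter (Ready G X)) (lab G X)
    ⟨y1, by simpa using hy1⟩
  have hyr : Ready G X y := by simpa using hy
  have hpos := hD.lists.pos_lt y (by simpa [blk_eq_zero] using hyr)
  obtain ⟨x, hx1, hx2, hx3⟩ := hD.lists.mem (lab G X y) lab_le_size
    (σ.a .blen (lab G X y) - 1) (by omega)
  have hx : Ready G X x := by simpa [blk_eq_zero] using hx1
  have hbk := hD.lists.bkt_pos x hx1
  rw [hx3] at hbk
  refine ⟨x, ⟨hx, fun z hz => hx2 ▸ hmax z (by simpa using hz)⟩, by rw [hx2]; omega,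
    by rw [hx2] at hbk ⊢; exact hbk, fun l hl hlt => ?_⟩
  by_contra h0
  obtain ⟨z, hz1, hz2, -⟩ := hD.lists.mem l hl 0 (by omega)
  have := hmax z (by simpa [blk_eq_zero] using hz1)
  omega

/-- Choose a vertex from bucket `i` for level `L`. -/
def choose : Cmd :=
  .set .x (Ex.a .bkt (Ex.a .row (Ex.v .i) + (Ex.a .blen (Ex.v .i) - 1))) ;;
  .sto .rlen (Ex.v .L) 0

theorem choose_vc (hR : Room μ n) (hS : Stat G sl σ) (hL : σ.v .L ≤ n) (hin : σ.v .i ≤ n)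
    (hb : σ.a .blen (σ.v .i) ≤ n) (hx : σ.a .bkt (σ.v .i * n + (σ.a .blen (σ.v .i) - 1)) = x) :
    choose.vc μ (fun σ' => σ'.v .x = x ∧ Fr [.rlen] [.x] σ σ' ∧
      σ'.a .rlen = Function.update (σ.a .rlen) (σ.v .L) 0) σ := by
  have b1 := hR.small (j := σ.v .i) (by omega)
  have b2 := hR.idx hin (j := σ.a .blen (σ.v .i) - 1) (by omega)
  have b3 := hR.small (j := σ.v .L) (by omega)
  simp [choose, hS.row _ hin, hx]
  omega

def descendBody : Cmd := scan ;; choose ;; visit ;; .set .L (Ex.v .L + 1)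

/-- Extend the path to a leaf of the search tree. -/
def descend : Cmd := .loop (.lt (Ex.v .L) (Ex.v .n)) descendBody

/-- The part of the cost of the descent that is still to be paid. -/
noncomputable def descPot (G : Digraph (Fin n)) (sl : Fin n → List (Fin n × ℕ))
    (X : Finset (Fin n)) (i : ℕ) : ℕ :=
  2 * ∑ z ∈ Xᶜ, wt sl z + i + (∑ z, wt sl z - freeIn G X)

/-- The weight of an unvisited vertex occurs twice in the potential: one copy pays for the visit,
the other for the possible growth of `i` by one. Growth beyond that is matched by `freeIn`. -/
theorem descPot_insert (hl : SuccList G sl) (hx : x ∉ X) {i i' : ℕ}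
    (h : i' + freeIn G X ≤ i + 1 + freeIn G (insert x X)) :
    descPot G sl (insert x X) i' + wt sl x ≤ descPot G sl X i := by
  have h1 : ∑ z ∈ Xᶜ, wt sl z = wt sl x + ∑ z ∈ (insert x X)ᶜ, wt sl z := by
    rw [Finset.compl_insert, Finset.add_sum_erase _ _ (Finset.mem_compl.2 hx)]
  have h2 := freeIn_le (X := insert x X) hl
  have h3 := freeIn_le (X := X) hl
  have h4 : 1 ≤ wt sl x := by unfold wt; omega
  unfold descPot
  omega

/-- `i` bounds the labels of the ready vertices. -/
def TopBound (G : Digraph (Fin n)) (X : Finset (Fin n)) (i : ℕ) : Prop :=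
  i ≤ n ∧ ∀ y, Ready G X y → lab G X y ≤ i

theorem toFinset_snoc : (xs ++ [x]).toFinset = insert x xs.toFinset := by
  ext z; simp [or_comm]

/-- Visiting a vertex at the end of the path. -/
theorem visitNext_wp (hG : IsMPDAG G) (hR : Room μ n) (hl : SuccList G sl) {σ₀ : St}
    (hI : Inv G sl xs σ₀) (hx : IsTop G xs.toFinset x) (hlt : xs.length < n) {as vs}
    (hf : Fr as vs σ₀ σ)
    (ha : ∀ id ∈ as, id ∈ [Arr.rlen, .rptr])
    (hv : ∀ x ∈ vs, x ∉ [Var.n, .L]) (hs : SameLow n xs.length σ₀ σ)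
    (hlev : LevOk G xs.toFinset x xs.length σ)
    (hvx : σ.v .x = x) (hi : ∀ y, Ready G xs.toFinset y → lab G xs.toFinset y ≤ σ.v .i)
    (hin : σ.v .i ≤ n) :
    wp μ (visit ;; .set .L (Ex.v .L + 1)) (KB * wt sl x + 10) (fun σ' =>
      Inv G sl (xs ++ [x]) σ' ∧ TopBound G (xs ++ [x]).toFinset (σ'.v .i) ∧
      Fr [.bkt, .blen, .pos, .lab, .blk, .time, .ord] [.b, .w, .y, .f, .j, .i, .L] σ σ' ∧
      σ'.v .i + freeIn G xs.toFinset ≤ σ.v .i + 1 + freeIn G (insert x xs.toFinset)) σ := by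
  have hL : σ.v .L = xs.length := (hf.var _ fun h => hv _ h (by simp)).trans hI.len
  have b1 := hR.small (j := xs.length) (by omega)
  have hS := hI.stat.fr hf (fun id h h' => by have := ha id h; simp at this h'; rcases this with rfl | rfl <;> simp at h')
    (fun x h h' => hv x h (by simp [h']))
  have hD : DynX G xs.toFinset σ := hI.dyn.fr hf fun id h h' => by
    have := ha id h; simp at this h'; rcases this with rfl | rfl <;> simp at h'
  refine wp_mono (wp_seq (k2 := 4) (wp_mono (visit_wp hR hG.loopless hl hS hx.1 hvx hL hlt hD hi)
    le_rfl ?_)) ?_ fun _ => id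
  · rintro σ1 ⟨h1, h2, h3, h4, h5, h6⟩
    have hL1 : σ1.v .L = xs.length := by rw [h2.var _ (by simp), hL]
    refine wp_set (x := .L) (e := Ex.v .L + 1) (by simp [hL1]; omega) ?_
    rw [show (Ex.v .L + 1).eval μ σ1 = xs.length + 1 by simp [hL1]]
    have hF2 : Fr [] [.L] σ1 (σ1.set .L (xs.length + 1)) := by simp
    have hi2 : (σ1.set .L (xs.length + 1)).v .i = σ1.v .i := by simp
    have hL2 : (σ1.set .L (xs.length + 1)).v .L = xs.length + 1 := by simp
    have ea : (σ1.set .L (xs.length + 1)).a = σ1.a := rfl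
    generalize σ1.set .L (xs.length + 1) = σ2 at *
    have hF : Fr [.bkt, .blen, .pos, .lab, .blk, .time, .ord] [.b, .w, .y, .f, .j, .i, .L] σ σ2 :=
      (h2.mono (by simp) (by simp)).sub hF2 (by simp) (by simp)
    have hb : σ1.v .i + freeIn G xs.toFinset ≤ σ.v .i + 1 + freeIn G (insert x xs.toFinset) := by
      rcases h6 with h6 | ⟨y, hy1, hy2⟩
      · have := freeIn_mono (G := G) (Finset.subset_insert x xs.toFinset)
        omega
      · rw [← hy2]
        exact lab_le_freeIn hx.1.1 hi hy1
    refine ⟨?_, ⟨?_, ?_⟩, hF, by rw [hi2]; exact hb⟩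
    · have hF0 : Fr ([Arr.bkt, .blen, .pos, .lab, .blk, .time, .ord] ++ as)
          ([Var.b, .w, .y, .f, .j, .i, .L] ++ vs) σ₀ σ2 :=
        (hf.mono (fun _ h => List.mem_append_right _ h) (fun _ h => List.mem_append_right _ h)).sub hF
          (fun _ h => List.mem_append_left _ h) (fun _ h => List.mem_append_left _ h)
      refine hI.snoc hx hF0 ?_ ?_ (hs.trans (SameLow.of_fr hF (by decide))) hL2 ?_ ?_ ?_ ?_
      · intro id h h'
        rw [List.mem_append] at h
        rcases h with h | h
        · revert h h'; cases id <;> simp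
        · have := ha id h; revert this h'; cases id <;> simp
      · rintro y h rfl
        rw [List.mem_append] at h
        rcases h with h | h
        · simp at h
        · exact hv _ h (by simp)
      · rw [ea, h4, hf.arr _ fun h => by simpa using ha _ h]
      · rw [ea, h3, hf.arr _ fun h => by simpa using ha _ h]
      · exact h1.fr hF2 (by simp)
      · exact (SameLow.of_fr (n := n) (L := xs.length + 1) hF (by decide)).levOk (by omega) hlev
    · rw [hi2]
      rcases h6 with h6 | ⟨y, hy1, hy2⟩
      · omega
      · rw [← hy2]; exact lab_le_size
    · rw [hi2, toFinset_snoc]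
      exact h5
  · unfold KB wt; omega

/-- The decrease of `i` in the scan and the weight of the chosen vertex are both taken from the
potential, with 1000 steps for each unit. -/
theorem descendBody_wp (hG : IsMPDAG G) (hR : Room μ n) (hl : SuccList G sl)
    (hI : Inv G sl xs σ) (hT : TopBound G xs.toFinset (σ.v .i)) (hlt : xs.length < n) {k : ℕ}
    (hk : 1000 * descPot G sl xs.toFinset (σ.v .i) + 1 ≤ k) :
    ∃ k1 k2, k1 + k2 + 3 ≤ k ∧ wp μ descendBody k1 (fun σ' => ∃ x, IsTop G xs.toFinset x ∧
      Inv G sl (xs ++ [x]) σ' ∧ TopBound G (xs ++ [x]).toFinset (σ'.v .i) ∧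
      Todo G (xs ++ [x]) σ' = Todo G xs σ ∧ σ'.out = σ.out ∧ σ'.a .last = σ.a .last ∧
      σ'.v .run = σ.v .run ∧
      1000 * descPot G sl (xs ++ [x]).toFinset (σ'.v .i) + 1 ≤ k2) σ := by
  obtain ⟨y0, hy0⟩ : ∃ y, y ∉ xs.toFinset := by
    by_contra hn
    push Not at hn
    have h1 : xs.toFinset = Finset.univ := Finset.eq_univ_iff_forall.2 hn
    have h2 := List.toFinset_card_of_nodup hI.mcs.nodup
    rw [h1, Finset.card_univ, Fintype.card_fin] at h2
    omega
  obtain ⟨x, hx, hb, hbk, h0⟩ := exists_top hG hI.dyn ⟨y0, hy0⟩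
  obtain ⟨hin, hi⟩ := hT
  have hli := hi x hx.1
  have hbl := (hI.dyn.lists.blen_le (lab_le_size (G := G) (X := xs.toFinset) (y := x))).trans
    (Finset.card_le_univ _)
  rw [Fintype.card_fin] at hbl
  have hw : 1 ≤ wt sl x := by unfold wt; omega
  have e1 : choose.cost ≤ 100 := by decide
  have hKB : KB * wt sl x = 400 * wt sl x := rfl
  have hpot : ∀ i', i' + freeIn G xs.toFinset ≤
      lab G xs.toFinset x + 1 + freeIn G (insert x xs.toFinset) →
      descPot G sl (insert x xs.toFinset) i' + wt sl x + (σ.v .i - lab G xs.toFinset x) ≤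
        descPot G sl xs.toFinset (σ.v .i) := by
    intro i' h
    have := descPot_insert hl hx.1.1 h
    unfold descPot at this ⊢
    omega
  set P := descPot G sl xs.toFinset (σ.v .i) with hP
  have h1 := hpot 0 (by have := freeIn_mono (G := G) (Finset.subset_insert x xs.toFinset); omega)
  refine ⟨(30 * (σ.v .i - lab G xs.toFinset x) + 20) + (choose.cost + (KB * wt sl x + 10)),
    k - 1000 * (wt sl x + (σ.v .i - lab G xs.toFinset x)), by omega, wp_seq (wp_mono
      (scan_wp hR hin hli hb fun l h1 h2 => h0 l (by omega) h1) le_rfl fun σ1 ⟨hF1, hi1⟩ =>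
      wp_seq (wp_mono (wp_of_vc _ (choose_vc (σ := σ1) (x := x) hR (hI.stat.fr hF1 (by decide) (by decide))
        ?_ ?_ ?_ ?_)) le_rfl ?_))⟩
  · rw [hF1.var _ (by simp), hI.len]; omega
  · rw [hi1]; exact lab_le_size
  · rw [hi1, hF1.arr _ (by simp)]; exact hbl
  · rw [hi1, hF1.arr _ (by simp), hF1.arr _ (by simp)]; exact hbk
  · rintro σ2 ⟨hx2, hF2, hr2⟩
    have hF : Fr [.rlen] [.x, .i] σ σ2 :=
      (hF1.mono (by simp) (by simp)).sub hF2 (by simp) (by simp)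
    have hi2 : σ2.v .i = lab G xs.toFinset x := by rw [hF2.var _ (by simp), hi1]
    have hL1 : σ1.v .L = xs.length := by rw [hF1.var _ (by simp), hI.len]
    rw [hL1, hF1.arr _ (by simp)] at hr2
    have hs : SameLow n xs.length σ σ2 :=
      ⟨fun j hj => by rw [hr2, Function.update_of_ne hj.ne], fun j _ => by rw [hF.arr _ (by simp)],
        fun i _ => by rw [hF.arr _ (by simp)]⟩
    -- The new level starts with its candidates uncollected, as `todo_snoc` requires.
    have h02 : σ2.a .rlen xs.length = 0 := by rw [hr2]; simp
    refine wp_mono (visitNext_wp hG hR hl hI hx hlt hF (by simp) (by simp) hs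
      (fun h => (h h02).elim) hx2 (fun y hy => hi2 ▸ hx.2 y hy) (hi2 ▸ lab_le_size)) le_rfl ?_
    rintro σ3 ⟨g1, g2, g3, g4⟩
    rw [hi2] at g4
    have hp := hpot _ g4
    refine ⟨x, hx, g1, g2, ?_, ?_, ?_, ?_, ?_⟩
    · rw [(SameLow.of_fr (n := n) (L := (xs ++ [x]).length) g3 (by decide)).todo le_rfl,
        todo_snoc hG hI.mcs hx h02, hs.todo le_rfl]
    · rw [g3.out, hF.out]
    · rw [g3.arr _ (by simp), hF.arr _ (by simp)]
    · rw [g3.var _ (by simp), hF.var _ (by simp)]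
    · rw [toFinset_snoc]; omega

theorem descend_wp (hG : IsMPDAG G) (hR : Room μ n) (hl : SuccList G sl)
    (hI : Inv G sl xs σ) (hT : TopBound G xs.toFinset (σ.v .i)) :
    wp μ descend (1000 * descPot G sl xs.toFinset (σ.v .i) + 10) (fun σ' => ∃ ys,
      ys.length = n ∧ Inv G sl ys σ' ∧ Todo G ys σ' = Todo G xs σ ∧ σ'.out = σ.out ∧
      σ'.a .last = σ.a .last ∧ σ'.v .run = σ.v .run) σ := by
  have ht : (Tst.lt (Ex.v .L) (Ex.v .n)).cost = 2 := rfl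
  refine wp_mono (wp_loop (t := .lt (Ex.v .L) (Ex.v .n)) (fun k σ' => ∃ ys, Inv G sl ys σ' ∧
    TopBound G ys.toFinset (σ'.v .i) ∧ Todo G ys σ' = Todo G xs σ ∧ σ'.out = σ.out ∧
    σ'.a .last = σ.a .last ∧ σ'.v .run = σ.v .run ∧
    1000 * descPot G sl ys.toFinset (σ'.v .i) + 1 ≤ k) ?_
    ⟨xs, hI, hT, rfl, rfl, rfl, rfl, le_rfl⟩)
    (by omega) fun _ => id
  rintro k σ1 ⟨ys, h1, h2, h3, h4, h4', h6, h5⟩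
  refine ⟨by simp, fun hh => ?_, fun hh => ?_⟩
  · simp only [Tst.Holds, Ex.eval, h1.len, h1.stat.size] at hh
    obtain ⟨k1, k2, hk, hw⟩ := descendBody_wp hG hR hl h1 h2 hh h5
    refine ⟨k1, k2, by omega, wp_mono hw le_rfl ?_⟩
    rintro σ2 ⟨x, -, g1, g2, g3, g4, g4', g6, g5⟩
    exact ⟨ys ++ [x], g1, g2, g3.trans h3, g4.trans h4, g4'.trans h4', g6.trans h6, g5⟩
  · simp only [Tst.Holds, Ex.eval, h1.len, h1.stat.size] at hh
    have := h1.length_le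
    exact ⟨by omega, ys, by omega, h1, h3, h4, h4', h6⟩

end WordRAM

/-! ### Candidates as classes -/

namespace CausalGraph

/-- Candidates share the label of `v`, so `a` may replace `v` as the vertex of reference. -/
theorem Cand.trans {V : Type*} {G : Digraph V} {X : Finset V} {v a z : V} (hv : Ready G X v)
    (h : Cand G X v a) (h' : Cand G X a z) : Cand G X v z := by
  unfold Cand at h'
  rw [(h.ready hv).2] at h'
  exact Relation.ReflTransGen.trans h h'

/-- With transitivity this lets the list collected from one candidate serve for every branch taken
at that level. -/
theorem Cand.symm {V : Type*} {G : Digraph V} {X : Finset V} {v a : V} (hv : Ready G X v)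
    (h : Cand G X v a) : Cand G X a v := by
  induction h with
  | refl => exact .refl
  | @tail b c h1 h2 ih =>
    have h3 : Cand G X v b := h1
    obtain ⟨h4, h5⟩ := h3.ready hv
    exact Cand.trans h2.2.1 (.single ⟨h2.1.symm, h4, h5.trans h2.2.2.symm⟩) ih

end CausalGraph

/-! ### The ascent to the last level with a pending branch -/

namespace WordRAM

open CausalGraph

variable {n : ℕ} {μ : Mach} {G D : Digraph (Fin n)} {sl : Fin n → List (Fin n × ℕ)} {σ σ' : St}
  {X : Finset (Fin n)} {x y : Fin n} {L : ℕ} {xs : List (Fin n)}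

/-! ### Returning to the last level with a branch to take -/

theorem mem_remSet {rl : List (Fin n)} (hn : rl.Nodup) (h0 : σ.a .rlen L ≠ 0)
    (h1 : σ.a .rlen L = rl.length)
    (h2 : ∀ (h : ℕ) (hh : h < rl.length), σ.a .rlist (L * n + h) = rl[h]) :
    y ∈ remSet G X x L σ ↔ y ∈ rl.drop (σ.a .rptr L) := by
  have hl : rl.length ≤ n := by simpa using hn.length_le_card
  simp only [remSet, Set.mem_ofPred_eq, if_neg h0]
  rw [List.mem_drop_iff_getElem]
  constructor
  · rintro ⟨k, -, hk1, hk2, hk3⟩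
    rw [h1] at hk2
    rw [h2 k hk2, Fin.val_inj] at hk3
    exact ⟨k - σ.a .rptr L, by omega, by rw [← hk3]; congr 1; omega⟩
  · rintro ⟨k, hk, rfl⟩
    exact ⟨σ.a .rptr L + k, by omega, by omega, by omega, h2 _ (by omega)⟩

theorem mem_remSet_of_rlen_eq_zero (h0 : σ.a .rlen L = 0) :
    y ∈ remSet G X x L σ ↔ Cand G X x y ∧ y ≠ x := by
  simp [remSet, h0]

/-- Collect the candidates of level `L` unless this has been done. -/
def fill : Cmd := .ite (.eq (Ex.a .rlen (Ex.v .L)) 0) collect .skip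

/-- Pending branches are the same before and after; only their representation changes from an
implicit one to the stored list. The price of collecting is due only if the list is not there yet,
which is why `hk` is conditional. -/
theorem fill_wp (hR : Room μ n) (hl : SuccList G sl) (hS : Stat G sl σ)
    (hD : DynX G X σ) (hx : Ready G X x) (hvx : σ.v .x = x) (hvL : σ.v .L = L) (hL : L ≤ n)
    (hmark : ∀ z : Fin n, σ.a .mark z = 0) (hlev : LevOk G X x L σ) {k : ℕ}
    (hk : σ.a .rlen L = 0 → 3 * KB * ∑ z ∈ candSet G X x, wt sl z ≤ k) :
    wp μ fill (k + 20) (fun σ' => Fr [.rlist, .mark, .rlen, .rptr] [.p, .len, .h, .w, .j, .y] σ σ' ∧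
      SameLow n L σ σ' ∧ LevOk G X x L σ' ∧ σ'.a .rlen L ≠ 0 ∧ remSet G X x L σ' = remSet G X x L σ ∧
      ∀ z : Fin n, σ'.a .mark z = 0) σ := by
  have b1 := hR.small (j := L) (by omega)
  have ht : (Tst.eq (Ex.a .rlen (Ex.v .L)) 0).cost = 11 := rfl
  refine wp_mono (wp_ite (k := k + 1) (by simp [hvL]; omega) (fun hh => ?_) (fun hh => ?_))
    (by omega) fun _ => id
  · simp only [Tst.Holds, Ex.eval, hvL, Ex.eval_ofNat] at hh
    refine wp_mono (collect_wp hR hl hS hD hx hvx hvL hL hmark) ((hk hh).trans (by omega)) ?_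
    rintro σ1 ⟨rl, h1, ⟨t, h2⟩, h3, h4, h5, h6, h7, h8, h9⟩
    have hlen : σ1.a .rlen L = rl.length := by rw [h6]; simp
    have hptr : σ1.a .rptr L = 1 := by rw [h7]; simp
    have hne : σ1.a .rlen L ≠ 0 := by rw [hlen, h2]; simp
    have hxt : x ∉ t := by rw [h2] at h1; exact (List.nodup_cons.1 h1).1
    refine ⟨h9, ⟨fun j hj => by rw [h6, Function.update_of_ne hj.ne],
      fun j hj => by rw [h7, Function.update_of_ne hj.ne], h5⟩, fun _ => ⟨rl, h1, hlen, h4,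
      fun z => (h3 z).1, ?_⟩, hne, ?_, h8⟩
    · rw [hptr, h2]; simpa using hxt
    · ext y
      rw [mem_remSet h1 hne hlen h4, mem_remSet_of_rlen_eq_zero hh, ← h3, hptr, h2]
      simp only [List.drop_succ_cons, List.drop_zero, List.mem_cons]
      constructor
      · intro h; exact ⟨Or.inr h, by rintro rfl; exact hxt h⟩
      · rintro ⟨h | h, h'⟩
        · exact absurd h h'
        · exact h
  · simp only [Tst.Holds, Ex.eval, hvL, Ex.eval_ofNat] at hh
    exact wp_mono (wp_skip ⟨.refl _ _ _, ⟨fun _ _ => rfl, fun _ _ => rfl, fun _ _ => rfl⟩, hlev, hh,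
      rfl, hmark⟩) (by omega) fun _ => id

/-- Take the vertex in `x` off the path. -/
def pop : Cmd := .set .L (Ex.v .L - 1) ;; .set .x (Ex.a .ord (Ex.v .L)) ;; unvisit

def branchHead : Cmd :=
  .set .x (Ex.a .rlist (Ex.a .row (Ex.v .L) + Ex.a .rptr (Ex.v .L))) ;;
  .sto .rptr (Ex.v .L) (Ex.a .rptr (Ex.v .L) + 1) ;;
  .set .i (Ex.a .lab (Ex.v .x))

/-- Take the next branch of level `L`. -/
def branch : Cmd := branchHead ;; (visit ;; .set .L (Ex.v .L + 1)) ;; .set .run (Ex.v .n)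

def ascendBody : Cmd :=
  pop ;; fill ;; .ite (.lt (Ex.a .rptr (Ex.v .L)) (Ex.a .rlen (Ex.v .L))) branch .skip

/-- Return to the last level with a branch to take, and take it. -/
def ascend : Cmd := .loop (.lt (Ex.v .run) (Ex.v .L)) ascendBody

theorem pop_wp (hG : IsMPDAG G) (hR : Room μ n) (hl : SuccList G sl)
    (hI : Inv G sl (xs ++ [x]) σ) : wp μ pop (KB * wt sl x + 30) (fun σ' => Inv G sl xs σ' ∧
      σ'.v .x = x ∧ LevOk G xs.toFinset x xs.length σ' ∧
      Fr [.bkt, .blen, .pos, .lab, .blk] [.b, .w, .y, .f, .j, .L, .x] σ σ') σ := by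
  have hlen : σ.v .L = xs.length + 1 := by simpa using hI.len
  have hle : xs.length < n := by simpa using hI.length_le
  have hord : σ.a .ord xs.length = x := by simpa using hI.ord xs.length (by simp)
  obtain ⟨hxs, hx⟩ := hI.mcs.of_snoc
  have b1 := hR.small (j := xs.length) (by omega)
  have h1 : wp μ (.set .L (Ex.v .L - 1)) 4 (fun σ' => σ' = σ.set .L xs.length) σ := by
    refine wp_of_vc (.set .L (Ex.v .L - 1)) ?_
    simp [hlen]; omega
  have h2 : wp μ (.set .x (Ex.a .ord (Ex.v .L))) 11
      (fun σ' => σ' = (σ.set .L xs.length).set .x x) (σ.set .L xs.length) := by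
    refine wp_of_vc (.set .x (Ex.a .ord (Ex.v .L))) ?_
    simp [hord]; omega
  refine wp_mono (wp_seq (wp_mono h1 le_rfl ?_)) (le_of_eq_of_le (b := 4 + (11 + KB * wt sl x)) rfl (by omega)) fun _ => id
  rintro _ rfl
  refine wp_seq (wp_mono h2 le_rfl ?_)
  rintro _ rfl
  have hF : Fr [] [.L, .x] σ ((σ.set .L xs.length).set .x x) := by simp
  have hvx : ((σ.set .L xs.length).set .x x).v .x = x := by simp
  have hvL : ((σ.set .L xs.length).set .x x).v .L = xs.length := by simp
  generalize (σ.set .L xs.length).set .x x = σ1 at *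
  have hD := hI.dyn
  rw [toFinset_snoc] at hD
  refine wp_mono (unvisit_wp hR hG.loopless hl (hI.stat.fr hF (by decide) (by decide)) hx.1 hvx
    (hD.fr hF (by simp))) le_rfl ?_
  rintro σ2 ⟨hD2, hF2⟩
  have hF' : Fr [.bkt, .blen, .pos, .lab, .blk] [.b, .w, .y, .f, .j, .L, .x] σ σ2 :=
    (hF.mono (by simp) (by simp)).sub hF2 (by simp) (by simp)
  have hs : SameLow n (xs.length + 1) σ σ2 := .of_fr hF' (by decide)
  refine ⟨⟨hI.stat.fr hF' (by decide) (by decide), hxs, by rw [hF2.var _ (by simp), hvL], ?_, ?_,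
    hD2, by rw [hF'.arr _ (by simp)]; exact hI.mark, ?_⟩, by rw [hF2.var _ (by simp), hvx], ?_, hF'⟩
  · intro j hj
    rw [hF'.arr _ (by simp), hI.ord j (by simp; omega), List.getElem_append_left hj]
  · intro j hj
    have := hI.time j (by simp; omega)
    rw [List.getElem_append_left hj] at this
    rw [hF'.arr _ (by simp), this]
  · intro j hj
    have := hs.levOk (by omega) (hI.lev j (by simp; omega))
    rwa [List.take_append_of_le_length hj.le, List.getElem_append_left hj] at this
  · have := hs.levOk (by omega) (hI.lev xs.length (by simp))
    simpa using this

theorem Inv.fill (hI : Inv G sl xs σ) {vs}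
    (hF : Fr [.rlist, .mark, .rlen, .rptr] vs σ σ') (hv : ∀ x ∈ vs, x ∉ [Var.n, .L])
    (hs : SameLow n xs.length σ σ') (hm : ∀ z : Fin n, σ'.a .mark z = 0) : Inv G sl xs σ' where
  stat := hI.stat.fr hF (by decide) fun x hx h => hv x hx (by simp [h])
  mcs := hI.mcs
  len := by rw [hF.var _ fun h => hv _ h (by simp)]; exact hI.len
  ord := by rw [hF.arr _ (by simp)]; exact hI.ord
  time := by rw [hF.arr _ (by simp)]; exact hI.time
  dyn := hI.dyn.fr hF (by simp)
  mark := hm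
  lev := fun j hj => hs.levOk hj (hI.lev j hj)

/-- The pointer moves past `y` before `y` is visited, so the pending branches split into the new
path and the rest of the row. Setting `run` to `n`, which no level exceeds, ends the loop of
`ascend`. -/
theorem branch_wp (hG : IsMPDAG G) (hR : Room μ n) (hl : SuccList G sl) (hI : Inv G sl xs σ)
    (hx : IsTop G xs.toFinset x) (hL : xs.length < n)
    (hlev : LevOk G xs.toFinset x xs.length σ)
    (hlt : σ.a .rptr xs.length < σ.a .rlen xs.length) :
    wp μ branch (KB * ∑ z, wt sl z + 100) (fun σ' => ∃ ys, Inv G sl ys σ' ∧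
      TopBound G ys.toFinset (σ'.v .i) ∧ σ'.v .run = n ∧ σ'.out = σ.out ∧
      Todo G ys σ' = {D | Pending G xs (remAll G xs σ) D ∨
        ∃ y ∈ remSet G xs.toFinset x xs.length σ, InExt G (xs ++ [y]) D}) σ := by
  obtain ⟨rl, h1, h2, h3, h4, h5⟩ := hlev (by omega)
  have hrn : rl.length ≤ n := by simpa using h1.length_le_card
  set p := σ.a .rptr xs.length with hp
  have hpl : p < rl.length := by omega
  set y := rl[p] with hy
  have hcy : Cand G xs.toFinset x y := h4 _ (List.getElem_mem _)
  have hyt := hcy.isTop hx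
  have b1 := hR.small (j := xs.length) (by omega)
  have b2 := hR.idx hL.le (j := p) (by omega)
  have b3 := hR.small (j := p) (by omega)
  have b4 := hR.small (j := y) (by have := y.isLt; omega)
  have hrow := hI.stat.row xs.length hL.le
  have hrl := h3 p hpl
  have hw : wt sl y ≤ ∑ z, wt sl z := Finset.single_le_sum (fun _ _ => Nat.zero_le _)
    (Finset.mem_univ y)
  have hhead : wp μ branchHead branchHead.cost (fun σ' => Fr [.rptr] [.x, .i] σ σ' ∧ σ'.v .x = y ∧
      σ'.v .i = lab G xs.toFinset y ∧ σ'.a .rptr = Function.update (σ.a .rptr) xs.length (p + 1)) σ := by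
    refine wp_of_vc _ ?_
    simp [branchHead, hI.len, hrow, ← hp, hrl, hI.dyn.lab, ← hy]
    omega
  have e1 : branchHead.cost ≤ 80 := by decide
  refine wp_mono (wp_seq (wp_mono hhead le_rfl ?_))
    (k := branchHead.cost + ((KB * wt sl y + 10) + 2)) (by unfold KB; omega) fun _ => id
  rintro σ1 ⟨hF1, hx1, hi1, hr1⟩
  have hs1 : SameLow n xs.length σ σ1 := ⟨fun j _ => by rw [hF1.arr _ (by simp)],
    fun j hj => by rw [hr1, Function.update_of_ne hj.ne], fun i _ => by rw [hF1.arr _ (by simp)]⟩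
  have hp1 : σ1.a .rptr xs.length = p + 1 := by rw [hr1]; simp
  have hl1 : σ1.a .rlen xs.length = rl.length := by rw [hF1.arr _ (by simp), h2]
  have hrl1 : ∀ (h : ℕ) (hh : h < rl.length), σ1.a .rlist (xs.length * n + h) = rl[h] := by
    rw [hF1.arr _ (by simp)]; exact h3
  have hd : rl.drop p = y :: rl.drop (p + 1) := List.drop_eq_getElem_cons hpl
  have hnd : (rl.drop p).Nodup := h1.sublist (List.drop_sublist _ _)
  rw [hd, List.nodup_cons] at hnd
  -- The row was collected for `x`; it is valid for `y` since both lie in one class of candidates,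
  -- and `y` does not recur behind the pointer because the list has no repetitions.
  have hlev1 : LevOk G xs.toFinset y xs.length σ1 := fun _ => ⟨rl, h1, hl1, hrl1,
    fun z hz => Cand.trans hyt.1 (hcy.symm hx.1) (h4 z hz), by rw [hp1]; exact hnd.1⟩
  refine wp_seq (wp_mono (visitNext_wp hG hR hl hI hyt hL hF1 (by simp) (by simp) hs1 hlev1 hx1
    (fun z hz => hi1 ▸ hyt.2 z hz) (hi1 ▸ lab_le_size)) le_rfl ?_)
  rintro σ2 ⟨g1, g2, g3, -⟩
  refine wp_set (x := .run) (e := Ex.v .n) trivial ?_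
  rw [show (Ex.v .n).eval μ σ2 = n from g1.stat.size]
  have hF3 : Fr [] [.run] σ2 (σ2.set .run n) := by simp
  refine ⟨xs ++ [y], g1.fr hF3 (by simp) (by simp), by simpa using g2, by simp, ?_, ?_⟩
  · rw [hF3.out, g3.out, hF1.out]
  · rw [(SameLow.of_fr (n := n) (L := (xs ++ [y]).length) hF3 (by simp)).todo le_rfl,
      (SameLow.of_fr (n := n) (L := (xs ++ [y]).length) g3 (by simp)).todo le_rfl]
    ext D
    simp only [Todo, Set.mem_ofPred_eq, pending_remAll_snoc, hs1.pending le_rfl]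
    simp only [mem_remSet h1 (by omega : σ.a .rlen xs.length ≠ 0) h2 h3,
      mem_remSet h1 (by omega : σ1.a .rlen xs.length ≠ 0) hl1 hrl1, hp1, ← hp, hd, List.mem_cons]
    constructor
    · rintro (h | h | ⟨z, hz, h⟩)
      · exact Or.inr ⟨y, Or.inl rfl, h⟩
      · exact Or.inl h
      · exact Or.inr ⟨z, Or.inr hz, h⟩
    · rintro (h | ⟨z, rfl | hz, h⟩)
      · exact Or.inr (Or.inl h)
      · exact Or.inl h
      · exact Or.inr (Or.inr ⟨z, hz, h⟩)

/-- The common part of returning to a level. -/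
theorem popFill_wp (hG : IsMPDAG G) (hR : Room μ n) (hl : SuccList G sl)
    (hI : Inv G sl (xs ++ [x]) σ) {k k' : ℕ} {Q : St → Prop} {c : Cmd}
    (hk : σ.a .rlen xs.length = 0 → 3 * KB * ∑ z ∈ candSet G xs.toFinset x, wt sl z ≤ k)
    (hc : ∀ σ', Inv G sl xs σ' → LevOk G xs.toFinset x xs.length σ' → σ'.a .rlen xs.length ≠ 0 →
      remSet G xs.toFinset x xs.length σ' = remSet G xs.toFinset x xs.length σ →
      SameLow n xs.length σ σ' → σ'.out = σ.out → σ'.v .run = σ.v .run → wp μ c k' Q σ') :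
    wp μ (pop ;; fill ;; c) (KB * wt sl x + 30 + (k + 20 + k')) Q σ := by
  obtain ⟨hxs, hx⟩ := hI.mcs.of_snoc
  have hle : xs.length < n := by simpa using hI.length_le
  refine wp_seq (wp_mono (pop_wp hG hR hl hI) le_rfl ?_)
  rintro σ1 ⟨hI1, hx1, hlev1, hF1⟩
  have hs1 : SameLow n (xs.length + 1) σ σ1 := .of_fr hF1 (by decide)
  refine wp_seq (wp_mono (fill_wp (k := k) hR hl hI1.stat hI1.dyn hx.1 hx1 hI1.len hle.le hI1.mark
    hlev1 (by rwa [hs1.rlen _ (by omega)])) le_rfl ?_)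
  rintro σ2 ⟨hF2, hs2, hlev2, hne2, hrem2, hm2⟩
  refine hc σ2 (hI1.fill hF2 (by simp) hs2 hm2) hlev2 hne2 ?_ ((hs1.mono (by omega)).trans hs2) ?_ ?_
  · rw [hrem2, hs1.remSet (by omega)]
  · rw [hF2.out, hF1.out]
  · rw [hF2.var _ (by simp), hF1.var _ (by simp)]

/-- Without a pending branch, an uncollected level has `x` as its only candidate, so collecting
costs a multiple of the weight of `x`, like undoing the visit. This keeps the whole ascent linear.
-/
theorem ascendBody_wp_of_empty (hG : IsMPDAG G) (hR : Room μ n) (hl : SuccList G sl)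
    (hI : Inv G sl (xs ++ [x]) σ) (hrem : ∀ y, y ∉ remSet G xs.toFinset x xs.length σ) :
    wp μ ascendBody (4 * KB * wt sl x + 100) (fun σ' => Inv G sl xs σ' ∧
      SameLow n xs.length σ σ' ∧ σ'.out = σ.out ∧ σ'.v .run = σ.v .run) σ := by
  have hle : xs.length < n := by simpa using hI.length_le
  have b1 := hR.small (j := xs.length) (by omega)
  have ht : (Tst.lt (Ex.a .rptr (Ex.v .L)) (Ex.a .rlen (Ex.v .L))).cost = 20 := rfl
  refine wp_mono (popFill_wp (k := 3 * KB * wt sl x) (k' := 22) hG hR hl hI ?_ ?_)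
    (by unfold KB; omega) fun _ => id
  · intro h0
    refine Nat.mul_le_mul_left _ ?_
    refine (Finset.sum_le_sum_of_subset (t := {x}) fun z hz => ?_).trans_eq (Finset.sum_singleton _ _)
    rw [mem_candSet] at hz
    by_contra hne
    rw [Finset.mem_singleton] at hne
    exact hrem z ((mem_remSet_of_rlen_eq_zero h0).2 ⟨hz, hne⟩)
  · intro σ1 hI1 hlev hne hr hs ho hrun
    refine wp_mono (wp_ite (k := 1) (by simp [hI1.len]; omega) (fun hh => ?_) (fun hh =>
      wp_skip ⟨hI1, hs, ho, hrun⟩)) (by omega) fun _ => id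
    simp only [Tst.Holds, Ex.eval, hI1.len] at hh
    obtain ⟨rl, h1, h2, h3, h4, h5⟩ := hlev hne
    exfalso
    have : rl[σ1.a .rptr xs.length] ∈ remSet G xs.toFinset x xs.length σ1 := by
      rw [mem_remSet h1 hne h2 h3, List.mem_drop_iff_getElem]
      exact ⟨0, by omega, by simp⟩
    rw [hr] at this
    exact hrem _ this

/-- Collecting may scan the whole graph here, but this round ends the ascent, so it happens at most
once between two leaves. -/
theorem ascendBody_wp_of_mem (hG : IsMPDAG G) (hR : Room μ n) (hl : SuccList G sl)
    (hI : Inv G sl (xs ++ [x]) σ) (hrem : y ∈ remSet G xs.toFinset x xs.length σ) :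
    wp μ ascendBody (5 * KB * ∑ z, wt sl z + 200) (fun σ' => ∃ ys, Inv G sl ys σ' ∧
      TopBound G ys.toFinset (σ'.v .i) ∧ σ'.v .run = n ∧ σ'.out = σ.out ∧
      Todo G ys σ' = {D | Pending G (xs ++ [x]) (remAll G (xs ++ [x]) σ) D}) σ := by
  have hle : xs.length < n := by simpa using hI.length_le
  have b1 := hR.small (j := xs.length) (by omega)
  have ht : (Tst.lt (Ex.a .rptr (Ex.v .L)) (Ex.a .rlen (Ex.v .L))).cost = 20 := rfl
  have hw : wt sl x ≤ ∑ z, wt sl z := Finset.single_le_sum (fun _ _ => Nat.zero_le _)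
    (Finset.mem_univ x)
  refine wp_mono (popFill_wp (k := 3 * KB * ∑ z, wt sl z)
    (k' := 21 + (KB * ∑ z, wt sl z + 100)) hG hR hl hI ?_ ?_)
    (by unfold KB; omega) fun _ => id
  · intro h0
    exact Nat.mul_le_mul_left _ (Finset.sum_le_sum_of_subset (Finset.subset_univ _))
  · intro σ1 hI1 hlev hne hr hs ho hrun
    refine wp_mono (wp_ite (k := KB * ∑ z, wt sl z + 100) (by simp [hI1.len]; omega)
      (fun hh => ?_) (fun hh => ?_)) (by omega) fun _ => id
    · simp only [Tst.Holds, Ex.eval, hI1.len] at hh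
      refine wp_mono (branch_wp hG hR hl hI1 hI.mcs.of_snoc.2 hle hlev hh) le_rfl ?_
      rintro σ2 ⟨ys, g1, g2, g3, g4, g5⟩
      refine ⟨ys, g1, g2, g3, g4.trans ho, g5.trans ?_⟩
      ext D
      simp only [Set.mem_ofPred_eq, pending_remAll_snoc, hr, hs.pending le_rfl]
    · simp only [Tst.Holds, Ex.eval, hI1.len] at hh
      exfalso
      obtain ⟨rl, h1, h2, h3, h4, h5⟩ := hlev hne
      rw [← hr, mem_remSet h1 hne h2 h3, List.mem_drop_iff_getElem] at hrem
      obtain ⟨k, hk, -⟩ := hrem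
      omega

theorem ascend_wp (hG : IsMPDAG G) (hR : Room μ n) (hl : SuccList G sl)
    (hI : Inv G sl xs σ) (hrun : σ.v .run = 0) :
    wp μ ascend (10 * KB * ∑ z, wt sl z + 300) (fun σ' => σ'.out = σ.out ∧
      ((σ'.v .run = 0 ∧ ∀ D, ¬ Pending G xs (remAll G xs σ) D) ∨
        0 < n ∧ σ'.v .run = n ∧ ∃ ys, Inv G sl ys σ' ∧ TopBound G ys.toFinset (σ'.v .i) ∧
          Todo G ys σ' = {D | Pending G xs (remAll G xs σ) D})) σ := by
  set S := ∑ z, wt sl z with hS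
  have ht : (Tst.lt (Ex.v .run) (Ex.v .L)).cost = 2 := rfl
  have hsum : ((xs.map (wt sl)).sum) ≤ S := sum_wt_le hI.mcs.nodup fun z _ => Finset.mem_univ z
  -- Either no branch has been taken, and the budget holds `5 * KB` per unit of weight on the
  -- remaining path plus the price of one branching round, or a branch has been taken and only the
  -- final test is due.
  refine wp_mono (wp_loop (t := .lt (Ex.v .run) (Ex.v .L)) (fun k σ' => ∃ ys, Inv G sl ys σ' ∧
    σ'.out = σ.out ∧
    ((σ'.v .run = 0 ∧ (∀ D, Pending G ys (remAll G ys σ') D ↔ Pending G xs (remAll G xs σ) D) ∧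
      5 * KB * (ys.map (wt sl)).sum + (5 * KB * S + 204) ≤ k) ∨
     (0 < n ∧ σ'.v .run = n ∧ TopBound G ys.toFinset (σ'.v .i) ∧
      Todo G ys σ' = {D | Pending G xs (remAll G xs σ) D} ∧ 1 ≤ k))) ?_
    (k := 5 * KB * (xs.map (wt sl)).sum + (5 * KB * S + 204))
    ⟨xs, hI, rfl, Or.inl ⟨hrun, fun _ => Iff.rfl, le_rfl⟩⟩)
    (by have := Nat.mul_le_mul_left (5 * KB) hsum; unfold KB at *; omega) fun _ => id
  rintro k σ1 ⟨ys, h1, h2, h3⟩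
  refine ⟨by simp, fun hh => ?_, fun hh => ?_⟩
  · simp only [Tst.Holds, Ex.eval, h1.len] at hh
    rcases h3 with ⟨h3, h4, h5⟩ | ⟨-, h3, -⟩
    · rcases List.eq_nil_or_concat ys with rfl | ⟨zs, x, hys⟩
      · simp at hh
      · rw [List.concat_eq_append] at hys
        subst hys
        by_cases he : ∃ y, y ∈ remSet G zs.toFinset x zs.length σ1
        · obtain ⟨y, hy⟩ := he
          refine ⟨_, 1, ?_, wp_mono (ascendBody_wp_of_mem hG hR hl h1 hy) le_rfl ?_⟩
          · rw [← hS]; omega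
          · rintro σ2 ⟨us, g1, g2, g3, g4, g5⟩
            refine ⟨us, g1, g4.trans h2, Or.inr ⟨?_, g3, g2, g5.trans ?_, le_rfl⟩⟩
            · have := h1.length_le; simp at this; omega
            · ext D; exact h4 D
        · push Not at he
          refine ⟨_, k - (4 * KB * wt sl x + 103), ?_, wp_mono (ascendBody_wp_of_empty hG hR hl h1 he)
            le_rfl ?_⟩
          · simp only [List.map_append, List.sum_append, List.map_cons, List.map_nil,
              List.sum_cons, List.sum_nil] at h5
            unfold KB at *
            omega
          · rintro σ2 ⟨g1, g2, g3, g4⟩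
            refine ⟨zs, g1, g3.trans h2, Or.inl ⟨g4.trans h3, fun D => ?_, ?_⟩⟩
            · rw [← h4, pending_remAll_snoc, g2.pending le_rfl]
              constructor
              · exact Or.inl
              · rintro (h | ⟨y, hy, -⟩)
                · exact h
                · exact absurd hy (he y)
            · have hw : 1 ≤ wt sl x := by unfold wt; omega
              simp only [List.map_append, List.sum_append, List.map_cons, List.map_nil,
                List.sum_cons, List.sum_nil] at h5
              unfold KB at *
              omega
    · have := h1.length_le; omega
  · simp only [Tst.Holds, Ex.eval, h1.len] at hh
    rcases h3 with ⟨h3, h4, h5⟩ | ⟨h0, h3, h4, h5, h6⟩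
    · refine ⟨by omega, h2, Or.inl ⟨h3, fun D hD => ?_⟩⟩
      obtain rfl : ys = [] := List.length_eq_zero_iff.1 (by omega)
      exact not_pending_nil ((h4 D).2 hD)
    · exact ⟨h6, h2, Or.inr ⟨h0, h3, ys, h1, h4, h5⟩⟩

end WordRAM

/-! ### Loops over the input and writing an extension -/

namespace WordRAM

open CausalGraph

variable {n : ℕ} {μ : Mach} {G D : Digraph (Fin n)} {sl : Fin n → List (Fin n × ℕ)} {σ σ' : St}
  {X : Finset (Fin n)} {x y : Fin n} {L : ℕ} {xs : List (Fin n)}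
  {es dirE undE : List (Fin n × Fin n)}

/-! ### Loops over the edges of the input -/

/-- The input words from position `s` on list the edges `es`. -/
structure EdgesAt (μ : Mach) (s : ℕ) (es : List (Fin n × Fin n)) : Prop where
  le : s + 2 * es.length ≤ μ.B
  fst : ∀ (i : ℕ) (hi : i < es.length), μ.inp (s + 2 * i) = es[i].1
  snd : ∀ (i : ℕ) (hi : i < es.length), μ.inp (s + 2 * i + 1) = es[i].2

def edgeHead : Cmd := .set .x (Ex.inp (Ex.v .j)) ;; .set .y (Ex.inp (Ex.v .j + 1))

def edgeTail : Cmd := .set .j (Ex.v .j + 2) ;; .set .h (Ex.v .h + 1)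

/-- Run `c` for every one of the `inp k` edges that are listed from position `j` on. -/
def edgeLoop (k : ℕ) (c : Cmd) : Cmd :=
  .set .h 0 ;; .loop (.lt (Ex.v .h) (Ex.inp (Ex.c k))) (edgeHead ;; c ;; edgeTail)

/-- The counter `h` runs over the edges and `j` over the input positions, two per edge. The
invariant has to survive changes of the variables used by the loop itself, which is the condition
`hJ`. -/
theorem edgeLoop_wp (hB : 64 + μ.B ≤ μ.lim) {s k K : ℕ} (hk : k < 3) (he : EdgesAt μ s es)
    (hs : 3 ≤ s) (hc : μ.inp k = es.length) {c : Cmd} (J : ℕ → St → Prop)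
    (hJ : ∀ i σ σ', J i σ → Fr [] [.x, .y, .j, .h] σ σ' → J i σ')
    (hstep : ∀ (i : ℕ) (hi : i < es.length) (σ : St), J i σ → σ.v .x = es[i].1 →
      σ.v .y = es[i].2 →
      wp μ c K (fun σ' => J (i + 1) σ' ∧ σ'.v .h = σ.v .h ∧ σ'.v .j = σ.v .j) σ)
    (h0 : J 0 σ) (hj : σ.v .j = s) :
    wp μ (edgeLoop k c) (20 + es.length * (K + 40)) (fun σ' => J es.length σ' ∧
      σ'.v .j = s + 2 * es.length) σ := by
  have hle := he.le
  have h1 : wp μ (.set .h 0) 2 (fun σ' => σ'.v .h = 0 ∧ J 0 σ' ∧ σ'.v .j = s + 2 * 0) σ := by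
    refine wp_set (x := .h) (e := 0) (by simp; omega) ⟨by simp, hJ 0 σ _ h0 (by simp), by simp [hj]⟩
  have e1 : edgeHead.cost ≤ 14 := by decide
  have e2 : edgeTail.cost ≤ 10 := by decide
  have hec : (Ex.inp (Ex.c k)).cost = 2 := rfl
  refine wp_mono (wp_seq (wp_mono h1 le_rfl fun σ1 hσ1 => wp_for (e := Ex.inp (Ex.c k))
    (k := edgeHead.cost + (K + edgeTail.cost)) (fun i σ' => σ'.v .h = i ∧ J i σ' ∧
      σ'.v .j = s + 2 * i) ?_ ?_ hσ1)) ?_ fun σ' h => h.2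
  · rintro i hi σ2 ⟨h2, -, -⟩
    exact ⟨h2, by simp; omega, hc⟩
  · rintro i hi σ2 ⟨h2, h3, h4⟩
    have hA : wp μ edgeHead edgeHead.cost (fun σ' => J i σ' ∧ σ'.v .h = i ∧ σ'.v .j = s + 2 * i ∧
        σ'.v .x = es[i].1 ∧ σ'.v .y = es[i].2) σ2 := by
      refine wp_of_vc _ ?_
      simp [edgeHead, h4, he.fst i hi, he.snd i hi, h2]
      repeat refine And.intro (by omega) ?_
      exact hJ i σ2 _ h3 (by simp)
    refine wp_seq (wp_mono hA le_rfl ?_)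
    rintro σ3 ⟨g1, g2, g3, g4, g5⟩
    refine wp_seq (wp_mono (hstep i hi σ3 g1 g4 g5) le_rfl ?_)
    rintro σ4 ⟨f1, f2, f3⟩
    refine wp_of_vc _ ?_
    simp [edgeTail, f2, f3, g2, g3]
    refine ⟨by omega, by omega, hJ _ σ4 _ f1 (by simp), by omega⟩
  · have := Nat.mul_le_mul_left es.length
      (show edgeHead.cost + (K + edgeTail.cost) + 2 + 2 ≤ K + 40 by omega)
    simp only [hec]
    omega

/-! ### Writing an extension -/

/-- The machine got from `σ` to `σ'` by writing `ws`. -/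
structure Wrote (ws : List ℕ) (σ σ' : St) : Prop where
  a : σ'.a = σ.a
  v : ∀ x, x ∉ [Var.x, .y, .j, .h] → σ'.v x = σ.v x
  out : σ'.out = σ.out ++ ws

theorem Wrote.fr {ws : List ℕ} {σ'' : St} (h : Wrote ws σ σ')
    (hf : Fr [] [.x, .y, .j, .h] σ' σ'') : Wrote ws σ σ'' :=
  ⟨by rw [← h.a]; exact funext fun id => hf.arr id (by simp),
    fun x hx => (hf.var x hx).trans (h.v x hx), hf.out.trans h.out⟩

def writeXY : Cmd := .write (Ex.v .x) ;; .write (Ex.v .y)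

/-- Write the edge between `x` and `y`, starting with the endpoint that was visited first. -/
def writeOriented : Cmd :=
  .ite (.lt (Ex.a .time (Ex.v .x)) (Ex.a .time (Ex.v .y))) writeXY
    (.write (Ex.v .y) ;; .write (Ex.v .x))

/-- Write the extension that belongs to the order of the visits. -/
def output : Cmd := .set .j 3 ;; edgeLoop 1 writeXY ;; edgeLoop 2 writeOriented

/-- The input of the machine. -/
structure Input (dirE undE : List (Fin n × Fin n)) (μ : Mach) : Prop where
  size : μ.inp 0 = n
  numDir : μ.inp 1 = dirE.length
  numUnd : μ.inp 2 = undE.length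
  base : μ.B = 3 + 2 * dirE.length + 2 * undE.length
  dir : EdgesAt μ 3 dirE
  und : EdgesAt μ (3 + 2 * dirE.length) undE

/-- An edge, starting with the endpoint of smaller value of `τ`. -/
def orientEdge (τ : Fin n → ℕ) (e : Fin n × Fin n) : Fin n × Fin n :=
  if τ e.1 < τ e.2 then e else e.swap

theorem edgeWords_append (es es' : List (Fin n × Fin n)) :
    edgeWords (es ++ es') = edgeWords es ++ edgeWords es' := List.flatMap_append

theorem edgeWords_singleton (e : Fin n × Fin n) : edgeWords [e] = [(e.1 : ℕ), (e.2 : ℕ)] := rfl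

theorem output_wp (hR : Room μ n) (hin : Input dirE undE μ) {τ : Fin n → ℕ}
    (hτ : ∀ v : Fin n, σ.a .time v = τ v) :
    wp μ output (200 * (dirE.length + undE.length + 1))
      (fun σ' => Wrote (edgeWords (dirE ++ undE.map (orientEdge τ))) σ σ') σ := by
  have hB : 64 + μ.B ≤ μ.lim := by unfold Room at hR; omega
  have hbase := hin.base
  have h1 : wp μ (.set .j 3) 2 (fun σ' => Wrote [] σ σ' ∧ σ'.v .j = 3) σ :=
    wp_set (x := .j) (e := 3) (by simp; omega)
      ⟨(⟨rfl, fun _ _ => rfl, by simp⟩ : Wrote [] σ σ).fr (by simp), by simp⟩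
  have e1 : writeXY.cost ≤ 10 := by decide
  have e2 : writeOriented.cost ≤ 60 := by decide
  refine wp_mono (wp_seq (wp_mono h1 le_rfl fun σ1 ⟨w1, j1⟩ => wp_seq (wp_mono
    (edgeLoop_wp (K := writeXY.cost) hB (by omega) hin.dir le_rfl hin.numDir
      (fun i σ' => Wrote (edgeWords (dirE.take i)) σ σ') (fun i σ σ' h hf => h.fr hf) ?_
      (by simpa [edgeWords] using w1) j1) le_rfl fun σ2 ⟨w2, j2⟩ =>
    wp_mono (edgeLoop_wp (K := writeOriented.cost) hB (by omega) hin.und (by omega) hin.numUnd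
      (fun i σ' => Wrote (edgeWords (dirE ++ (undE.map (orientEdge τ)).take i)) σ σ')
      (fun i σ σ' h hf => h.fr hf) ?_ (by simpa using w2) j2) le_rfl ?_))) ?_ fun _ => id
  · intro i hi σ3 w3 hx hy
    refine wp_of_vc _ ?_
    simp [writeXY, hx, hy]
    refine ⟨w3.a, w3.v, ?_⟩
    simp only [St.emit_out, w3.out]
    rw [List.take_succ_eq_append_getElem hi, edgeWords_append, edgeWords_singleton]
    simp
  · intro i hi σ3 w3 hx hy
    have b1 := hR.small (j := undE[i].1) (by have := (undE[i].1).isLt; omega)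
    have b2 := hR.small (j := undE[i].2) (by have := (undE[i].2).isLt; omega)
    have hi' : i < (undE.map (orientEdge τ)).length := by simpa using hi
    have ht : ∀ v : Fin n, σ3.a .time v = τ v := by rw [w3.a]; exact hτ
    have key : ∀ σ4 : St, σ4.a = σ3.a → σ4.v = σ3.v →
        σ4.out = σ3.out ++ edgeWords [orientEdge τ undE[i]] →
        Wrote (edgeWords (dirE ++ (undE.map (orientEdge τ)).take (i + 1))) σ σ4 := by
      intro σ4 ha hv ho
      refine ⟨ha.trans w3.a, by rw [hv]; exact w3.v, ?_⟩
      rw [ho, w3.out, List.take_succ_eq_append_getElem hi', ← List.append_assoc,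
        edgeWords_append _ [_], List.getElem_map, List.append_assoc]
    refine wp_of_vc _ ?_
    simp [writeOriented, writeXY, hx, hy, ht]
    refine ⟨⟨by omega, by omega⟩, fun hlt => key _ rfl rfl ?_, fun hle => key _ rfl rfl ?_⟩
    · simp [edgeWords_singleton, orientEdge, hlt]
    · simp [edgeWords_singleton, orientEdge, hle.not_gt]
  · rintro σ3 ⟨w3, -⟩
    rwa [List.take_of_length_le (by simp)] at w3
  · have g1 := Nat.mul_le_mul_left dirE.length (show writeXY.cost + 40 ≤ 100 by omega)
    have g2 := Nat.mul_le_mul_left undE.length (show writeOriented.cost + 40 ≤ 100 by omega)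
    omega

end WordRAM

/-! ### Output encoding and the test at the first leaf -/

namespace WordRAM

open CausalGraph

variable {n : ℕ} {μ : Mach} {G D : Digraph (Fin n)} {sl : Fin n → List (Fin n × ℕ)} {σ σ' : St}
  {X : Finset (Fin n)} {x y : Fin n} {L : ℕ} {xs : List (Fin n)}
  {es dirE undE : List (Fin n × Fin n)}

theorem mem_map_orientEdge (hG : ∀ v, ¬ G.Adj v v) (hE : IsEdgeListing G dirE undE)
    {τ : Fin n → ℕ} (hτ : Function.Injective τ) {u v : Fin n} :
    (u, v) ∈ undE.map (orientEdge τ) ↔ UndirEdge G u v ∧ τ u < τ v := by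
  rw [← hE.mem_und, List.mem_map]
  constructor
  · rintro ⟨⟨a, b⟩, he, h⟩
    have hab : UndirEdge G a b := (hE.mem_und a b).1 (Or.inl he)
    have hne : τ a ≠ τ b := fun h' => by
      have := hτ h'; subst this; exact hG _ hab.1
    unfold orientEdge at h
    split_ifs at h with hlt
    · obtain ⟨rfl, rfl⟩ := Prod.mk.inj h
      exact ⟨Or.inl he, hlt⟩
    · obtain ⟨rfl, rfl⟩ := Prod.mk.inj h
      exact ⟨Or.inr he, lt_of_le_of_ne (not_lt.1 hlt) hne.symm⟩
  · rintro ⟨h | h, hlt⟩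
    · exact ⟨_, h, by simp [orientEdge, hlt]⟩
    · exact ⟨_, h, by simp [orientEdge, hlt.not_gt]⟩

/-- No edge is written twice: orienting keeps the unordered pairs, which are distinct, and a
directed edge is never an undirected one. -/
theorem encodes_orient (hG : ∀ v, ¬ G.Adj v v) (hE : IsEdgeListing G dirE undE)
    {τ : Fin n → ℕ} (hτ : Function.Injective τ) :
    Encodes (edgeWords (dirE ++ undE.map (orientEdge τ))) (orient G τ) := by
  refine ⟨_, ?_, fun u v => ?_, rfl⟩
  · rw [List.nodup_append]
    refine ⟨hE.nodup_dir, ?_, ?_⟩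
    · refine List.Nodup.of_map (fun e => s(e.1, e.2)) ?_
      rw [List.map_map]
      convert hE.nodup_und using 2
      refine funext fun e => ?_
      simp only [Function.comp, orientEdge]
      split_ifs
      · rfl
      · exact Sym2.eq_swap
    · rintro ⟨u, v⟩ h1 _ h2 rfl
      rw [hE.mem_dir] at h1
      rw [mem_map_orientEdge hG hE hτ] at h2
      exact h1.2 h2.1.2
  · rw [List.mem_append, hE.mem_dir, mem_map_orientEdge hG hE hτ]
    rfl

/-! ### Checking the first leaf -/

/-- Orient the edge between `x` and `y`: `f` is visited before `b`. -/
def orientXY : Cmd :=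
  .ite (.lt (Ex.a .time (Ex.v .x)) (Ex.a .time (Ex.v .y)))
    (.set .f (Ex.v .x) ;; .set .b (Ex.v .y)) (.set .f (Ex.v .y) ;; .set .b (Ex.v .x))

/-- The entry of `last` at a child is raised to the latest visiting time among its undirected
parents. -/
def recordBody : Cmd :=
  orientXY ;;
  .ite (.lt (Ex.a .last (Ex.v .b)) (Ex.a .time (Ex.v .f)))
    (.sto .last (Ex.v .b) (Ex.a .time (Ex.v .f))) .skip

/-- The array `ord` turns the recorded time back into a vertex; a parent that is neither this vertex
nor adjacent to it refutes the leaf. -/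
def compareBody : Cmd :=
  orientXY ;; .set .w (Ex.a .ord (Ex.a .last (Ex.v .b))) ;;
  .ite (.eq (Ex.v .f) (Ex.v .w)) .skip
    (.ite (.eq (Ex.a .adj (Ex.a .row (Ex.v .f) + Ex.v .w)) 1) .skip (.set .run 0))

def undStart : Cmd := .set .j (3 + Ex.inp 1 + Ex.inp 1)

/-- Set `run` to `1` if the order of the visits yields an extension, to `0` otherwise. -/
def check : Cmd :=
  undStart ;; edgeLoop 2 recordBody ;; (undStart ;; .set .run 1) ;; edgeLoop 2 compareBody

theorem orientXY_vc (hR : Room μ n) {τ : Fin n → ℕ} (hτ : ∀ v : Fin n, σ.a .time v = τ v)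
    {e : Fin n × Fin n} (hx : σ.v .x = e.1) (hy : σ.v .y = e.2) :
    orientXY.vc μ (fun σ' => Fr [] [.f, .b] σ σ' ∧ σ'.v .f = (orientEdge τ e).1 ∧
      σ'.v .b = (orientEdge τ e).2) σ := by
  have b1 := hR.small (j := e.1) (by have := e.1.isLt; omega)
  have b2 := hR.small (j := e.2) (by have := e.2.isLt; omega)
  simp [orientXY, hx, hy, hτ]
  refine ⟨⟨by omega, by omega⟩, fun h => ?_, fun h => ?_⟩
  · simp [orientEdge, h]
  · simp [orientEdge, h.not_gt]

/-- The order of the visits. -/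
structure Order (G : Digraph (Fin n)) (sl : Fin n → List (Fin n × ℕ)) (τ : Fin n → ℕ) (σ : St) :
    Prop where
  stat : Stat G sl σ
  time : ∀ v : Fin n, σ.a .time v = τ v
  ord : ∀ v : Fin n, σ.a .ord (τ v) = v
  lt : ∀ v, τ v < n

theorem Order.fr {τ : Fin n → ℕ} (h : Order G sl τ σ) {as vs} (hf : Fr as vs σ σ')
    (ha : ∀ id ∈ as, id ∈ [Arr.last]) (hv : ∀ x ∈ vs, x ≠ Var.n) : Order G sl τ σ' where
  stat := h.stat.fr hf (fun id hid h' => by have := ha id hid; simp at this h'; simp [this] at h') hv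
  time := by rw [hf.arr _ fun h' => by simpa using ha _ h']; exact h.time
  ord := by rw [hf.arr _ fun h' => by simpa using ha _ h']; exact h.ord
  lt := h.lt

/-- `last c` is at least the time of every parent of `c` in `ps`. -/
def LastGe (τ : Fin n → ℕ) (ps : List (Fin n × Fin n)) (σ : St) : Prop :=
  ∀ e ∈ ps, τ e.1 ≤ σ.a .last e.2

/-- `last c` is zero or the time of a parent of `c`. -/
def LastMem (τ : Fin n → ℕ) (ps : List (Fin n × Fin n)) (σ : St) : Prop :=
  ∀ c : Fin n, σ.a .last c = 0 ∨ ∃ e ∈ ps, e.2 = c ∧ σ.a .last c = τ e.1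

theorem recordBody_vc (hR : Room μ n) {τ : Fin n → ℕ} (ho : Order G sl τ σ)
    {ps qs : List (Fin n × Fin n)} {e : Fin n × Fin n} (hx : σ.v .x = e.1) (hy : σ.v .y = e.2)
    (h1 : LastGe τ qs σ) (h2 : LastMem τ ps σ) (he : orientEdge τ e ∈ ps) :
    recordBody.vc μ (fun σ' => Fr [.last] [.f, .b] σ σ' ∧ LastGe τ (qs ++ [orientEdge τ e]) σ' ∧
      LastMem τ ps σ') σ := by
  change orientXY.vc μ _ σ
  refine Cmd.vc_mono _ (orientXY_vc hR ho.time hx hy) ?_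
  rintro σ1 ⟨hF, hf, hb⟩
  generalize orientEdge τ e = e at *
  have el : σ1.a .last = σ.a .last := hF.arr _ (by simp)
  have ho1 := ho.fr hF (by simp) (by simp)
  have b1 := hR.small (j := e.1) (by have := e.1.isLt; omega)
  have b2 := hR.small (j := e.2) (by have := e.2.isLt; omega)
  have h2' : LastMem τ ps σ1 := by unfold LastMem; rw [el]; exact h2
  simp [hf, hb, ho1.time]
  refine ⟨⟨by omega, by omega⟩, fun h => ⟨by omega, by omega, ?_, ?_, ?_⟩,
    fun h => ⟨hF.mono (by simp) (by simp), ?_, h2'⟩⟩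
  · exact hF.mono (by simp) (by simp)
  · intro e' he'
    simp only [St.sto_a, if_true, Function.update_apply, Fin.val_inj]
    rw [List.mem_append, List.mem_singleton] at he'
    rcases he' with he' | rfl
    · have := h1 e' he'
      rw [← el] at this
      split_ifs with h'
      · rw [h'] at this; omega
      · exact this
    · simp
  · intro c
    simp only [St.sto_a, if_true, Function.update_apply, Fin.val_inj]
    by_cases hc : c = e.2
    · subst hc; exact Or.inr ⟨e, he, rfl, by simp⟩
    · rw [if_neg hc]; exact h2' c
  · intro e' he'
    rw [List.mem_append, List.mem_singleton] at he'
    rcases he' with he' | rfl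
    · rw [el]; exact h1 e' he'
    · exact h

/-- The parents in `ps` of the child of `e` that are visited last are equal or adjacent to the
parent in `e`. -/
def LastAdj (G : Digraph (Fin n)) (τ : Fin n → ℕ) (ps : List (Fin n × Fin n))
    (e : Fin n × Fin n) : Prop :=
  ∀ q, (q, e.2) ∈ ps → (∀ e' ∈ ps, e'.2 = e.2 → τ e'.1 ≤ τ q) → e.1 = q ∨ Adjacent G e.1 q

/-- The initial value 0 is also the time of the first visited vertex. This is harmless: if a child
with parent `e.1` has the entry 0, then `e.1` has time 0 and is itself the last parent. -/
theorem exists_last {τ : Fin n → ℕ} {ps : List (Fin n × Fin n)} (h1 : LastGe τ ps σ)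
    (h2 : LastMem τ ps σ) {e : Fin n × Fin n} (he : e ∈ ps) :
    ∃ q, (q, e.2) ∈ ps ∧ σ.a .last e.2 = τ q ∧ ∀ e' ∈ ps, e'.2 = e.2 → τ e'.1 ≤ τ q := by
  have key : ∀ q, σ.a .last e.2 = τ q → ∀ e' ∈ ps, e'.2 = e.2 → τ e'.1 ≤ τ q := by
    intro q hq e' he' h
    rw [← hq, ← h]; exact h1 e' he'
  rcases h2 e.2 with h | ⟨e', he', h3, h4⟩
  · have := h1 e he
    have h5 : σ.a .last e.2 = τ e.1 := by omega
    exact ⟨e.1, he, h5, key _ h5⟩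
  · exact ⟨e'.1, by rw [← h3]; exact he', h4, key _ h4⟩

theorem compareBody_vc (hR : Room μ n) {τ : Fin n → ℕ} (hτ : Function.Injective τ)
    (ho : Order G sl τ σ)
    {ps : List (Fin n × Fin n)} {e : Fin n × Fin n} (hx : σ.v .x = e.1) (hy : σ.v .y = e.2)
    (h1 : LastGe τ ps σ) (h2 : LastMem τ ps σ) (he : orientEdge τ e ∈ ps) :
    compareBody.vc μ (fun σ' => Fr [] [.f, .b, .w, .run] σ σ' ∧
      (LastAdj G τ ps (orientEdge τ e) ∧ σ'.v .run = σ.v .run ∨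
        ¬ LastAdj G τ ps (orientEdge τ e) ∧ σ'.v .run = 0)) σ := by
  change orientXY.vc μ _ σ
  refine Cmd.vc_mono _ (orientXY_vc hR ho.time hx hy) ?_
  rintro σ1 ⟨hF, hf, hb⟩
  generalize orientEdge τ e = e at *
  obtain ⟨q, hq1, hq2, hq3⟩ := exists_last h1 h2 he
  have ho1 := ho.fr hF (by simp) (by simp)
  have el : σ1.a .last e.2 = τ q := by rw [hF.arr _ (by simp), hq2]
  have b1 := hR.idx (l := e.1) (j := q) e.1.isLt.le (by have := q.isLt; omega)
  have b2 := hR.small (j := e.2) (by have := e.2.isLt; omega)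
  have b3 := hR.small (j := τ q) (by have := ho.lt q; omega)
  have b4 := hR.small (j := e.1) (by have := e.1.isLt; omega)
  have hadj := ho1.stat.adj e.1 q
  have hrow := ho1.stat.row e.1 e.1.isLt.le
  have hlast : LastAdj G τ ps e ↔ e.1 = q ∨ Adjacent G e.1 q := by
    refine ⟨fun h => h q hq1 hq3, fun h q' hq1' hq3' => ?_⟩
    have : q' = q := hτ (le_antisymm (hq3 (q', e.2) hq1' rfl) (hq3' (q, e.2) hq1 rfl))
    rwa [this]
  have hrun : σ1.v .run = σ.v .run := hF.var _ (by simp)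
  have hF1 : Fr [] [.f, .b, .w, .run] σ σ1 := hF.mono (by simp) (by simp)
  rw [hlast]
  simp [hf, hb, el, ho1.ord, hrow, hadj, Fin.val_inj, hrun, hF1]
  exact ⟨by omega, fun h => Or.inl (Or.inl h), fun h => ⟨⟨by omega, by omega⟩,
    fun h' => Or.inl (Or.inr h'), fun h' => ⟨by omega, Or.inr ⟨h, h'⟩⟩⟩⟩

/-- Two passes over the undirected edges, since the last parents must be known before any
comparison. A failed comparison sets `run` to 0 and nothing later resets it. -/
theorem check_wp (hR : Room μ n) (hin : Input dirE undE μ) {τ : Fin n → ℕ}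
    (hτ : Function.Injective τ) (ho : Order G sl τ σ) (hlast : ∀ v : Fin n, σ.a .last v = 0) :
    wp μ check (400 * (undE.length + 1)) (fun σ' =>
      Fr [.last] [.x, .y, .j, .h, .f, .b, .w, .run] σ σ' ∧
      (σ'.v .run = 1 ∧ (∀ e ∈ undE.map (orientEdge τ), LastAdj G τ (undE.map (orientEdge τ)) e) ∨
       σ'.v .run = 0 ∧ ∃ e ∈ undE.map (orientEdge τ),
        ¬ LastAdj G τ (undE.map (orientEdge τ)) e)) σ := by
  have hB : 64 + μ.B ≤ μ.lim := by unfold Room at hR; omega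
  have hbase := hin.base
  set ps := undE.map (orientEdge τ) with hps
  have hsub : [Var.x, .y, .j, .h] ⊆ [Var.x, .y, .j, .h, .f, .b, .w, .run] := by decide
  have htake : ∀ (i : ℕ) (hi : i < undE.length), ps.take (i + 1) =
      ps.take i ++ [orientEdge τ undE[i]] := by
    intro i hi
    rw [List.take_succ_eq_append_getElem (by simpa [hps] using hi)]
    simp [hps]
  have hmem : ∀ (i : ℕ) (hi : i < undE.length), orientEdge τ undE[i] ∈ ps := fun i hi =>
    List.mem_map_of_mem (List.getElem_mem hi)
  have hstart : ∀ σ₀ : St, wp μ undStart 10 (fun σ' => Fr [] [.j] σ₀ σ' ∧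
      σ'.v .j = 3 + 2 * dirE.length) σ₀ := by
    intro σ₀
    refine wp_mono (wp_of_vc _ ?_) (by decide : undStart.cost ≤ 10) fun _ => id
    simp [undStart, hin.numDir]
    omega
  have e1 : recordBody.cost ≤ 140 := by decide
  have e2 : compareBody.cost ≤ 140 := by decide
  set J1 : ℕ → St → Prop := fun i σ' => Fr [.last] [.x, .y, .j, .h, .f, .b, .w, .run] σ σ' ∧
    LastGe τ (ps.take i) σ' ∧ LastMem τ ps σ' with hJ1
  set J2 : ℕ → St → Prop := fun i σ' => Fr [.last] [.x, .y, .j, .h, .f, .b, .w, .run] σ σ' ∧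
    LastGe τ ps σ' ∧ LastMem τ ps σ' ∧ (σ'.v .run = 1 ∧ (∀ e ∈ ps.take i, LastAdj G τ ps e) ∨
       σ'.v .run = 0 ∧ ∃ e ∈ ps, ¬ LastAdj G τ ps e) with hJ2
  have hJ1fr : ∀ i σ1 σ2, J1 i σ1 → Fr [] [.x, .y, .j, .h] σ1 σ2 → J1 i σ2 := by
    rintro i σ1 σ2 ⟨g1, g2, g3⟩ hf
    have el : σ2.a .last = σ1.a .last := hf.arr _ (by simp)
    refine ⟨g1.sub hf (by simp) fun _ h => hsub h, ?_, ?_⟩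
    · unfold LastGe; rw [el]; exact g2
    · unfold LastMem; rw [el]; exact g3
  have hJ2fr : ∀ i σ1 σ2, J2 i σ1 → Fr [] [.x, .y, .j, .h] σ1 σ2 → J2 i σ2 := by
    rintro i σ1 σ2 ⟨g1, g2, g3, g4⟩ hf
    have el : σ2.a .last = σ1.a .last := hf.arr _ (by simp)
    refine ⟨g1.sub hf (by simp) fun _ h => hsub h, ?_, ?_, ?_⟩
    · unfold LastGe; rw [el]; exact g2
    · unfold LastMem; rw [el]; exact g3
    · rw [hf.var .run (by simp)]; exact g4
  have hfin : ∀ i, undE.length ≤ i → ps.take i = ps := fun i hi =>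
    List.take_of_length_le (by simpa [hps] using hi)
  refine wp_mono (wp_seq (wp_mono (hstart σ) le_rfl fun σ1 ⟨f1, j1⟩ => wp_seq (wp_mono
    (edgeLoop_wp (K := recordBody.cost) hB (by omega) hin.und (by omega) hin.numUnd J1 hJ1fr ?_
      ?_ j1) le_rfl fun σ2 ⟨w2, j2⟩ => wp_seq (k1 := 13) (k2 := 20 + undE.length * (compareBody.cost + 40))
      (wp_seq (k1 := 10) (k2 := 3) ?_)))) ?_
      fun _ => id
  · intro i hi σ2 ⟨g1, g2, g3⟩ hx hy
    refine wp_of_vc _ (Cmd.vc_mono _ (recordBody_vc hR (ho.fr g1 (by simp) (by simp)) hx hy g2 g3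
      (hmem i hi)) ?_)
    rintro σ3 ⟨k1, k2, k3⟩
    exact ⟨⟨g1.sub k1 (by simp) (by simp), by rw [htake i hi]; exact k2, k3⟩,
      k1.var _ (by simp), k1.var _ (by simp)⟩
  · refine ⟨f1.mono (by simp) (by simp), by simp [LastGe], fun c => Or.inl ?_⟩
    rw [f1.arr _ (by simp), hlast]
  · refine wp_mono (hstart σ2) le_rfl ?_
    rintro σ3 ⟨f3, j3⟩
    refine wp_mono (wp_set (x := .run) (e := 1) (Q := fun σ' => J2 0 σ' ∧
      σ'.v .j = 3 + 2 * dirE.length) (by simp; omega) ⟨?_, by simp [j3]⟩) (by decide) ?_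
    · obtain ⟨g1, g2, g3⟩ := w2
      rw [hfin _ le_rfl] at g2
      have el : σ3.a .last = σ2.a .last := f3.arr _ (by simp)
      refine ⟨?_, ?_, ?_, Or.inl ⟨by simp, by simp⟩⟩
      · have := g1.sub f3 (by simp) (by simp)
        simpa using this
      · unfold LastGe; rw [St.set_a, el]; exact g2
      · unfold LastMem; rw [St.set_a, el]; exact g3
    · rintro σ4 ⟨w4, j4⟩
      refine wp_mono (edgeLoop_wp (K := compareBody.cost) hB (by omega) hin.und (by omega)
        hin.numUnd J2 hJ2fr ?_ w4 j4) le_rfl ?_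
      · rintro i hi σ5 ⟨g1, g2, g3, g4⟩ hx hy
        refine wp_of_vc _ (Cmd.vc_mono _ (compareBody_vc hR hτ (ho.fr g1 (by simp) (by simp)) hx
          hy g2 g3 (hmem i hi)) ?_)
        rintro σ6 ⟨k1, k2⟩
        have el : σ6.a .last = σ5.a .last := k1.arr _ (by simp)
        refine ⟨⟨g1.sub k1 (by simp) (by simp), ?_, ?_, ?_⟩, k1.var _ (by simp), k1.var _ (by simp)⟩
        · unfold LastGe; rw [el]; exact g2
        · unfold LastMem; rw [el]; exact g3
        · rcases k2 with ⟨k2, k3⟩ | ⟨k2, k3⟩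
          · rw [k3]
            refine g4.imp (fun ⟨h1, h2⟩ => ⟨h1, fun e he => ?_⟩) id
            rw [htake i hi, List.mem_append, List.mem_singleton] at he
            rcases he with he | rfl
            · exact h2 e he
            · exact k2
          · exact Or.inr ⟨k3, _, hmem i hi, k2⟩
      · rintro σ5 ⟨⟨g1, -, -, g4⟩, -⟩
        rw [hfin _ le_rfl] at g4
        exact ⟨g1, g4⟩
  · have g1 := Nat.mul_le_mul_left undE.length (show recordBody.cost + 40 ≤ 180 by omega)
    have g2 := Nat.mul_le_mul_left undE.length (show compareBody.cost + 40 ≤ 180 by omega)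
    omega

/-- The outcome of the check decides whether there are extensions. -/
theorem extension_of_lastAdj (hG : IsMPDAG G) (hE : IsEdgeListing G dirE undE)
    (hxs : MCSPrefix G xs) (hall : ∀ v, v ∈ xs)
    (h : ∀ e ∈ undE.map (orientEdge fun v => xs.idxOf v),
      LastAdj G (fun v => xs.idxOf v) (undE.map (orientEdge fun v => xs.idxOf v)) e) :
    IsConsistentExtension (orient G fun v => xs.idxOf v) G := by
  have hτ := idxOf_injective hall
  set τ : Fin n → ℕ := fun v => xs.idxOf v with hτdef
  have hmem : ∀ u v, (u, v) ∈ undE.map (orientEdge τ) ↔ UndirEdge G u v ∧ τ u < τ v := fun u v =>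
    mem_map_orientEdge hG.loopless hE hτ
  refine hxs.orient_isConsistentExtension hG hall fun a b c h1 h2 h3 h4 h5 =>
    moral_of_last_parent hG hτ (fun u v huv => mem_before.1 ((hxs.isTop_before hall v).1.2 u huv))
      ?_ (τ c) a b c rfl h1 h2 h3 h4 h5
  intro a p c hac hpc hap hpc' hmax
  have hle : ∀ e ∈ undE.map (orientEdge τ), e.2 = (a, c).2 → τ e.1 ≤ τ p := by
    rintro ⟨q, c'⟩ he rfl
    exact hmax q ((hmem _ _).1 he).1 ((hmem _ _).1 he).2
  rcases h (a, c) ((hmem _ _).2 ⟨hac, hap.trans hpc'⟩) p ((hmem _ _).2 ⟨hpc, hpc'⟩) hle with h' | h'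
  · exact absurd (congrArg τ h') hap.ne
  · exact h'

/-- If there were an extension, every search order would be moral, so a single failed comparison
refutes all extensions and not just the orientation at this leaf. -/
theorem not_extension_of_not_lastAdj (hG : IsMPDAG G) (hE : IsEdgeListing G dirE undE)
    (hxs : MCSPrefix G xs) (hall : ∀ v, v ∈ xs)
    (h : ∃ e ∈ undE.map (orientEdge fun v => xs.idxOf v),
      ¬ LastAdj G (fun v => xs.idxOf v) (undE.map (orientEdge fun v => xs.idxOf v)) e) :
    ¬ IsConsistentExtension D G := by
  intro hD
  obtain ⟨⟨a, c⟩, he, h⟩ := h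
  have hτ := idxOf_injective hall
  have h1 := (mem_map_orientEdge hG.loopless hE hτ).1 he
  refine h fun q hq _ => ?_
  have h2 := (mem_map_orientEdge hG.loopless hE hτ).1 hq
  by_cases e : a = q
  · exact Or.inl e
  · exact Or.inr (hxs.moral hG hD hall a q c h1.2 h2.2 h1.1 h2.1 e)

end WordRAM

/-! ### Successor lists and adjacency matrix from the input -/

namespace WordRAM

open CausalGraph

variable {n : ℕ} {μ : Mach} {G D : Digraph (Fin n)} {sl : Fin n → List (Fin n × ℕ)} {σ σ' : St}
  {X : Finset (Fin n)} {x y : Fin n} {L : ℕ} {xs : List (Fin n)}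
  {es dirE undE : List (Fin n × Fin n)}

/-! ### Building the data structures from the input -/

/-- The successors of `x` in a list of arcs with flags. -/
def succs (as : List (Fin n × Fin n × ℕ)) (x : Fin n) : List (Fin n × ℕ) :=
  (as.filter fun a => a.1 = x).map Prod.snd

theorem succs_append (as bs : List (Fin n × Fin n × ℕ)) :
    succs (as ++ bs) x = succs as x ++ succs bs x := by simp [succs]

theorem succs_singleton (u : Fin n) (a : Fin n × ℕ) :
    succs [(u, a)] x = if u = x then [a] else [] := by
  unfold succs
  by_cases h : u = x <;> simp [h]

theorem mem_succs {as : List (Fin n × Fin n × ℕ)} {a : Fin n × ℕ} :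
    a ∈ succs as x ↔ (x, a) ∈ as := by
  simp [succs]

theorem sum_length_succs (as : List (Fin n × Fin n × ℕ)) :
    ∑ x, (succs as x).length = as.length := by
  induction as with
  | nil => simp [succs]
  | cons a as ih =>
    have : ∀ x, (succs (a :: as) x).length = (if a.1 = x then 1 else 0) + (succs as x).length := by
      intro x
      unfold succs
      by_cases h : a.1 = x <;> simp [h]; omega
    simp only [this, Finset.sum_add_distrib, ih]
    simp; omega

/-- The directed edges as arcs. -/
def dirArcs (es : List (Fin n × Fin n)) : List (Fin n × Fin n × ℕ) := es.map fun e => (e.1, e.2, 1)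

/-- The undirected edges as arcs. -/
def undArcs (es : List (Fin n × Fin n)) : List (Fin n × Fin n × ℕ) :=
  es.flatMap fun e => [(e.1, e.2, 0), (e.2, e.1, 0)]

theorem mem_dirArcs {u v : Fin n} {f : ℕ} :
    (u, v, f) ∈ dirArcs es ↔ (u, v) ∈ es ∧ f = 1 := by
  simp only [dirArcs, List.mem_map, Prod.mk.injEq, Prod.exists]
  constructor
  · rintro ⟨a, b, h, rfl, rfl, rfl⟩; exact ⟨h, rfl⟩
  · rintro ⟨h, rfl⟩; exact ⟨_, _, h, rfl, rfl, rfl⟩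

theorem mem_undArcs {u v : Fin n} {f : ℕ} :
    (u, v, f) ∈ undArcs es ↔ ((u, v) ∈ es ∨ (v, u) ∈ es) ∧ f = 0 := by
  simp only [undArcs, List.mem_flatMap, List.mem_cons, Prod.mk.injEq, List.not_mem_nil, or_false,
    Prod.exists]
  constructor
  · rintro ⟨a, b, h, ⟨rfl, rfl, rfl⟩ | ⟨rfl, rfl, rfl⟩⟩
    · exact ⟨Or.inl h, rfl⟩
    · exact ⟨Or.inr h, rfl⟩
  · rintro ⟨h | h, rfl⟩
    · exact ⟨_, _, h, Or.inl ⟨rfl, rfl, rfl⟩⟩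
    · exact ⟨_, _, h, Or.inr ⟨rfl, rfl, rfl⟩⟩

/-- The arcs of the graph. -/
def arcs (dirE undE : List (Fin n × Fin n)) : List (Fin n × Fin n × ℕ) :=
  dirArcs dirE ++ undArcs undE

theorem length_arcs : (arcs dirE undE).length = dirE.length + 2 * undE.length := by
  have : (undArcs undE).length = 2 * undE.length := by
    unfold undArcs
    induction undE with
    | nil => rfl
    | cons e es ih => simp only [List.flatMap_cons, List.length_append, ih]; simp; omega
  simp [arcs, dirArcs, this]

theorem nodup_undArcs (hne : ∀ e ∈ es, e.1 ≠ e.2) (h : (es.map fun e => s(e.1, e.2)).Nodup) :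
    ((undArcs es).map fun a => (a.1, a.2.1)).Nodup := by
  induction es with
  | nil => simp [undArcs]
  | cons e es ih =>
    rw [List.map_cons, List.nodup_cons] at h
    have ih' := ih (fun e he => hne e (List.mem_cons_of_mem _ he)) h.2
    have hc : undArcs (e :: es) = (e.1, e.2, 0) :: (e.2, e.1, 0) :: undArcs es := rfl
    have hmem : ∀ u v, (u, v) ∈ (undArcs es).map (fun a => (a.1, a.2.1)) →
        s(u, v) ∈ es.map fun e => s(e.1, e.2) := by
      intro u v huv
      rw [List.mem_map] at huv
      obtain ⟨⟨a, b, f⟩, hab, h'⟩ := huv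
      obtain ⟨rfl, rfl⟩ := Prod.mk.inj h'
      rcases (mem_undArcs.1 hab).1 with hab | hab
      · exact List.mem_map.2 ⟨_, hab, rfl⟩
      · exact List.mem_map.2 ⟨_, hab, Sym2.eq_swap⟩
    rw [hc, List.map_cons, List.map_cons, List.nodup_cons, List.nodup_cons, List.mem_cons, not_or]
    refine ⟨⟨?_, fun h' => h.1 (hmem _ _ h')⟩, fun h' => h.1 ?_, ih'⟩
    · intro h'
      exact hne e (List.mem_cons_self) (Prod.mk.inj h').1
    · have := hmem _ _ h'
      rwa [Sym2.eq_swap] at this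

theorem succList_arcs (hG : ∀ v, ¬ G.Adj v v) (hE : IsEdgeListing G dirE undE) :
    SuccList G (succs (arcs dirE undE)) := by
  constructor
  · intro x
    have h1 : ((arcs dirE undE).map fun a => (a.1, a.2.1)).Nodup := by
      unfold arcs
      rw [List.map_append, List.nodup_append]
      refine ⟨?_, nodup_undArcs ?_ hE.nodup_und, ?_⟩
      · simpa [dirArcs, Function.comp_def] using hE.nodup_dir
      · rintro ⟨u, v⟩ he h
        have := (hE.mem_und u v).1 (Or.inl he)
        simp only at h
        subst h
        exact hG _ this.1
      · rintro ⟨u, v⟩ h2 _ h3 rfl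
        rw [List.mem_map] at h2 h3
        obtain ⟨⟨a, b, f⟩, hab, h2⟩ := h2
        obtain ⟨⟨a', b', f'⟩, hab', h3⟩ := h3
        obtain ⟨rfl, rfl⟩ := Prod.mk.inj h2
        obtain ⟨rfl, rfl⟩ := Prod.mk.inj h3
        have h4 := (hE.mem_dir _ _).1 (mem_dirArcs.1 hab).1
        have h5 := (hE.mem_und _ _).1 (mem_undArcs.1 hab').1
        exact h4.2 h5.2
    have h2 := (h1.of_map _).filter (fun a => a.1 = x)
    unfold succs
    rw [List.map_map]
    refine List.Nodup.map_on ?_ h2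
    rintro ⟨a, b, f⟩ hab ⟨a', b', f'⟩ hab' h
    simp only [List.mem_filter, decide_eq_true_eq] at hab hab'
    have : b = b' := h
    subst this
    obtain ⟨hab, rfl⟩ := hab
    obtain ⟨hab', rfl⟩ := hab'
    exact List.inj_on_of_nodup_map h1 hab hab' rfl
  · intro x y f
    rw [mem_succs, arcs, List.mem_append, mem_dirArcs, mem_undArcs, hE.mem_dir, hE.mem_und]

/-- The successor lists of the arcs read so far. -/
structure Arcs (as : List (Fin n × Fin n × ℕ)) (σ : St) : Prop where
  size : σ.v .n = n
  row : ∀ x ≤ n, σ.a .row x = x * n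
  deg : ∀ x : Fin n, σ.a .deg x = (succs as x).length
  tgt : ∀ (x : Fin n) (j : ℕ) (hj : j < (succs as x).length),
    σ.a .tgt (x * n + j) = ((succs as x)[j]).1
  flg : ∀ (x : Fin n) (j : ℕ) (hj : j < (succs as x).length),
    σ.a .flg (x * n + j) = ((succs as x)[j]).2

theorem Arcs.fr {as : List (Fin n × Fin n × ℕ)} (h : Arcs as σ) {ar vs} (hf : Fr ar vs σ σ')
    (ha : ∀ id ∈ ar, id ∉ [Arr.row, .deg, .tgt, .flg]) (hv : ∀ x ∈ vs, x ≠ Var.n) :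
    Arcs as σ' where
  size := (hf.var _ fun h' => hv _ h' rfl).trans h.size
  row := by rw [hf.arr _ fun h' => ha _ h' (by simp)]; exact h.row
  deg := by rw [hf.arr _ fun h' => ha _ h' (by simp)]; exact h.deg
  tgt := by rw [hf.arr _ fun h' => ha _ h' (by simp)]; exact h.tgt
  flg := by rw [hf.arr _ fun h' => ha _ h' (by simp)]; exact h.flg

/-- Append an arc from the vertex in `a` to the vertex in `b`. -/
def addArc (a b : Var) (f : ℕ) : Cmd :=
  .sto .tgt (Ex.a .row (Ex.v a) + Ex.a .deg (Ex.v a)) (Ex.v b) ;;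
  .sto .flg (Ex.a .row (Ex.v a) + Ex.a .deg (Ex.v a)) (Ex.c f) ;;
  .sto .deg (Ex.v a) (Ex.a .deg (Ex.v a) + 1)

/-- Describes a store directly behind the last entry of a row. -/
theorem getElem_append_singleton_update {α : Type*} {β : Type*} (l : List α) (a : α) (g : α → β)
    (t : ℕ → β) (x : ℕ) (h : ∀ (j : ℕ) (hj : j < l.length), t (x + j) = g l[j]) (j : ℕ)
    (hj : j < (l ++ [a]).length) :
    Function.update t (x + l.length) (g a) (x + j) = g (l ++ [a])[j] := by
  rcases Nat.lt_or_ge j l.length with h' | h'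
  · rw [Function.update_of_ne (by omega), h j h', List.getElem_append_left h']
  · obtain rfl : j = l.length := by simp at hj; omega
    simp

/-- The bound `hu` keeps the new cell inside the row of `u`, so the rows of other vertices are not
overwritten. -/
theorem addArc_vc (hR : Room μ n) {as : List (Fin n × Fin n × ℕ)} (hA : Arcs as σ)
    (hlen : ∀ x, (succs as x).length ≤ n) {a b : Var} {f : ℕ} (hf : f ≤ 1) {u w : Fin n}
    (hu : (succs as u).length < n)
    (ha : σ.v a = u) (hb : σ.v b = w) :
    (addArc a b f).vc μ (fun σ' => Arcs (as ++ [(u, w, f)]) σ' ∧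
      Fr [.tgt, .flg, .deg] [] σ σ') σ := by
  have b1 := hR.idx u.isLt.le (j := (succs as u).length) (by omega)
  have b2 := hR.small (j := (succs as u).length) (by omega)
  have b3 := hR.small (j := u) (by have := u.isLt; omega)
  have hrow := hA.row u u.isLt.le
  have hdeg := hA.deg u
  simp [addArc, ha, hb, hrow, hdeg]
  repeat refine And.intro (by omega) ?_
  have hlt : ∀ z : Fin n, (succs as z).length ≤ n := hlen
  refine ⟨hA.size, by simpa using hA.row, fun z => ?_, fun z j hj => ?_, fun z j hj => ?_⟩
  · simp only [St.sto_a, if_true, Function.update_apply, Fin.val_inj, succs_append,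
      succs_singleton, List.length_append]
    by_cases h : z = u
    · subst h; simp
    · rw [if_neg h, if_neg (Ne.symm h)]
      simpa using hA.deg z
  · simp only [St.sto_a, if_true, reduceCtorEq, if_false]
    simp only [succs_append, succs_singleton] at hj ⊢
    by_cases h : u = z
    · subst h
      simp only [if_true] at hj ⊢
      exact getElem_append_singleton_update (succs as u) (w, f) (fun p => (p.1 : ℕ)) _ _
        (hA.tgt u) j hj
    · simp only [if_neg h, List.append_nil] at hj ⊢
      rw [Function.update_of_ne, hA.tgt z j hj]
      intro e
      have := (mul_add_inj (by have := hlt z; omega) hu e).1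
      exact h (Fin.ext this.symm)
  · simp only [St.sto_a, if_true, reduceCtorEq, if_false]
    simp only [succs_append, succs_singleton] at hj ⊢
    by_cases h : u = z
    · subst h
      simp only [if_true] at hj ⊢
      exact getElem_append_singleton_update (succs as u) (w, f) (fun p => p.2) _ _
        (hA.flg u) j hj
    · simp only [if_neg h, List.append_nil] at hj ⊢
      rw [Function.update_of_ne, hA.flg z j hj]
      intro e
      have := (mul_add_inj (by have := hlt z; omega) hu e).1
      exact h (Fin.ext this.symm)

def setAdj : Cmd :=
  .sto .adj (Ex.a .row (Ex.v .x) + Ex.v .y) 1 ;; .sto .adj (Ex.a .row (Ex.v .y) + Ex.v .x) 1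

/-- The adjacency matrix of the edges `es`. -/
def AdjMat (es : List (Fin n × Fin n)) (σ : St) : Prop :=
  ∀ x y : Fin n, σ.a .adj (x * n + y) = 1 ↔ (x, y) ∈ es ∨ (y, x) ∈ es

theorem setAdj_vc (hR : Room μ n) (hrow : ∀ x ≤ n, σ.a .row x = x * n) (hM : AdjMat es σ)
    {u w : Fin n} (hx : σ.v .x = u) (hy : σ.v .y = w) :
    setAdj.vc μ (fun σ' => AdjMat (es ++ [(u, w)]) σ' ∧ Fr [.adj] [] σ σ') σ := by
  have b1 := hR.idx u.isLt.le (j := w) (by have := w.isLt; omega)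
  have b2 := hR.idx w.isLt.le (j := u) (by have := u.isLt; omega)
  have b3 := hR.small (j := u) (by have := u.isLt; omega)
  have b4 := hR.small (j := w) (by have := w.isLt; omega)
  simp [setAdj, hx, hy, hrow u u.isLt.le, hrow w w.isLt.le]
  repeat refine And.intro (by omega) ?_
  intro z z'
  simp only [St.sto_a, if_true, Function.update_apply, List.mem_append, List.mem_singleton,
    Prod.mk.injEq]
  have key : ∀ a b : Fin n, (z : ℕ) * n + z' = a * n + b ↔ z = a ∧ z' = b := by
    intro a b
    constructor
    · intro h
      obtain ⟨h1, h2⟩ := mul_add_inj z'.isLt b.isLt h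
      exact ⟨Fin.ext h1, Fin.ext h2⟩
    · rintro ⟨rfl, rfl⟩; rfl
  simp only [key]
  by_cases h1 : z = w ∧ z' = u
  · simp only [h1.1, h1.2, and_self, if_true, true_iff]; tauto
  · by_cases h2 : z = u ∧ z' = w
    · rw [if_neg h1]; simp only [h2.1, h2.2, and_self, if_true, true_iff]; tauto
    · rw [if_neg h1, if_neg h2, hM]; tauto

end WordRAM

/-! ### Reading the edges and filling the buckets -/

namespace WordRAM

open CausalGraph

variable {n : ℕ} {μ : Mach} {G D : Digraph (Fin n)} {sl : Fin n → List (Fin n × ℕ)} {σ σ' : St}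
  {X : Finset (Fin n)} {x y : Fin n} {L : ℕ} {xs : List (Fin n)}
  {es dirE undE : List (Fin n × Fin n)}

def addDir : Cmd := addArc .x .y 1 ;; setAdj ;; .sto .blk (Ex.v .y) (Ex.a .blk (Ex.v .y) + 1)

def addUnd : Cmd := addArc .x .y 0 ;; addArc .y .x 0 ;; setAdj

/-- `blk` counts the edges of `es` into a vertex. -/
def InCount (es : List (Fin n × Fin n)) (σ : St) : Prop :=
  ∀ y : Fin n, σ.a .blk y = (es.filter fun e => e.2 = y).length

/-- The state after reading a part of the edges. -/
structure Reading (as : List (Fin n × Fin n × ℕ)) (es ds : List (Fin n × Fin n)) (σ₀ σ : St) :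
    Prop where
  arcs : Arcs as σ
  adj : AdjMat es σ
  count : InCount ds σ
  fr : Fr [.row, .tgt, .flg, .deg, .adj, .blk] [.n, .x, .y, .j, .h] σ₀ σ

theorem Reading.fr' {σ₀ : St} {as : List (Fin n × Fin n × ℕ)} {es ds : List (Fin n × Fin n)}
    (h : Reading as es ds σ₀ σ) (hf : Fr [] [.x, .y, .j, .h] σ σ') : Reading as es ds σ₀ σ' where
  arcs := h.arcs.fr hf (by simp) (by simp)
  adj := by unfold AdjMat; rw [hf.arr _ (by simp)]; exact h.adj
  count := by unfold InCount; rw [hf.arr _ (by simp)]; exact h.count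
  fr := h.fr.sub hf (by simp) (by simp)

theorem succs_length_le (hl : SuccList G sl) {as : List (Fin n × Fin n × ℕ)}
    (hsl : sl = succs (WordRAM.arcs dirE undE)) (h : as <+: WordRAM.arcs dirE undE) (x : Fin n) :
    (succs as x).length ≤ n := by
  obtain ⟨t, ht⟩ := h
  have := hl.length_le (x := x)
  rw [hsl, ← ht, succs_append, List.length_append] at this
  omega

/-- A prefix that already includes the arc gives at most `n` successors, so there was a free place
before it was added. -/
theorem succs_length_lt (hl : SuccList G sl) {as : List (Fin n × Fin n × ℕ)} {a : Fin n × ℕ}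
    (hsl : sl = succs (WordRAM.arcs dirE undE)) (h : as ++ [(x, a)] <+: WordRAM.arcs dirE undE) :
    (succs as x).length < n := by
  have := succs_length_le hl hsl h x
  rw [succs_append, succs_singleton] at this
  simp at this
  omega

theorem addDir_vc (hR : Room μ n) (hl : SuccList G sl) (hsl : sl = succs (arcs dirE undE))
    {σ₀ : St} {as : List (Fin n × Fin n × ℕ)} {es ds : List (Fin n × Fin n)}
    (h : Reading as es ds σ₀ σ) {e : Fin n × Fin n}
    (hpre : as ++ dirArcs [e] <+: arcs dirE undE) (hds : ds.length ≤ μ.B)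
    (hx : σ.v .x = e.1) (hy : σ.v .y = e.2) :
    addDir.vc μ (fun σ' => Reading (as ++ dirArcs [e]) (es ++ [e]) (ds ++ [e]) σ₀ σ' ∧
      Fr [.tgt, .flg, .deg, .adj, .blk] [] σ σ') σ := by
  have hlen := succs_length_le hl hsl ((List.prefix_append as _).trans hpre)
  change (addArc .x .y 1).vc μ _ σ
  refine Cmd.vc_mono _ (addArc_vc hR h.arcs hlen le_rfl (succs_length_lt hl hsl hpre) hx hy) ?_
  rintro σ1 ⟨hA1, hF1⟩
  change setAdj.vc μ _ σ1
  refine Cmd.vc_mono _ (setAdj_vc (es := es) (u := e.1) (w := e.2) hR hA1.row ?_ ?_ ?_) ?_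
  · unfold AdjMat; rw [hF1.arr _ (by simp)]; exact h.adj
  · rw [hF1.var _ (by simp), hx]
  · rw [hF1.var _ (by simp), hy]
  rintro σ2 ⟨hM2, hF2⟩
  have hF : Fr [.tgt, .flg, .deg, .adj, .blk] [] σ σ2 :=
    (hF1.mono (by simp) (by simp)).sub hF2 (by simp) (by simp)
  have hy2 : σ2.v .y = e.2 := by rw [hF.var _ (by simp), hy]
  have hc2 : InCount ds σ2 := by
    unfold InCount; rw [hF2.arr _ (by simp), hF1.arr _ (by simp)]; exact h.count
  have b1 := hR.small (j := e.2) (by have := e.2.isLt; omega)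
  have b2 : (ds.filter fun e' => e'.2 = e.2).length ≤ ds.length := List.length_filter_le _ _
  have b3 := hR.small (j := 0) (by omega)
  have hbe := hc2 e.2
  have hFs : Fr [.blk] [] σ2 (σ2.sto .blk e.2 ((ds.filter fun e' => e'.2 = e.2).length + 1)) := by
    simp
  simp only [Cmd.vc, Ex.Ok, Ex.eval, Ex.ok_add, Ex.eval_add, Ex.eval_ofNat, Ex.ok_ofNat, hy2, hbe]
  refine ⟨trivial, ⟨⟨trivial, by omega⟩, by omega, by unfold Room at hR; omega⟩, by omega, ?_⟩
  refine ⟨⟨hA1.fr (ar := [.adj, .blk]) (vs := []) ((hF2.mono (by simp) (by simp)).sub hFs (by simp) (by simp))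
    (by simp) (by simp), ?_, ?_, ?_⟩, hF.sub hFs (by simp) (by simp)⟩
  · unfold AdjMat; rw [hFs.arr _ (by simp)]; exact hM2
  · intro z
    simp only [St.sto_a, if_true, Function.update_apply, Fin.val_inj, List.filter_append,
      List.length_append]
    by_cases hz : z = e.2
    · subst hz; simp
    · rw [if_neg hz, hc2 z]
      simp [Ne.symm hz]
  · exact h.fr.sub (hF.sub hFs (by simp) (by simp)) (by simp) (by simp)

theorem addUnd_vc (hR : Room μ n) (hl : SuccList G sl) (hsl : sl = succs (arcs dirE undE))
    {σ₀ : St} {as : List (Fin n × Fin n × ℕ)} {es ds : List (Fin n × Fin n)}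
    (h : Reading as es ds σ₀ σ) {e : Fin n × Fin n}
    (hpre : as ++ undArcs [e] <+: arcs dirE undE)
    (hx : σ.v .x = e.1) (hy : σ.v .y = e.2) :
    addUnd.vc μ (fun σ' => Reading (as ++ undArcs [e]) (es ++ [e]) ds σ₀ σ' ∧
      Fr [.tgt, .flg, .deg, .adj, .blk] [] σ σ') σ := by
  have hE : as ++ undArcs [e] = (as ++ [(e.1, e.2, 0)]) ++ [(e.2, e.1, 0)] := by
    rw [List.append_assoc]; rfl
  rw [hE] at hpre ⊢
  have hpre1 := (List.prefix_append _ _).trans hpre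
  change (addArc .x .y 0).vc μ _ σ
  refine Cmd.vc_mono _ (addArc_vc hR h.arcs (succs_length_le hl hsl
    ((List.prefix_append as _).trans hpre1)) (by omega) (succs_length_lt hl hsl hpre1) hx hy) ?_
  rintro σ1 ⟨hA1, hF1⟩
  change (addArc .y .x 0).vc μ _ σ1
  refine Cmd.vc_mono _ (addArc_vc hR hA1 (succs_length_le hl hsl hpre1) (by omega)
    (succs_length_lt hl hsl hpre) ((hF1.var _ (by simp)).trans hy) ((hF1.var _ (by simp)).trans hx)) ?_
  rintro σ2 ⟨hA2, hF2⟩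
  have hF12 := hF1.trans hF2
  refine Cmd.vc_mono _ (setAdj_vc (es := es) (u := e.1) (w := e.2) hR hA2.row ?_ ?_ ?_) ?_
  · unfold AdjMat; rw [hF12.arr _ (by simp)]; exact h.adj
  · rw [hF12.var _ (by simp), hx]
  · rw [hF12.var _ (by simp), hy]
  rintro σ3 ⟨hM3, hF3⟩
  have hF : Fr [.tgt, .flg, .deg, .adj, .blk] [] σ σ3 :=
    (hF12.mono (by simp) (by simp)).sub hF3 (by simp) (by simp)
  refine ⟨⟨hA2.fr hF3 (by simp) (by simp), hM3, ?_, h.fr.sub hF (by simp) (by simp)⟩, hF⟩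
  unfold InCount
  rw [hF3.arr _ (by simp), hF12.arr _ (by simp)]; exact h.count

/-- The machine cannot multiply, so the multiples of `n` are tabulated by repeated addition. The
table includes the row `n`. -/
def rowBody : Cmd := .sto .row (Ex.v .h + 1) (Ex.a .row (Ex.v .h) + Ex.v .n) ;; .set .h (Ex.v .h + 1)

def rows : Cmd := .set .n (Ex.inp 0) ;; .loop (.lt (Ex.v .h) (Ex.v .n)) rowBody

/-- Read the edges. -/
def readEdges : Cmd := .set .j 3 ;; edgeLoop 1 addDir ;; edgeLoop 2 addUnd

def fillBody : Cmd :=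
  .set .y (Ex.v .h) ;; .ite (.eq (Ex.a .blk (Ex.v .y)) 0) insertY .skip ;; .set .h (Ex.v .h + 1)

/-- Put the vertices without parents into the buckets. -/
def fillBuckets : Cmd := .set .h 0 ;; .loop (.lt (Ex.v .h) (Ex.v .n)) fillBody

def prepare : Cmd := rows ;; readEdges ;; fillBuckets

/-- The state at the start. -/
def St.zero : St := ⟨fun _ => 0, fun _ _ => 0, []⟩

theorem rows_wp (hR : Room μ n) (hin : Input dirE undE μ) :
    wp μ rows (40 * (n + 1)) (fun σ' => Fr [.row] [.n, .h] St.zero σ' ∧ σ'.v .n = n ∧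
      ∀ x ≤ n, σ'.a .row x = x * n) St.zero := by
  have e1 : rowBody.cost ≤ 35 := by decide
  have ec : (Ex.v .n).cost = 1 := rfl
  have hb := hin.base
  have hB : 64 + μ.B ≤ μ.lim := by unfold Room at hR; omega
  refine wp_mono (wp_seq (k1 := 3) (k2 := 1 + 2 + n * (rowBody.cost + 1 + 2)) (wp_mono (wp_set (x := .n) (e := Ex.inp 0)
    (Q := fun σ' => σ' = St.zero.set .n n) (by simp; omega) (by simp [hin.size])) (by decide) ?_)) ?_
    fun _ => id
  · rintro _ rfl
    refine wp_mono (wp_for (e := Ex.v .n) (k := rowBody.cost) (N := n) (fun i σ' =>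
      σ'.v .h = i ∧ Fr [.row] [.n, .h] St.zero σ' ∧ σ'.v .n = n ∧ ∀ x ≤ i, σ'.a .row x = x * n)
      ?_ ?_ ?_) le_rfl fun σ' h => h.2
    · rintro i hi σ1 ⟨h1, -, h2, -⟩
      exact ⟨h1, trivial, h2⟩
    · rintro i hi σ1 ⟨h1, h2, h3, h4⟩
      have b1 := hR.small (j := i + 1) (by omega)
      have b2 := hR.idx (l := i + 1) (by omega) (Nat.zero_le (n + 2))
      have h5 := h4 i le_rfl
      have e : (i + 1) * n = i * n + n := by ring
      refine wp_of_vc _ ?_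
      simp [rowBody, h1, h3, h5, h2]
      repeat refine And.intro (by omega) ?_
      intro z hz
      rw [Function.update_apply]
      split_ifs with h
      · rw [h, e]
      · exact h4 z (by omega)
    · refine ⟨rfl, by simp, by simp, fun x hx => ?_⟩
      obtain rfl : x = 0 := by omega
      simp [St.zero]
  · have := Nat.mul_le_mul_left n (show rowBody.cost + 1 + 2 ≤ 40 by omega)
    omega

theorem readEdges_wp (hR : Room μ n) (hin : Input dirE undE μ) (hl : SuccList G sl)
    (hsl : sl = succs (arcs dirE undE)) (h0 : Fr [.row] [.n, .h] St.zero σ) (hn : σ.v .n = n)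
    (hrow : ∀ x ≤ n, σ.a .row x = x * n) :
    wp μ readEdges (300 * (dirE.length + undE.length + 1))
      (Reading (arcs dirE undE) (dirE ++ undE) dirE St.zero) σ := by
  have hB : 64 + μ.B ≤ μ.lim := by unfold Room at hR; omega
  have hbase := hin.base
  have e1 : addDir.cost ≤ 200 := by decide
  have e2 : addUnd.cost ≤ 250 := by decide
  have hr0 : Reading (dirArcs (dirE.take 0)) (dirE.take 0) (dirE.take 0) St.zero σ := by
    have hz : ∀ id, id ≠ .row → σ.a id = fun _ => 0 := fun id hid => by
      rw [h0.arr id (by simpa using hid)]; rfl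
    exact ⟨⟨hn, hrow, by simp [hz, dirArcs, succs], by simp [dirArcs, succs],
      by simp [dirArcs, succs]⟩, fun x y => by simp [hz], fun y => by simp [hz],
      h0.mono (by simp) (by simp)⟩
  have h1 : wp μ (.set .j 3) 2 (fun σ' => Reading (dirArcs (dirE.take 0)) (dirE.take 0)
      (dirE.take 0) St.zero σ' ∧ σ'.v .j = 3) σ :=
    wp_set (x := .j) (e := 3) (by simp; omega) ⟨hr0.fr' (by simp), by simp⟩
  refine wp_mono (wp_seq (wp_mono h1 le_rfl fun σ1 ⟨w1, j1⟩ => wp_seq (wp_mono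
    (edgeLoop_wp (K := addDir.cost) hB (by omega) hin.dir le_rfl hin.numDir
      (fun i σ' => Reading (dirArcs (dirE.take i)) (dirE.take i) (dirE.take i) St.zero σ')
      (fun i σ σ' h hf => h.fr' hf) ?_ w1 j1) le_rfl fun σ2 ⟨w2, j2⟩ =>
    wp_mono (edgeLoop_wp (K := addUnd.cost) hB (by omega) hin.und (by omega) hin.numUnd
      (fun i σ' => Reading (dirArcs dirE ++ undArcs (undE.take i)) (dirE ++ undE.take i) dirE
        St.zero σ')
      (fun i σ σ' h hf => h.fr' hf) ?_ (by simpa [undArcs] using w2) j2) le_rfl ?_))) ?_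
      fun _ => id
  · intro i hi σ3 w3 hx hy
    have htake : dirE.take (i + 1) = dirE.take i ++ [dirE[i]] := List.take_succ_eq_append_getElem hi
    have harc : dirArcs (dirE.take (i + 1)) = dirArcs (dirE.take i) ++ dirArcs [dirE[i]] := by
      rw [htake]; simp only [dirArcs, List.map_append]
    refine wp_of_vc _ (Cmd.vc_mono _ (addDir_vc hR hl hsl w3 (e := dirE[i]) ?_ ?_ hx hy) ?_)
    · rw [← harc]
      refine List.IsPrefix.trans ?_ (List.prefix_append _ _)
      unfold dirArcs
      exact (List.take_prefix _ _).map _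
    · have := List.length_take_le i dirE; omega
    · rintro σ4 ⟨g1, g2⟩
      rw [harc, htake]
      exact ⟨g1, g2.var _ (by simp), g2.var _ (by simp)⟩
  · intro i hi σ3 w3 hx hy
    have htake : undE.take (i + 1) = undE.take i ++ [undE[i]] := List.take_succ_eq_append_getElem hi
    have harc : undArcs (undE.take (i + 1)) = undArcs (undE.take i) ++ undArcs [undE[i]] := by
      rw [htake]; simp only [undArcs, List.flatMap_append]
    refine wp_of_vc _ (Cmd.vc_mono _ (addUnd_vc hR hl hsl w3 (e := undE[i]) ?_ hx hy) ?_)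
    · rw [List.append_assoc, ← harc, arcs, List.prefix_append_right_inj]
      refine ⟨undArcs (undE.drop (i + 1)), ?_⟩
      unfold undArcs
      rw [← List.flatMap_append, List.take_append_drop]
    · rintro σ4 ⟨g1, g2⟩
      rw [harc, htake, ← List.append_assoc, ← List.append_assoc]
      exact ⟨g1, g2.var _ (by simp), g2.var _ (by simp)⟩
  · rintro σ3 ⟨w3, -⟩
    rwa [List.take_length] at w3
  · have g1 := Nat.mul_le_mul_left dirE.length (show addDir.cost + 40 ≤ 300 by omega)
    have g2 := Nat.mul_le_mul_left undE.length (show addUnd.cost + 40 ≤ 300 by omega)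
    omega

theorem lab_empty : lab G ∅ x = 0 := by simp [lab]

theorem fillBuckets_wp (hR : Room μ n) (hS : Stat G sl σ)
    (hlab : ∀ y : Fin n, σ.a .lab y = 0) (hblk : ∀ y : Fin n, σ.a .blk y = blk G ∅ y)
    (h0 : ∀ l, σ.a .blen l = 0) :
    wp μ fillBuckets (200 * (n + 1)) (fun σ' => DynX G ∅ σ' ∧
      Fr [.bkt, .blen, .pos] [.h, .y, .b] σ σ') σ := by
  have e1 : fillBody.cost ≤ 150 := by decide
  have ec : (Ex.v .n).cost = 1 := rfl
  have b0 := hR.small (j := 0) (by omega)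
  refine wp_mono (wp_seq (k1 := 2) (k2 := 1 + 2 + n * (fillBody.cost + 1 + 2))
    (wp_mono (wp_set (x := .h) (e := 0)
    (Q := fun σ' => σ' = σ.set .h 0) (by simp; omega) (by simp)) (by decide) ?_)) ?_
    fun _ => id
  · rintro _ rfl
    refine wp_mono (wp_for (e := Ex.v .n) (k := fillBody.cost) (N := n) (fun i σ' =>
      σ'.v .h = i ∧ Fr [.bkt, .blen, .pos] [.h, .y, .b] σ σ' ∧
      Lists (lab G ∅) (Finset.univ.filter fun y : Fin n => blk G ∅ y = 0 ∧ y < i) σ')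
      ?_ ?_ ?_) le_rfl ?_
    · rintro i hi σ1 ⟨h1, h2, -⟩
      exact ⟨h1, trivial, (h2.var _ (by simp)).trans hS.size⟩
    · rintro i hi σ1 ⟨h1, h2, h3⟩
      have b1 := hR.small (j := i) (by omega)
      have hF1 : Fr [] [.y] σ1 (σ1.set .y i) := by simp
      have hF2 : Fr [.bkt, .blen, .pos] [.h, .y, .b] σ (σ1.set .y i) :=
        h2.sub hF1 (by simp) (by simp)
      have hb1 : (σ1.set .y i).a .blk i = blk G ∅ (⟨i, hi⟩ : Fin n) := by
        rw [hF2.arr _ (by simp)]; exact hblk ⟨i, hi⟩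
      have hvy : (σ1.set .y i).v .y = i := by simp
      have hvh : (σ1.set .y i).v .h = i := by simp [h1]
      refine wp_of_vc _ ⟨trivial, ?_⟩
      rw [show (Ex.v .h).eval μ σ1 = i from h1]
      have hL1 := h3.fr hF1 (by simp) (fun _ _ => rfl) rfl
      generalize σ1.set .y i = σ2 at *
      refine ⟨by simp [hvy]; omega, fun hh => ?_, fun hh => ?_⟩
      · simp [hvy, hb1] at hh
        refine Cmd.vc_mono _ (insertY_vc hR (hS.fr hF2 (by decide) (by decide)) hL1
          (fun _ => lab_le_size) (y := ⟨i, hi⟩) (by simp) hvy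
          (by rw [lab_empty, hF2.arr _ (by simp)]; exact hlab ⟨i, hi⟩)) ?_
        rintro σ3 ⟨g1, g2⟩
        have hv3 : σ3.v .h = i := by rw [g2.var _ (by simp), hvh]
        have hF3 : Fr [.bkt, .blen, .pos] [.h, .y, .b] σ σ3 := hF2.sub g2 (by simp) (by simp)
        simp [hv3, hF3]
        refine ⟨by omega, g1.fr (as := []) (vs := [.h]) (by simp) (by simp) (fun _ _ => rfl) ?_⟩
        ext z
        simp only [Finset.mem_filter, Finset.mem_univ, true_and, Finset.mem_insert, Fin.ext_iff]
        constructor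
        · rintro ⟨k1, k2⟩
          by_cases h : (z : ℕ) = i
          · exact Or.inl h
          · exact Or.inr ⟨k1, by omega⟩
        · rintro (h | ⟨k1, k2⟩)
          · obtain rfl : z = ⟨i, hi⟩ := Fin.ext h
            exact ⟨hh, by simp⟩
          · exact ⟨k1, by omega⟩
      · simp [hvy, hb1] at hh
        simp [hvh, hF2]
        refine ⟨by omega, hL1.fr (as := []) (vs := [.h]) (by simp) (by simp) (fun _ _ => rfl) ?_⟩
        ext z
        simp only [Finset.mem_filter, Finset.mem_univ, true_and]
        refine and_congr_right fun k1 => ?_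
        have : (z : ℕ) ≠ i := fun h => hh (by rw [← k1]; congr 1; exact Fin.ext h.symm)
        omega
    · refine ⟨by simp, by simp, ?_, ?_, ?_⟩
      · simp
      · simp
      · simp [h0]
    · rintro σ1 ⟨-, h2, h3⟩
      refine ⟨⟨fun y => ?_, fun y => ?_, ?_⟩, h2⟩
      · rw [h2.arr _ (by simp), hlab, lab_empty]
      · rw [h2.arr _ (by simp), hblk]
      · simpa using h3
  · have := Nat.mul_le_mul_left n (show fillBody.cost + 1 + 2 ≤ 160 by omega)
    omega

theorem blk_empty (hE : IsEdgeListing G dirE undE) :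
    blk G ∅ y = (dirE.filter fun e => e.2 = y).length := by
  classical
  have h1 : ((dirE.filter fun e => e.2 = y).map Prod.fst).Nodup := by
    refine List.Nodup.map_on ?_ (hE.nodup_dir.filter _)
    rintro ⟨a, b⟩ h ⟨a', b'⟩ h' e
    simp only [List.mem_filter, decide_eq_true_eq] at h h' e
    rw [e, h.2, h'.2]
  unfold blk
  rw [← List.length_map (f := Prod.fst), ← List.toFinset_card_of_nodup h1]
  simp only [Finset.notMem_empty, if_false, add_zero]
  congr 1
  ext u
  simp [mem_openParents, hE.mem_dir]

theorem prepare_wp (hG : IsMPDAG G) (hE : IsEdgeListing G dirE undE) (hR : Room μ n)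
    (hin : Input dirE undE μ) :
    wp μ prepare (600 * (n + (dirE.length + undE.length) + 1)) (fun σ' =>
      Inv G (succs (arcs dirE undE)) [] σ' ∧ σ'.v .i = 0 ∧ (∀ v : Fin n, σ'.a .last v = 0) ∧
      σ'.out = []) St.zero := by
  have hl := succList_arcs hG.loopless hE
  refine wp_mono (wp_seq (wp_mono (rows_wp hR hin) le_rfl fun σ1 ⟨f1, f2, f3⟩ =>
    wp_seq (k2 := 200 * (n + 1)) (wp_mono (readEdges_wp hR hin hl rfl f1 f2 f3) le_rfl fun σ2 hr => ?_))) ?_ fun _ => id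
  · have hz : ∀ id, id ∉ [Arr.row, .tgt, .flg, .deg, .adj, .blk] → σ2.a id = fun _ => 0 :=
      fun id hid => by rw [hr.fr.arr id hid]; rfl
    have hS : Stat G (succs (arcs dirE undE)) σ2 := by
      refine ⟨hr.arcs.size, hr.arcs.row, hr.arcs.deg, hr.arcs.tgt, hr.arcs.flg, fun x y => ?_⟩
      rw [hr.adj, adjacent_iff, List.mem_append, List.mem_append, hE.mem_dir, hE.mem_dir,
        ← hE.mem_und]
      tauto
    refine wp_mono (fillBuckets_wp hR hS (by simp [hz]) (fun y => by rw [hr.count, blk_empty hE])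
      (by simp [hz])) le_rfl ?_
    rintro σ3 ⟨hD, hF⟩
    have hz3 : ∀ id, id ∉ [Arr.row, .tgt, .flg, .deg, .adj, .blk, .bkt, .blen, .pos] →
        σ3.a id = fun _ => 0 := by
      intro id hid
      rw [hF.arr id (by simp at hid ⊢; tauto), hz id (by simp at hid ⊢; tauto)]
    have hv3 : ∀ x, x ∉ [Var.n, .x, .y, .j, .h, .b] → σ3.v x = 0 := by
      intro x hx
      rw [hF.var x (by simp at hx ⊢; tauto), hr.fr.var x (by simp at hx ⊢; tauto)]
      rfl
    exact ⟨⟨hS.fr hF (by decide) (by decide), .nil, hv3 _ (by simp), by simp, by simp, hD,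
      by simp [hz3], by simp⟩, hv3 _ (by simp), by simp [hz3], by rw [hF.out, hr.fr.out]; rfl⟩
  · omega

end WordRAM

/-! ### From leaf to leaf -/

namespace WordRAM

open CausalGraph

variable {n : ℕ} {μ : Mach} {G D : Digraph (Fin n)} {sl : Fin n → List (Fin n × ℕ)} {σ σ' : St}
  {X : Finset (Fin n)} {x y : Fin n} {L : ℕ} {xs : List (Fin n)}
  {es dirE undE : List (Fin n × Fin n)}

/-! ### The enumeration -/

/-- Find the first leaf of the search tree. -/
def start : Cmd := prepare ;; descend ;; check

/-- Move on to the next leaf of the search tree. -/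
def next : Cmd := .set .run 0 ;; ascend ;; .ite (.lt 0 (Ex.v .run)) descend .skip

theorem mem_of_length_eq (hn : xs.Nodup) (h : xs.length = n) (v : Fin n) : v ∈ xs := by
  have h1 := List.toFinset_card_of_nodup hn
  rw [h] at h1
  have h2 : xs.toFinset = Finset.univ := Finset.eq_univ_of_card _ (by simpa using h1)
  rw [← List.mem_toFinset, h2]
  exact Finset.mem_univ v

theorem Inv.time_eq (hI : Inv G sl xs σ) (h : xs.length = n) (v : Fin n) :
    σ.a .time v = xs.idxOf v := by
  have hv := List.idxOf_lt_length_iff.2 (mem_of_length_eq hI.mcs.nodup h v)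
  have := hI.time _ hv
  rwa [List.getElem_idxOf] at this

theorem Inv.order (hI : Inv G sl xs σ) (h : xs.length = n) :
    Order G sl (fun v => xs.idxOf v) σ where
  stat := hI.stat
  time := hI.time_eq h
  ord := fun v => by
    have hv := List.idxOf_lt_length_iff.2 (mem_of_length_eq hI.mcs.nodup h v)
    have := hI.ord _ hv
    rwa [List.getElem_idxOf] at this
  lt := fun v => by
    have hv := List.idxOf_lt_length_iff.2 (mem_of_length_eq hI.mcs.nodup h v)
    omega

theorem descPot_le {i : ℕ} (hi : i ≤ n) :
    descPot G sl X i ≤ 4 * ∑ z, wt sl z := by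
  have h1 : ∑ z ∈ Xᶜ, wt sl z ≤ ∑ z, wt sl z :=
    Finset.sum_le_sum_of_subset (Finset.subset_univ _)
  have h2 : n ≤ ∑ z, wt sl z := by
    calc n = ∑ _z : Fin n, 1 := by simp
      _ ≤ _ := Finset.sum_le_sum fun z _ => by unfold wt; omega
  unfold descPot
  omega

theorem sum_wt_arcs :
    ∑ z, wt (succs (arcs dirE undE)) z = n + (dirE.length + 2 * undE.length) := by
  unfold wt
  rw [Finset.sum_add_distrib, sum_length_succs, length_arcs]
  simp; omega

/-- At the empty path nothing is pending and every extension is compatible, so the first descent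
leaves all extensions to be written. The test then sets `run` according to whether there are any. -/
theorem start_wp (hG : IsMPDAG G) (hE : IsEdgeListing G dirE undE) (hR : Room μ n)
    (hin : Input dirE undE μ) :
    wp μ start (20000 * (n + (dirE.length + undE.length) + 1)) (fun σ' => σ'.out = [] ∧
      ∃ xs, xs.length = n ∧ Inv G (succs (arcs dirE undE)) xs σ' ∧
      Todo G xs σ' = {D | IsConsistentExtension D G} ∧
      (0 < σ'.v .run ∧ (∃ D, IsConsistentExtension D G) ∨
       σ'.v .run = 0 ∧ ∀ D, ¬ IsConsistentExtension D G)) St.zero := by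
  have hl := succList_arcs hG.loopless hE
  refine wp_mono (wp_seq (wp_mono (prepare_wp hG hE hR hin) le_rfl fun σ1 ⟨i1, i2, i3, i4⟩ =>
    wp_seq (k1 := 1000 * (4 * ∑ z, wt (succs (arcs dirE undE)) z) + 10)
      (k2 := 400 * (undE.length + 1))
      (wp_mono (descend_wp hG hR hl i1 ⟨by omega, fun y _ => ?_⟩) ?_
      fun σ2 ⟨xs, d1, d2, d3, d4, d5, _⟩ => ?_))) ?_ fun _ => id
  · simp [lab]
  · have := descPot_le (G := G) (sl := succs (arcs dirE undE)) (X := ([] : List (Fin n)).toFinset) (i := σ1.v .i) (by omega)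
    omega
  · have hall := mem_of_length_eq d2.mcs.nodup d1
    refine wp_mono (check_wp hR hin (idxOf_injective hall) (d2.order d1)
      (fun v => by rw [d5]; exact i3 v)) le_rfl ?_
    rintro σ3 ⟨f, h⟩
    have hI3 : Inv G (succs (arcs dirE undE)) xs σ3 := d2.fr f (by simp) (by simp)
    refine ⟨by rw [f.out, d4, i4], xs, d1, hI3, ?_, ?_⟩
    · rw [(SameLow.of_fr (n := n) (L := xs.length) f (by simp)).todo le_rfl, d3]
      ext D
      simp [Todo, inExt_nil, not_pending_nil]
    · refine h.imp (fun ⟨h1, h2⟩ => ⟨by omega, _, extension_of_lastAdj hG hE hI3.mcs hall h2⟩)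
        (fun ⟨h1, h2⟩ => ⟨h1, fun D => not_extension_of_not_lastAdj hG hE hI3.mcs hall h2⟩)
  · rw [sum_wt_arcs]; omega

/-- What remains at the new leaf is exactly what was pending at the old one. The cost is one ascent
and at most one descent, whose potential is at most four times the total weight. -/
theorem next_wp (hG : IsMPDAG G) (hR : Room μ n) (hl : SuccList G sl) (hI : Inv G sl xs σ) :
    wp μ next (20000 * ∑ z, wt sl z + 400) (fun σ' => σ'.out = σ.out ∧
      (σ'.v .run = 0 ∧ (∀ D, ¬ Pending G xs (remAll G xs σ) D) ∨
       0 < σ'.v .run ∧ ∃ ys, ys.length = n ∧ Inv G sl ys σ' ∧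
        Todo G ys σ' = {D | Pending G xs (remAll G xs σ) D})) σ := by
  have b0 := hR.small (j := 0) (by omega)
  have hF0 : Fr [] [.run] σ (σ.set .run 0) := by simp
  have hrun0 : (σ.set .run 0).v .run = 0 := by simp
  have ht : (Tst.lt 0 (Ex.v .run)).cost = 2 := rfl
  refine wp_mono (wp_seq (k1 := 2) (k2 := (10 * KB * ∑ z, wt sl z + 300) +
      (3 + (1000 * (4 * ∑ z, wt sl z) + 10)))
    (wp_mono (wp_set (x := .run) (e := 0) (Q := fun σ' => σ' = σ.set .run 0) (by simp; omega)
      (by simp)) (by decide) ?_)) (by unfold KB; omega) fun _ => id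
  rintro _ rfl
  have hI0 : Inv G sl xs (σ.set .run 0) := hI.fr hF0 (by simp) (by simp)
  have hP0 : ∀ D, Pending G xs (remAll G xs (σ.set .run 0)) D ↔ Pending G xs (remAll G xs σ) D :=
    fun D => (SameLow.of_fr (n := n) (L := xs.length) hF0 (by simp)).pending le_rfl
  have ho : (σ.set .run 0).out = σ.out := rfl
  generalize σ.set .run 0 = σ1 at *
  refine wp_seq (wp_mono (ascend_wp hG hR hl hI0 hrun0) le_rfl ?_)
  rintro σ2 ⟨h0, h | ⟨h1, h2, ys, h3, h4, h5⟩⟩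
  · refine wp_mono (wp_ite (k := 1) (by simp; omega) (fun hh => ?_) (fun _ => wp_skip
      ⟨h0.trans ho, Or.inl ⟨h.1, fun D hD => h.2 D ((hP0 D).2 hD)⟩⟩)) (by omega) fun _ => id
    simp [h.1] at hh
  · refine wp_ite (k := 1000 * (4 * ∑ z, wt sl z) + 10) (by simp; omega) (fun hh => ?_) (fun hh => ?_)
    · have hp := descPot_le (G := G) (sl := sl) (X := ys.toFinset) h4.1
      refine wp_mono (wp_mono (descend_wp hG hR hl h3 h4) (by omega) ?_) le_rfl fun _ => id
      rintro σ3 ⟨zs, g1, g2, g3, g5, -, g4⟩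
      refine ⟨g5.trans (h0.trans ho), Or.inr ⟨?_, zs, g1, g2, ?_⟩⟩
      · simpa [g4] using hh
      · rw [g3, h5]
        ext D; exact hP0 D
    · simp [h2] at hh
      omega

end WordRAM

/-! ### The main loop and its delay -/

namespace WordRAM

open CausalGraph

variable {n : ℕ} {μ : Mach} {G D : Digraph (Fin n)} {sl : Fin n → List (Fin n × ℕ)} {σ σ' : St}
  {xs : List (Fin n)} {es dirE undE : List (Fin n × Fin n)}

/-! ### The main loop -/

/-- There is an extension to be written. -/
def running : Tst := .lt 0 (Ex.v .run)

/-- Write an extension and move on to the next one. -/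
def mainBody : Prog := .seq output.comp (.seq .finish (.seq next.comp running.comp))

/-- The program after the computation of the first address of the arrays. -/
def enumerate : Prog := .seq start.comp (.seq running.comp (.loop running.test mainBody))

theorem todo_of_isConsistentExtension (hG : IsMPDAG G) (hI : Inv G sl xs σ) (h : xs.length = n)
    {D₀ : Digraph (Fin n)} (hD₀ : IsConsistentExtension D₀ G) :
    D ∈ Todo G xs σ ↔ D = orient G (fun v => xs.idxOf v) ∨ Pending G xs (remAll G xs σ) D := by
  have hall := mem_of_length_eq hI.mcs.nodup h
  rw [Todo, Set.mem_ofPred_eq, inExt_orient hG hI.mcs hall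
    (hI.mcs.orient_isConsistentExtension hG hall (hI.mcs.moral hG hD₀ hall))]

theorem not_pending_orient (hG : IsMPDAG G) (hI : Inv G sl xs σ) (h : xs.length = n)
    {D₀ : Digraph (Fin n)} (hD₀ : IsConsistentExtension D₀ G) :
    ¬ Pending G xs (remAll G xs σ) (orient G fun v => xs.idxOf v) := by
  have hall := mem_of_length_eq hI.mcs.nodup h
  exact not_pending_of_inExt hG hI.mcs hI.remOk ((inExt_orient hG hI.mcs hall
    (hI.mcs.orient_isConsistentExtension hG hall (hI.mcs.moral hG hD₀ hall))).2 rfl)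

/-- From state `s`, the program `P` writes the extensions in `S`, if it is started after at most
`d₀` silent steps and is granted a delay of `d` steps. -/
def Enumerates (W d₀ d : ℕ) (P : Prog) (s : State) (S : Set (Digraph (Fin n))) : Prop :=
  ∃ t s' sols, ∃ Ds : List (Digraph (Fin n)), Exec W P s t s' ∧
    (∀ pre, Event.done ∉ pre → written pre = [] → pre.length ≤ d₀ →
      OutputsWithDelay d (pre ++ t) sols) ∧
    List.Forall₂ Encodes sols Ds ∧ Ds.Nodup ∧ ∀ D, D ∈ Ds ↔ D ∈ S

theorem enumerates_loop_false {W d₀ d : ℕ} {b : Test} {P : Prog} {s : State}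
    {S : Set (Digraph (Fin n))} (hb : ¬ b.Holds s) (hS : ∀ D, D ∉ S) (hd : d₀ + 1 ≤ d) :
    Enumerates W d₀ d (.loop b P) s S := by
  refine ⟨_, _, [], [], Exec.loop_false hb, fun pre h1 h2 h3 => .halt ?_ ?_ ?_, .nil, .nil, ?_⟩
  · simp [h1]
  · rw [written_append, h2]; rfl
  · simp; omega
  · simpa using hS

theorem Rep.congr_out {σ σ' : St} {s : State} (h : Rep μ σ s) (hv : σ'.v = σ.v) (ha : σ'.a = σ.a) :
    Rep μ σ' s :=
  ⟨fun x => by rw [hv]; exact h.var x, h.base, fun id i => by rw [ha]; exact h.arr id i, h.inp⟩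

theorem running_exec (hR : Room μ n) {s : State} (hs : Rep μ σ s) :
    ∃ s', Exec μ.W running.comp s (sil 2) s' ∧ Rep μ σ s' ∧
      (running.test.Holds s' ↔ 0 < σ.v .run) := by
  have := hR.small (j := 0) (by omega)
  exact running.comp_exec hs (by simp [running]; omega)

/-- The steps after the end mark are kept apart as `t₂`, because they count towards the delay of the
next solution. -/
theorem mainBody_exec (hG : IsMPDAG G) (hR : Room μ n)
    (hin : Input dirE undE μ) (hl : SuccList G sl) (hI : Inv G sl xs σ) (h : xs.length = n)
    {s : State} (hs : Rep μ σ s) :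
    ∃ t₁ t₂ s' σ', Exec μ.W mainBody s (t₁ ++ ([.done] ++ t₂)) s' ∧ Rep μ σ' s' ∧
      Event.done ∉ t₁ ∧ t₁.length ≤ 200 * (dirE.length + undE.length + 1) ∧
      written t₁ = edgeWords (dirE ++ undE.map (orientEdge fun v => xs.idxOf v)) ∧
      Event.done ∉ t₂ ∧ t₂.length ≤ 20000 * ∑ z, wt sl z + 402 ∧ written t₂ = [] ∧
      (running.test.Holds s' ↔ 0 < σ'.v .run) ∧
      (σ'.v .run = 0 ∧ (∀ D, ¬ Pending G xs (remAll G xs σ) D) ∨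
       0 < σ'.v .run ∧ ∃ ys, ys.length = n ∧ Inv G sl ys σ' ∧
        Todo G ys σ' = {D | Pending G xs (remAll G xs σ) D}) := by
  obtain ⟨t₁, s1, σ1, x1, r1, n1, o1, l1, w1⟩ := output_wp hR hin (hI.time_eq h) s hs
  -- The representation of a state does not involve the words written, so the log may be reset; then
  -- writing a solution falls under the frame rule.
  have hF : Fr [] [.x, .y, .j, .h] σ { σ1 with out := σ.out } :=
    ⟨fun id _ => congrFun w1.a id, w1.v, rfl⟩
  have r2 : Rep μ { σ1 with out := σ.out } s1 := r1.congr_out rfl rfl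
  have hI2 := hI.fr hF (by simp) (by simp)
  have hP : ∀ D, Pending G xs (remAll G xs { σ1 with out := σ.out }) D ↔
      Pending G xs (remAll G xs σ) D :=
    fun D => (SameLow.of_fr (n := n) (L := xs.length) hF (by simp)).pending le_rfl
  obtain ⟨t₂, s3, σ3, x3, r3, n3, o3, l3, e3, h3⟩ := next_wp hG hR hl hI2 s1 r2
  simp only [hP] at h3
  obtain ⟨s4, x4, r4, v4⟩ := running_exec hR r3
  refine ⟨t₁, t₂ ++ sil 2, s4, σ3, x1.seq ((Exec.finish s1).seq (x3.seq x4)), r4, n1, l1, ?_, ?_,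
    ?_, ?_, v4, h3⟩
  · have := w1.out
    rw [o1] at this
    exact List.append_cancel_left this
  · simp [n3, done_notMem_sil]
  · rw [List.length_append, length_sil]; omega
  · rw [e3] at o3
    rw [written_append, written_sil, List.append_nil]
    exact List.self_eq_append_right.1 o3

/-- Induction on the number of extensions left. A round writes the orientation along the current
order, which is not pending, so exactly the pending ones remain. The extension `D₀` guarantees that
every leaf is valid. -/
theorem mainLoop_exec (hG : IsMPDAG G) (hE : IsEdgeListing G dirE undE) (hR : Room μ n)
    (hin : Input dirE undE μ) (hl : SuccList G sl) {d₀ d : ℕ}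
    (hd₀ : 20000 * ∑ z, wt sl z + 402 ≤ d₀)
    (hd : d₀ + 200 * (dirE.length + undE.length + 1) + 2 ≤ d)
    {D₀ : Digraph (Fin n)} (hD₀ : IsConsistentExtension D₀ G)
    (hI : Inv G sl xs σ) (h : xs.length = n) {s : State} (hs : Rep μ σ s)
    (ht : running.test.Holds s) :
    Enumerates μ.W d₀ d (.loop running.test mainBody) s (Todo G xs σ) := by
  induction hc : (Todo G xs σ).ncard using Nat.strong_induction_on generalizing xs σ s with
  | _ c ih =>
  subst hc
  have hall := mem_of_length_eq hI.mcs.nodup h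
  obtain ⟨t₁, t₂, s', σ', x1, r1, n1, l1, o1, n2, l2, o2, hb, hnext⟩ :=
    mainBody_exec hG hR hin hl hI h hs
  have hmem := fun D => todo_of_isConsistentExtension (D := D) hG hI h hD₀
  have hnot := not_pending_orient hG hI h hD₀
  obtain ⟨t₃, s3, sols, Ds, x3, d3, f3, u3, m3⟩ : Enumerates μ.W d₀ d
      (.loop running.test mainBody) s' {D | Pending G xs (remAll G xs σ) D} := by
    rcases hnext with ⟨h0, hno⟩ | ⟨h0, ys, hy, hI', hT⟩
    · exact enumerates_loop_false (by rw [hb]; omega) hno (by omega)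
    · rw [← hT]
      refine ih _ ?_ hI' hy r1 (hb.2 h0) rfl
      rw [hT]
      refine Set.ncard_lt_ncard ⟨fun D hD => (hmem D).2 (Or.inr hD), fun hsub => ?_⟩
        (Set.toFinite _)
      exact hnot (hsub ((hmem _).2 (Or.inl rfl)))
  refine ⟨_, s3, _ :: sols, orient G (fun v => xs.idxOf v) :: Ds, Exec.loop_true ht x1 x3, ?_,
    .cons (encodes_orient hG.loopless hE (idxOf_injective hall)) f3, ?_, ?_⟩
  -- The delay consists of the silent steps `pre` since the previous solution, the loop test, the
  -- output, and the end mark.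
  · intro pre p1 p2 p3
    have := OutputsWithDelay.next (d := d) (t := pre ++ (.silent :: t₁)) (by simp [p1, n1])
      (by simp; omega) (d3 t₂ n2 o2 (l2.trans hd₀))
    rw [written_append, p2, List.nil_append,
      show written (.silent :: t₁) = written t₁ from rfl, o1] at this
    simpa using this
  · exact List.nodup_cons.2 ⟨fun hD => hnot ((m3 _).1 hD), u3⟩
  · intro D
    rw [List.mem_cons, m3, hmem]; rfl

theorem enumerate_exec (hG : IsMPDAG G) (hE : IsEdgeListing G dirE undE) (hR : Room μ n)
    (hin : Input dirE undE μ) {s : State} (hs : Rep μ St.zero s) :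
    Enumerates μ.W 8 (50000 * (n + (dirE.length + undE.length) + 1)) enumerate s
      {D | IsConsistentExtension D G} := by
  have hsum := sum_wt_arcs (dirE := dirE) (undE := undE)
  have hl := succList_arcs hG.loopless hE
  obtain ⟨t, s1, σ1, x1, r1, n1, o1, l1, e1, xs, h1, hI, hT, hrun⟩ := start_wp hG hE hR hin s hs
  obtain ⟨s2, x2, r2, v2⟩ := running_exec hR r1
  have hw : written t = [] := by simpa [St.zero, e1] using o1
  -- The number of silent steps allowed before the loop covers both the initial phase and the
  -- transition between two leaves; the total weight is n plus the number of directed and twice the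
  -- number of undirected edges.
  have key : Enumerates μ.W (20000 * ∑ z, wt (succs (arcs dirE undE)) z + 20500)
      (50000 * (n + (dirE.length + undE.length) + 1))
      (.loop running.test mainBody) s2 {D | IsConsistentExtension D G} := by
    rcases hrun with ⟨h0, D₀, hD₀⟩ | ⟨h0, hno⟩
    · rw [← hT]
      exact mainLoop_exec hG hE hR hin hl (by omega) (by omega) hD₀ hI h1 r2 (v2.2 h0)
    · exact enumerates_loop_false (by rw [v2]; omega) hno (by omega)
  obtain ⟨t₃, s3, sols, Ds, x3, d3, f3, u3, m3⟩ := key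
  refine ⟨_, s3, sols, Ds, x1.seq (x2.seq x3), fun pre p1 p2 p3 => ?_, f3, u3, m3⟩
  have := d3 (pre ++ (t ++ sil 2)) (by simp [p1, n1, done_notMem_sil])
    (by rw [written_append, written_append, p2, hw, written_sil]; rfl)
    (by simp [length_sil]; omega)
  simpa using this

end WordRAM

/-! ### Word size, memory layout, and the final assembly -/

namespace WordRAM

open CausalGraph

variable {n : ℕ} {μ : Mach} {G D : Digraph (Fin n)} {es dirE undE : List (Fin n × Fin n)}

/-! ### The machine and its input -/

theorem edgeWords_length (es : List (Fin n × Fin n)) : (edgeWords es).length = 2 * es.length := by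
  induction es with
  | nil => rfl
  | cons e es ih =>
    rw [← List.singleton_append, edgeWords_append, List.length_append, ih, List.length_append,
      edgeWords_singleton]
    simp; omega

theorem getD_edgeWords (pre post : List ℕ) (es : List (Fin n × Fin n)) (i : ℕ)
    (hi : i < es.length) :
    (pre ++ (edgeWords es ++ post)).getD (pre.length + 2 * i) 0 = (es[i].1 : ℕ) ∧
    (pre ++ (edgeWords es ++ post)).getD (pre.length + 2 * i + 1) 0 = (es[i].2 : ℕ) := by
  induction es generalizing pre i with
  | nil => simp at hi
  | cons e es ih =>
    have he : edgeWords (e :: es) = [(e.1 : ℕ), (e.2 : ℕ)] ++ edgeWords es := rfl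
    rw [he]
    cases i with
    | zero => simp
    | succ i =>
      have := ih (pre ++ [(e.1 : ℕ), (e.2 : ℕ)]) i (by simpa using hi)
      simp only [List.length_append, List.length_cons, List.length_nil] at this
      simp only [List.append_assoc] at this ⊢
      rw [show pre.length + 2 * (i + 1) = pre.length + (0 + 1 + 1) + 2 * i by omega]
      simpa using this

/-- The machine on which the program is run with the given input. -/
def machine (dirE undE : List (Fin n × Fin n)) : Mach where
  W := (n + (dirE.length + undE.length) + 2) ^ 12
  B := 3 + 2 * dirE.length + 2 * undE.length
  lim := (n + 2) * (n + 2) + 64 + (3 + 2 * dirE.length + 2 * undE.length)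
  inp := fun i => (inputWords dirE undE).getD i 0
  hW := by
    set N := n + (dirE.length + undE.length) + 2 with hN
    have h1 : (n + 2) * (n + 2) ≤ N * N := Nat.mul_le_mul (by omega) (by omega)
    have h2 : 2 ^ 10 ≤ N ^ 10 := Nat.pow_le_pow_left (by omega) 10
    have h3 : 2 * 2 ≤ N * N := Nat.mul_le_mul (by omega) (by omega)
    have h4 : 2 * N ≤ N * N := Nat.mul_le_mul_right N (by omega)
    -- All addresses are below a constant multiple of `N * N`, and since `N` is at least 2 the
    -- constant is absorbed by ten further factors; this gives the exponent 12.
    calc _ ≤ 2 ^ 10 * (N * N) := by omega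
      _ ≤ N ^ 10 * (N * N) := Nat.mul_le_mul_right _ h2
      _ = N ^ 12 := by ring

theorem room_machine : Room (machine dirE undE) n := le_rfl

theorem input_machine : Input dirE undE (machine dirE undE) where
  size := rfl
  numDir := rfl
  numUnd := rfl
  base := rfl
  dir := by
    have h := getD_edgeWords [n, dirE.length, undE.length] (edgeWords undE) dirE
    rw [← List.append_assoc] at h
    exact ⟨Nat.le_add_right _ _, fun i hi => (h i hi).1, fun i hi => (h i hi).2⟩
  und := by
    have h := getD_edgeWords ([n, dirE.length, undE.length] ++ edgeWords dirE) [] undE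
    rw [List.append_nil] at h
    have hl : ([n, dirE.length, undE.length] ++ edgeWords dirE).length = 3 + 2 * dirE.length := by
      rw [List.length_append, edgeWords_length]; rfl
    rw [hl] at h
    exact ⟨le_rfl, fun i hi => (h i hi).1, fun i hi => (h i hi).2⟩

/-- Compute the first address of the arrays. -/
def prelude : Prog :=
  .seq (.const 3 1) (.seq (.load 3 3) (.seq (.const 5 2) (.seq (.load 5 5)
    (.seq (.add 3 3 5) (.seq (.add 3 3 3) (.seq (.const 5 3) (.add 1 3 5)))))))

/-- Only the registers 1, 3 and 5 are written, so all variables keep the value 0, and all memory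
cells behind the input are 0, so every array is zero. -/
theorem prelude_exec (dirE undE : List (Fin n × Fin n)) :
    ∃ s, Exec (machine dirE undE).W prelude (init (inputWords dirE undE)) (sil 8) s ∧
      Rep (machine dirE undE) St.zero s := by
  have hW := (machine dirE undE).hW
  have hB : (machine dirE undE).B = 3 + 2 * dirE.length + 2 * undE.length := rfl
  have hlen : (inputWords dirE undE).length = 3 + 2 * dirE.length + 2 * undE.length := by
    simp [inputWords, edgeWords_length]; omega
  have e1 : (inputWords dirE undE).getD 1 0 = dirE.length := rfl
  have e2 : (inputWords dirE undE).getD 2 0 = undE.length := rfl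
  have hinp : (machine dirE undE).inp = fun i => (inputWords dirE undE).getD i 0 := rfl
  generalize machine dirE undE = μ at *
  refine ⟨_, (Exec.const _ _ _ ?_).seq ((Exec.load _ _ _).seq ((Exec.const _ _ _ ?_).seq
    ((Exec.load _ _ _).seq ((Exec.add _ _ _ _ ?_).seq ((Exec.add _ _ _ _ ?_).seq
    ((Exec.const _ _ _ ?_).seq (Exec.add _ _ _ _ ?_))))))), ?_⟩
  rotate_right
  · refine ⟨fun x => ?_, ?_, fun id i => ?_, fun i _ => ?_⟩
    · have h1 : 2 * x.code ≠ 1 := by omega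
      have h3 : 2 * x.code ≠ 3 := by omega
      have h5 : 2 * x.code ≠ 5 := by omega
      simp [State.setReg, init, h1, h3, h5, St.zero]
    · simp [State.setReg, init, e1, e2, hB, -List.getD_eq_getElem?_getD]
      omega
    · exact List.getD_eq_default _ _ (by rw [hlen]; omega)
    · rw [hinp]; rfl
  all_goals
    first
    | omega
    | simp [State.setReg, init, e1, e2, -List.getD_eq_getElem?_getD]
      omega

end WordRAM

theorem mainTheorem6 :
    ∃ (P : WordRAM.Prog) (C k : ℕ),
      ∀ (n : ℕ) (G : Digraph (Fin n)) (dirE undE : List (Fin n × Fin n)),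
        CausalGraph.IsMPDAG G → CausalGraph.IsEdgeListing G dirE undE →
        ∃ (t : List WordRAM.Event) (s : WordRAM.State)
          (sols : List (List ℕ)) (Ds : List (Digraph (Fin n))),
          WordRAM.Exec ((n + (dirE.length + undE.length) + 2) ^ k) P
            (WordRAM.init (CausalGraph.inputWords dirE undE)) t s ∧
          WordRAM.OutputsWithDelay (C * (n + (dirE.length + undE.length) + 1)) t sols ∧
          List.Forall₂ CausalGraph.Encodes sols Ds ∧
          Ds.Nodup ∧
          ∀ D : Digraph (Fin n), D ∈ Ds ↔ CausalGraph.IsConsistentExtension D G := by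
  -- The eight silent steps of the prelude are the initial steps that `enumerate_exec` grants before
  -- the enumeration.
  refine ⟨.seq WordRAM.prelude WordRAM.enumerate, 50000, 12, fun n G dirE undE hG hE => ?_⟩
  obtain ⟨s₁, x₁, r₁⟩ := WordRAM.prelude_exec dirE undE
  obtain ⟨t, s, sols, Ds, x₂, hd, hf, hn, hm⟩ :=
    WordRAM.enumerate_exec hG hE WordRAM.room_machine WordRAM.input_machine r₁
  exact ⟨_, s, sols, Ds, x₁.seq x₂, hd _ (WordRAM.done_notMem_sil 8) (WordRAM.written_sil 8)
    (WordRAM.length_sil 8).le, hf, hn, hm⟩
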